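/- Let $F$ be a distribution function on $\mathbb{R}$ in the domain of attraction of a stable distribution of index $\alpha\in(0,2)$, let $(X_i)_{i\ge1}$ be independent random variables with distribution function $F$, and write $\overline F=1-F$. Assume that the right tail of $F$ is not negligible: $\overline F(x)/P(|X_1|>x)$ does not tend to $0$ as $x\to\infty$ (that is, its limit $p$, which exists by tail balance, is positive). Let $(a_n)$ and $(b_n)$ be sequences of real numbers with $a_n\to-\infty$, $b_n\to+\infty$, and such that $\lim_{n\to\infty} b_n/(-a_n)$ exists and is positive or $+\infty$. Put $$\mu_n=\mathrm{E}\,X_i\mathbf 1_{[a_n,b_n]}(X_i),\qquad \sigma_n^2=\mathrm{E}\bigl(X_i\mathbf 1_{[a_n,b_n]}(X_i)-\mu_n\bigr)^2,\qquad Z_{i,n}=\frac{X_i\mathbf 1_{[a_n,b_n]}(X_i)-\mu_n}{\sigma_n}$$ ($\sigma_n>0$ for all $n$ large enough). Let $A_{i,n}$, $1\le i\le n$, $n\ge1$, be a triangular array of real constants such that $\sum_{1\le i\le n}A_{i,n}^2=1$ for every $n\ge 1$. Then $\sum_{1\le i\le n}A_{i,n}Z_{i,n}$ converges in distribution to the standard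 normal law $N(0,1)$ if and only if, for every $\lambda>0$, $$\lim_{n\to\infty}\sum_{1\le i\le n}A_{i,n}^2\,\mathbf 1\bigl\{|A_{i,n}|>\lambda\sqrt{\overline F(b_n)}\bigr\}=0.$$ -/

import Mathlib

open MeasureTheory ProbabilityTheory Filter Topology Asymptotics

noncomputable section

namespace TruncatedStable

/-- The tail `1 - F` of the distribution function of the law `F`. -/
def tail (F : Measure ℝ) (x : ℝ) : ℝ := 1 - cdf F x

/-- The tail of the distribution function of `|X|`, where `X` has law `F`. -/
def absTail (F : Measure ℝ) (x : ℝ) : ℝ := tail (F.map fun y : ℝ => |y|) x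

/-- The Lévy measure with density `p α x ^ (-α-1)` on the positive half-line and
`q α |x| ^ (-α-1)` on the negative half-line. -/
def stableLevyMeasure (α p q : ℝ) : Measure ℝ :=
  volume.withDensity fun x : ℝ => ENNReal.ofReal
    (if 0 < x then p * α * x ^ (-α - 1) else if x < 0 then q * α * |x| ^ (-α - 1) else 0)

/-- `G` is a (nondegenerate, not necessarily centered) stable law of index `α`, for `0 < α < 2`:
it is infinitely divisible without Gaussian part, and its Lévy measure is
`stableLevyMeasure α p q` with `p, q ≥ 0` not both zero. -/
def IsStableLaw (α : ℝ) (G : Measure ℝ) : Prop :=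
  ∃ p q γ : ℝ, 0 ≤ p ∧ 0 ≤ q ∧ 0 < p + q ∧ ∀ θ : ℝ,
    charFun G θ = Complex.exp (Complex.I * θ * γ +
      ∫ x : ℝ, (Complex.exp (Complex.I * θ * x) - 1
          - Complex.I * θ * (Set.Ioo (-1 : ℝ) 1).indicator (fun y => y) x)
        ∂(stableLevyMeasure α p q))

/-- `F` is in the domain of attraction of a stable law of index `α`: for some scalings `c n > 0`
and centerings `d n`, if `x₁, …, xₙ` are independent with law `F`, then
`(x₁ + ⋯ + xₙ - d n) / c n` converges in distribution to a stable law of index `α`. -/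
def InStableDomain (α : ℝ) (F : Measure ℝ) [IsProbabilityMeasure F] : Prop :=
  ∃ G : ProbabilityMeasure ℝ, IsStableLaw α (G : Measure ℝ) ∧
    ∃ c d : ℕ → ℝ, (∀ n, 0 < c n) ∧
      TendstoInDistribution (fun (n : ℕ) (x : Fin n → ℝ) => (∑ i, x i - d n) / c n) atTop
        (fun y : ℝ => y) (fun n => Measure.pi fun _ : Fin n => F) (G : Measure ℝ)

/-- The truncation `x 1_{[a,b]}(x)`. -/
def trunc (a b x : ℝ) : ℝ := (Set.Icc a b).indicator (fun y => y) x

/-- The mean of `X 1_{[a,b]}(X)`, where `X` has law `F`. -/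
def truncMean (F : Measure ℝ) (a b : ℝ) : ℝ := ∫ x, trunc a b x ∂F

/-- The standard deviation of `X 1_{[a,b]}(X)`, where `X` has law `F`. -/
def truncSD (F : Measure ℝ) (a b : ℝ) : ℝ :=
  Real.sqrt (∫ x, (trunc a b x - truncMean F a b) ^ 2 ∂F)

/-- The truncated, centered and standardized value of `x`. -/
def standardize (F : Measure ℝ) (a b x : ℝ) : ℝ :=
  (trunc a b x - truncMean F a b) / truncSD F a b

end TruncatedStable

end

/-! Write `T n = tail F (b n)` and let `Z n` be the standardized truncated variable. Regular
behaviour of the tail makes the variance of the truncated variable comparable to `b n ^ 2 * T n`.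
Hence `|Z n|` is at most a constant times `1 / √(T n)`. Conversely, on an event of probability at
least `T n`, namely `X ∈ (κ b n, b n]`, it differs from its typical values by at least a constant
times `1 / √(T n)`. So `√(T n)` is the scale at which a weight makes a single summand of order one.

If the weights above `l √(T n)` carry vanishing total square for every `l`, the other summands are
uniformly small and Lindeberg's comparison of characteristic functions gives the normal limit
(`tendsto_prod_charFun_of_tendsto_sum`). For the converse, let `φ` be the characteristic function of
`Z n`. Each `u ^ 2 - (1 - ‖φ u‖ ^ 2)` is nonnegative, being the mean of `v ^ 2 / 2 - (1 - cos v)` at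
`v = u (Z - Z')` with `Z'` an independent copy. Since `Z n → 0` in probability, normal convergence
forces the sum of these gaps over `u = A i n * t` to vanish, while a large weight, for suitable `t`,
has a gap of at least a constant times `A i n ^ 2` (`tendsto_sum_of_tendsto_prod_charFun`).

The facts needed on the tail (`tail_regularity`) are extracted from the definition of the domain of
attraction. Moduli of characteristic functions, which ignore centerings, give `c n → ∞` and `n / c n
^ 2 → 0`. The powers `φ_F ^ n`, with `φ_F` the characteristic function of `F`, may then be replaced
by `exp (n (φ_F - 1))`. Second differences in `θ` of the exponents remove drift and compensator and
turn the convergence into weak convergence of finite measures, hence vague convergence of `n` times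
the law of `X / c n` to the Lévy measure (`exists_scaling_of_inStableDomain`). -/

namespace TruncatedStable

/-! ### Inequalities for characteristic functions of probability measures. -/

section CharFun

variable {μ : Measure ℝ} [IsProbabilityMeasure μ]

lemma integrable_of_abs_le {ν : Measure ℝ} [IsFiniteMeasure ν] {f : ℝ → ℝ} (C : ℝ)
    (hf : AEStronglyMeasurable f ν) (h : ∀ x, |f x| ≤ C) : Integrable f ν :=
  Integrable.of_bound hf C (ae_of_all _ h)

lemma integrable_cos_mul (ν : Measure ℝ) [IsFiniteMeasure ν] (t : ℝ) :
    Integrable (fun x => Real.cos (t * x)) ν :=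
  integrable_of_abs_le 1 (by fun_prop) fun _ => Real.abs_cos_le_one _

lemma integrable_sin_mul (ν : Measure ℝ) [IsFiniteMeasure ν] (t : ℝ) :
    Integrable (fun x => Real.sin (t * x)) ν :=
  integrable_of_abs_le 1 (by fun_prop) fun _ => Real.abs_sin_le_one _

lemma integrable_cexp_mul_I (ν : Measure ℝ) [IsFiniteMeasure ν] (t : ℝ) :
    Integrable (fun x : ℝ => Complex.exp (t * x * Complex.I)) ν := by
  refine Integrable.of_bound (by fun_prop) 1 (ae_of_all _ fun x => ?_)
  rw [← Complex.ofReal_mul, Complex.norm_exp_ofReal_mul_I]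

lemma charFun_re (ν : Measure ℝ) [IsFiniteMeasure ν] (t : ℝ) :
    (charFun ν t).re = ∫ x, Real.cos (t * x) ∂ν := by
  rw [charFun_apply_real, ← RCLike.re_eq_complex_re, ← integral_re (integrable_cexp_mul_I ν t)]
  congr with x
  rw [← Complex.ofReal_mul, RCLike.re_eq_complex_re, Complex.exp_ofReal_mul_I_re]

lemma charFun_im (ν : Measure ℝ) [IsFiniteMeasure ν] (t : ℝ) :
    (charFun ν t).im = ∫ x, Real.sin (t * x) ∂ν := by
  rw [charFun_apply_real, ← RCLike.im_eq_complex_im, ← integral_im (integrable_cexp_mul_I ν t)]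
  congr with x
  rw [← Complex.ofReal_mul, RCLike.im_eq_complex_im, Complex.exp_ofReal_mul_I_im]

lemma one_sub_re_charFun (t : ℝ) :
    1 - (charFun μ t).re = ∫ x, (1 - Real.cos (t * x)) ∂μ := by
  rw [integral_sub (integrable_const _) (integrable_cos_mul μ t), charFun_re]
  simp

lemma integral_one_sub_cos_mul_sub (t y : ℝ) :
    ∫ x, (1 - Real.cos (t * (x - y))) ∂μ =
      1 - (Real.cos (t * y) * (charFun μ t).re + Real.sin (t * y) * (charFun μ t).im) := by
  have : ∀ x, 1 - Real.cos (t * (x - y)) =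
      1 - (Real.cos (t * y) * Real.cos (t * x) + Real.sin (t * y) * Real.sin (t * x)) := by
    intro x
    rw [mul_sub, Real.cos_sub]
    ring
  have h1 := (integrable_cos_mul μ t).const_mul (Real.cos (t * y))
  have h2 := (integrable_sin_mul μ t).const_mul (Real.sin (t * y))
  simp_rw [this]
  rw [integral_sub (integrable_const _) (h1.fun_add h2), integral_add h1 h2, integral_const_mul,
    integral_const_mul, charFun_re, charFun_im]
  simp

/-- Symmetrization: the difference of two independent copies has characteristic function `‖charFun μ
t‖ ^ 2`. The addition formula separates the variables, so Fubini is not needed. -/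
lemma integral_integral_one_sub_cos (t : ℝ) :
    ∫ y, ∫ x, (1 - Real.cos (t * (x - y))) ∂μ ∂μ = 1 - ‖charFun μ t‖ ^ 2 := by
  have h1 := (integrable_cos_mul μ t).mul_const (charFun μ t).re
  have h2 := (integrable_sin_mul μ t).mul_const (charFun μ t).im
  simp_rw [integral_one_sub_cos_mul_sub]
  rw [integral_sub (integrable_const _) (h1.fun_add h2), integral_add h1 h2, integral_mul_const,
    integral_mul_const, ← charFun_re, ← charFun_im, ← Complex.normSq_eq_norm_sq,
    Complex.normSq_apply]
  simp

lemma integrable_integral_one_sub_cos (t : ℝ) :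
    Integrable (fun y => ∫ x, (1 - Real.cos (t * (x - y))) ∂μ) μ := by
  simp_rw [integral_one_sub_cos_mul_sub]
  exact (integrable_const _).sub (((integrable_cos_mul μ t).mul_const _).add
    ((integrable_sin_mul μ t).mul_const _))

lemma norm_charFun_sq_le_one (t : ℝ) : ‖charFun μ t‖ ^ 2 ≤ 1 :=
  pow_le_one₀ (norm_nonneg _) (norm_charFun_le_one t)

lemma re_charFun_le_one (t : ℝ) : (charFun μ t).re ≤ 1 :=
  (Complex.re_le_norm _).trans (norm_charFun_le_one t)

lemma one_sub_norm_charFun_sq_le (t : ℝ) :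
    1 - ‖charFun μ t‖ ^ 2 ≤ 2 * (1 - (charFun μ t).re) := by
  have h1 := re_charFun_le_one (μ := μ) t
  have h2 : (charFun μ t).re ^ 2 ≤ ‖charFun μ t‖ ^ 2 := by
    rw [← Complex.normSq_eq_norm_sq, Complex.normSq_apply]
    nlinarith [sq_nonneg (charFun μ t).im]
  nlinarith [sq_nonneg (1 - (charFun μ t).re)]

/-- Since `1 - cos (2 u) = 2 sin² u`, this is the square of `|sin (u + v)| ≤ |sin u| + |sin v|`. -/
lemma one_sub_cos_add_le (a b : ℝ) :
    1 - Real.cos (a + b) ≤ 2 * (1 - Real.cos a) + 2 * (1 - Real.cos b) := by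
  have key : ∀ u : ℝ, 1 - Real.cos (2 * u) = 2 * Real.sin u ^ 2 := fun u => by
    rw [Real.cos_two_mul, Real.cos_sq']
    ring
  have e1 := key (a / 2)
  have e2 := key (b / 2)
  have e3 := key (a / 2 + b / 2)
  rw [show 2 * (a / 2) = a by ring] at e1
  rw [show 2 * (b / 2) = b by ring] at e2
  rw [show 2 * (a / 2 + b / 2) = a + b by ring] at e3
  rw [e1, e2, e3, Real.sin_add]
  set p := Real.sin (a / 2)
  set q := Real.sin (b / 2)
  have c1 := Real.sin_sq_add_cos_sq (a / 2)
  have c2 := Real.sin_sq_add_cos_sq (b / 2)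
  set r := Real.cos (a / 2)
  set s := Real.cos (b / 2)
  have h1 : (p * s) ^ 2 ≤ p ^ 2 := by nlinarith [mul_nonneg (sq_nonneg p) (sq_nonneg q)]
  have h2 : (r * q) ^ 2 ≤ q ^ 2 := by nlinarith [mul_nonneg (sq_nonneg p) (sq_nonneg q)]
  nlinarith [sq_nonneg (p * s - r * q)]

/-- The real part of the characteristic function is controlled by its modulus, up to a drift. -/
lemma one_sub_re_charFun_le {M : ℝ} (hM : 1 / 2 ≤ μ.real {x | |x| ≤ M}) (t : ℝ) :
    1 - (charFun μ t).re ≤ 4 * (1 - ‖charFun μ t‖ ^ 2) + 2 * t ^ 2 * M ^ 2 := by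
  set L := 1 - (charFun μ t).re with hL
  set B : Set ℝ := {x | |x| ≤ M}
  have hB : MeasurableSet B := measurableSet_le (by fun_prop) (by fun_prop)
  have hL0 : 0 ≤ L := sub_nonneg.2 (re_charFun_le_one t)
  set k : ℝ → ℝ := fun y => ∫ x, (1 - Real.cos (t * (x - y))) ∂μ with hk
  have hk0 : ∀ y, 0 ≤ k y := fun y => integral_nonneg fun x => by
    simpa using Real.cos_le_one _
  have hki : Integrable k μ := integrable_integral_one_sub_cos t
  -- Write `x = (x - y) + y` with `y` in the bulk, so that `y` costs at most `t ^ 2 * M ^ 2`.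
  -- Averaging over `y ∈ B`, of mass at least `1 / 2`, brings in the symmetrized law.
  have hpt : ∀ y ∈ B, L ≤ 2 * k y + t ^ 2 * M ^ 2 := by
    intro y hy
    have hi : Integrable (fun x => 1 - Real.cos (t * (x - y))) μ :=
      integrable_of_abs_le 2 (by fun_prop) fun x => by
        rw [abs_le]
        constructor <;> linarith [Real.cos_le_one (t * (x - y)), Real.neg_one_le_cos (t * (x - y))]
    have h1 : L ≤ ∫ x, (2 * (1 - Real.cos (t * (x - y))) + 2 * (1 - Real.cos (t * y))) ∂μ := by
      rw [hL, one_sub_re_charFun]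
      refine integral_mono ((integrable_const _).sub (integrable_cos_mul μ t))
        ((hi.const_mul 2).add (integrable_const _)) fun x => ?_
      have := one_sub_cos_add_le (t * (x - y)) (t * y)
      rwa [show t * (x - y) + t * y = t * x by ring] at this
    rw [integral_add (hi.const_mul 2) (integrable_const _), integral_const_mul] at h1
    have h2 : 1 - Real.cos (t * y) ≤ t ^ 2 * M ^ 2 / 2 := by
      have h3 := Real.one_sub_sq_div_two_le_cos (x := t * y)
      have h4 : y ^ 2 ≤ M ^ 2 := sq_le_sq' (abs_le.1 hy).1 (abs_le.1 hy).2
      nlinarith [mul_le_mul_of_nonneg_left h4 (sq_nonneg t)]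
    simp only [integral_const, probReal_univ, one_smul] at h1
    linarith
  have h5 : ∫ _ in B, L ∂μ ≤ ∫ y in B, (2 * k y + t ^ 2 * M ^ 2) ∂μ :=
    setIntegral_mono_on (integrable_const _).integrableOn
      ((hki.const_mul 2).add (integrable_const _)).integrableOn hB hpt
  rw [integral_add (hki.const_mul 2).integrableOn (integrable_const _).integrableOn,
    integral_const_mul] at h5
  have h6 : ∫ y in B, k y ∂μ ≤ 1 - ‖charFun μ t‖ ^ 2 := by
    rw [← integral_integral_one_sub_cos]
    exact setIntegral_le_integral hki (ae_of_all _ hk0)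
  simp only [integral_const, measureReal_restrict_apply MeasurableSet.univ, Set.univ_inter,
    smul_eq_mul] at h5
  have h7 : μ.real B ≤ 1 := measureReal_le_one
  nlinarith [mul_nonneg (sq_nonneg t) (sq_nonneg M)]

/-- Cauchy–Schwarz, from the nonnegativity of the integral of `(p * f - I) ^ 2`. Dividing by `p`
requires the null case to be treated apart. -/
lemma sq_setIntegral_le {Ω : Type*} [MeasurableSpace Ω] {P : Measure Ω} [IsFiniteMeasure P]
    {f : Ω → ℝ} (hf : Integrable f P) (hf2 : Integrable (fun x => f x ^ 2) P) (s : Set Ω) :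
    (∫ x in s, f x ∂P) ^ 2 ≤ P.real s * ∫ x in s, f x ^ 2 ∂P := by
  set I := ∫ x in s, f x ∂P with hI
  set p := P.real s with hp
  have h0 : 0 ≤ p := measureReal_nonneg
  have h1 : 0 ≤ ∫ x in s, (p * f x - I) ^ 2 ∂P := integral_nonneg fun _ => sq_nonneg _
  have h2 : ∫ x in s, (p * f x - I) ^ 2 ∂P = p * (p * ∫ x in s, f x ^ 2 ∂P - I ^ 2) := by
    have e : ∀ x, (p * f x - I) ^ 2 = p ^ 2 * f x ^ 2 - 2 * p * I * f x + I ^ 2 := fun x => by ring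
    simp_rw [e]
    have i1 : Integrable (fun x => p ^ 2 * f x ^ 2) (P.restrict s) :=
      (hf2.const_mul _).integrableOn
    have i2 : Integrable (fun x => 2 * p * I * f x) (P.restrict s) :=
      (hf.const_mul _).integrableOn
    have i3 : Integrable (fun x => p ^ 2 * f x ^ 2 - 2 * p * I * f x) (P.restrict s) := i1.sub i2
    rw [integral_add i3 (integrable_const _), integral_sub i1 i2, integral_const_mul,
      integral_const_mul, ← hI]
    simp only [integral_const, measureReal_restrict_apply MeasurableSet.univ, Set.univ_inter,
      smul_eq_mul, ← hp]
    ring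
  rcases h0.eq_or_lt with h | h
  · have : P s = 0 := by
      rwa [hp, eq_comm, measureReal_eq_zero_iff] at h
    rw [hI, ← h]
    simp [Measure.restrict_eq_zero.2 this]
  · rw [h2] at h1
    linarith [nonneg_of_mul_nonneg_right h1 h]

/-- The bulk `|x| ≤ M` contributes at most `|t| * M`; the rest is bounded by Cauchy–Schwarz, as `|1
- exp (itx)| ^ 2 = 2 (1 - cos (tx))`. The factor of `1 - Re φ` can be made small by taking `M`
large. -/
lemma norm_one_sub_charFun_sq_le {M : ℝ} (hM : 0 ≤ M) (t : ℝ) :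
    ‖1 - charFun μ t‖ ^ 2 ≤
      2 * t ^ 2 * M ^ 2 + 4 * μ.real {x | M < |x|} * (1 - (charFun μ t).re) := by
  set f : ℝ → ℝ := fun x => ‖1 - Complex.exp (t * x * Complex.I)‖ with hf
  have hfm : Continuous f := by fun_prop
  have hf2 : ∀ x, f x ^ 2 = 2 * (1 - Real.cos (t * x)) := by
    intro x
    simp only [hf]
    rw [← Complex.ofReal_mul, ← Complex.normSq_eq_norm_sq, Complex.normSq_apply, Complex.sub_re,
      Complex.sub_im,
      Complex.exp_ofReal_mul_I_re, Complex.exp_ofReal_mul_I_im]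
    simp only [Complex.one_re, Complex.one_im]
    nlinarith [Real.sin_sq_add_cos_sq (t * x)]
  have hf0 : ∀ x, 0 ≤ f x := fun x => norm_nonneg _
  have hfx : ∀ x, f x ≤ |t| * |x| := by
    intro x
    rw [← abs_mul, hf]
    simp only
    rw [norm_sub_rev, ← Complex.ofReal_mul, mul_comm]
    exact Real.norm_exp_I_mul_ofReal_sub_one_le
  have hfi : Integrable f μ := integrable_of_abs_le 2 (by fun_prop) fun x => by
    rw [abs_of_nonneg (hf0 x)]
    nlinarith [hf2 x, hf0 x, Real.neg_one_le_cos (t * x)]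
  have hfi2 : Integrable (fun x => f x ^ 2) μ := by
    simp_rw [hf2]
    exact ((integrable_const _).sub (integrable_cos_mul μ t)).const_mul 2
  set B : Set ℝ := {x | M < |x|} with hB
  have hBm : MeasurableSet B := measurableSet_lt (by fun_prop) (by fun_prop)
  have h1 : ‖1 - charFun μ t‖ ≤ ∫ x, f x ∂μ := by
    have : 1 - charFun μ t = ∫ x : ℝ, (1 - Complex.exp (t * x * Complex.I)) ∂μ := by
      rw [integral_sub (integrable_const _) (integrable_cexp_mul_I μ t), charFun_apply_real]
      simp
    rw [this]
    exact norm_integral_le_integral_norm _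
  have h2 : ∫ x, f x ∂μ = ∫ x in B, f x ∂μ + ∫ x in Bᶜ, f x ∂μ :=
    (integral_add_compl hBm hfi).symm
  have h3 : ∫ x in Bᶜ, f x ∂μ ≤ |t| * M := by
    calc ∫ x in Bᶜ, f x ∂μ ≤ ∫ x in Bᶜ, |t| * M ∂μ := by
          refine setIntegral_mono_on hfi.integrableOn (integrable_const _).integrableOn
            hBm.compl fun x hx => (hfx x).trans ?_
          gcongr
          simpa [hB] using hx
      _ ≤ |t| * M := by
          simp only [integral_const, measureReal_restrict_apply MeasurableSet.univ,
            Set.univ_inter, smul_eq_mul]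
          have : μ.real Bᶜ ≤ 1 := measureReal_le_one
          nlinarith [mul_nonneg (abs_nonneg t) hM]
  have h4 : (∫ x in B, f x ∂μ) ^ 2 ≤ μ.real B * (2 * (1 - (charFun μ t).re)) := by
    refine (sq_setIntegral_le hfi hfi2 B).trans ?_
    gcongr
    calc ∫ x in B, f x ^ 2 ∂μ ≤ ∫ x, f x ^ 2 ∂μ :=
          setIntegral_le_integral hfi2 (ae_of_all _ fun _ => sq_nonneg _)
      _ = 2 * (1 - (charFun μ t).re) := by
          simp_rw [hf2]
          rw [integral_const_mul, one_sub_re_charFun]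
  have h5 : 0 ≤ ∫ x in B, f x ∂μ := integral_nonneg hf0
  have h6 : 0 ≤ ∫ x in Bᶜ, f x ∂μ := integral_nonneg hf0
  set u := ∫ x in B, f x ∂μ
  set v := ∫ x in Bᶜ, f x ∂μ
  have h7 : v ^ 2 ≤ t ^ 2 * M ^ 2 := by
    rw [← sq_abs t, ← mul_pow]
    exact pow_le_pow_left₀ h6 h3 2
  have h8 : ‖1 - charFun μ t‖ ^ 2 ≤ (u + v) ^ 2 :=
    pow_le_pow_left₀ (norm_nonneg _) (h1.trans h2.le) 2
  nlinarith [sq_nonneg (u - v)]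

/-- A tail bound from the real part of the characteristic function near the origin. -/
lemma measureReal_abs_gt_le {r η : ℝ} (hr : 0 < r)
    (h : ∀ u, |u| ≤ 2 / r → 1 - (charFun μ u).re ≤ η) :
    μ.real {x | r < |x|} ≤ 2 * η := by
  refine (measureReal_abs_gt_le_integral_charFun hr).trans ?_
  have hc : Continuous (charFun μ) := continuous_charFun
  -- The imaginary part is odd and the interval symmetric, so only the real part remains.
  have e : ∫ t in (-2 * r⁻¹)..(2 * r⁻¹), (1 - charFun μ t) =
      ∫ t in (-2 * r⁻¹)..(2 * r⁻¹), (((1 - (charFun μ t).re : ℝ)) : ℂ) := by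
    have e1 : ∫ t in (-2 * r⁻¹)..(2 * r⁻¹), (1 - charFun μ (-t)) =
        ∫ t in (-2 * r⁻¹)..(2 * r⁻¹), (1 - charFun μ t) := by
      rw [intervalIntegral.integral_comp_neg (fun t => 1 - charFun μ t)]
      congr 1 <;> ring
    have e2 : ∫ t in (-2 * r⁻¹)..(2 * r⁻¹), ((1 - charFun μ t) + (1 - charFun μ (-t))) =
        ∫ t in (-2 * r⁻¹)..(2 * r⁻¹), 2 * (((1 - (charFun μ t).re : ℝ)) : ℂ) := by
      congr with t
      rw [charFun_neg]
      have := Complex.add_conj (charFun μ t)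
      push_cast at this ⊢
      linear_combination -this
    rw [intervalIntegral.integral_add (by apply Continuous.intervalIntegrable; fun_prop)
      (by apply Continuous.intervalIntegrable; fun_prop), e1,
      intervalIntegral.integral_const_mul] at e2
    linear_combination e2 / 2
  rw [e]
  have hb : ‖∫ t in (-2 * r⁻¹)..(2 * r⁻¹), (((1 - (charFun μ t).re : ℝ)) : ℂ)‖ ≤
      η * |2 * r⁻¹ - -2 * r⁻¹| := by
    refine intervalIntegral.norm_integral_le_of_norm_le_const fun t ht => ?_
    rw [Complex.norm_real, Real.norm_eq_abs, abs_of_nonneg (sub_nonneg.2 (re_charFun_le_one t))]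
    apply h
    have : -2 * r⁻¹ ≤ 2 * r⁻¹ := by
      have := inv_pos.2 hr
      linarith
    rw [Set.uIoc_of_le this] at ht
    rw [abs_le, div_eq_mul_inv]
    exact ⟨by linarith [ht.1], ht.2⟩
  have hη : |2 * r⁻¹ - -2 * r⁻¹| = 4 * r⁻¹ := by
    rw [abs_of_nonneg] <;> [ring; (have := inv_pos.2 hr; linarith)]
  rw [hη] at hb
  calc _ ≤ 2⁻¹ * r * (η * (4 * r⁻¹)) := by gcongr
    _ = 2 * η := by field_simp; ring

end CharFun

/-! ### Products close to one and their logarithms. -/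

section Elementary

lemma norm_prod_sub_prod_le {ι : Type*} (s : Finset ι) (z w : ι → ℂ) (hz : ∀ i ∈ s, ‖z i‖ ≤ 1)
    (hw : ∀ i ∈ s, ‖w i‖ ≤ 1) : ‖∏ i ∈ s, z i - ∏ i ∈ s, w i‖ ≤ ∑ i ∈ s, ‖z i - w i‖ := by
  classical
  induction s using Finset.induction_on with
  | empty => simp
  | insert a s ha ih =>
    rw [Finset.prod_insert ha, Finset.prod_insert ha, Finset.sum_insert ha]
    have ih' := ih (fun i hi => hz i (Finset.mem_insert_of_mem hi))
      (fun i hi => hw i (Finset.mem_insert_of_mem hi))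
    have h1 : ‖∏ i ∈ s, z i‖ ≤ 1 := by
      rw [norm_prod]
      exact Finset.prod_le_one (fun _ _ => norm_nonneg _)
        fun i hi => hz i (Finset.mem_insert_of_mem hi)
    calc ‖z a * ∏ i ∈ s, z i - w a * ∏ i ∈ s, w i‖
        = ‖(z a - w a) * ∏ i ∈ s, z i + w a * (∏ i ∈ s, z i - ∏ i ∈ s, w i)‖ := by ring_nf
      _ ≤ ‖z a - w a‖ * ‖∏ i ∈ s, z i‖ + ‖w a‖ * ‖∏ i ∈ s, z i - ∏ i ∈ s, w i‖ := by
          refine (norm_add_le _ _).trans ?_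
          rw [norm_mul, norm_mul]
      _ ≤ ‖z a - w a‖ * 1 + 1 * ∑ i ∈ s, ‖z i - w i‖ := by
          gcongr
          exact hw a (Finset.mem_insert_self _ _)
      _ = _ := by ring

lemma norm_pow_sub_pow_le_mul (n : ℕ) {z w : ℂ} (hz : ‖z‖ ≤ 1) (hw : ‖w‖ ≤ 1) :
    ‖z ^ n - w ^ n‖ ≤ n * ‖z - w‖ := by
  simpa using norm_prod_sub_prod_le (Finset.range n) (fun _ => z) (fun _ => w)
    (fun _ _ => hz) (fun _ _ => hw)

/-- `∑ (1 - xᵢ)` is comparable to `-log ∏ xᵢ` when all `xᵢ` are close to `1`. -/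
lemma sum_one_sub_le_neg_log {ι : Type*} (s : Finset ι) (x : ι → ℝ) (hx : ∀ i ∈ s, 0 < x i) :
    ∑ i ∈ s, (1 - x i) ≤ -Real.log (∏ i ∈ s, x i) := by
  rw [Real.log_prod (fun i hi => (hx i hi).ne'), ← Finset.sum_neg_distrib]
  refine Finset.sum_le_sum fun i hi => ?_
  linarith [Real.log_le_sub_one_of_pos (hx i hi)]

/-- From `1 - 1 / x ≤ log x` one gets `x * (-log x) ≤ 1 - x`. For `δ` near `1` this nearly matches
the upper bound. -/
lemma mul_neg_log_le_sum_one_sub {ι : Type*} (s : Finset ι) (x : ι → ℝ) {δ : ℝ} (hδ : 0 < δ)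
    (hx : ∀ i ∈ s, δ ≤ x i) (hx1 : ∀ i ∈ s, x i ≤ 1) :
    δ * -Real.log (∏ i ∈ s, x i) ≤ ∑ i ∈ s, (1 - x i) := by
  rw [Real.log_prod (fun i hi => (hδ.trans_le (hx i hi)).ne'), ← Finset.sum_neg_distrib,
    Finset.mul_sum]
  refine Finset.sum_le_sum fun i hi => ?_
  have h0 := hδ.trans_le (hx i hi)
  have h1 := Real.one_sub_inv_le_log_of_pos h0
  have h2 : x i * -Real.log (x i) ≤ 1 - x i := by
    have : x i * (1 - (x i)⁻¹) ≤ x i * Real.log (x i) := by gcongr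
    rw [mul_sub, mul_inv_cancel₀ h0.ne'] at this
    linarith
  have h3 : 0 ≤ -Real.log (x i) := by
    linarith [Real.log_nonpos h0.le (hx1 i hi)]
  nlinarith [hx i hi]

/-- The quantity lies between `x n * (-log (x n ^ n))` and `-log (x n ^ n)`, and `x n → 1`. -/
lemma tendsto_mul_one_sub_of_tendsto_pow {x : ℕ → ℝ} (h0 : ∀ n, 0 ≤ x n) (h1 : ∀ n, x n ≤ 1)
    {J : ℝ} (h : Tendsto (fun n => x n ^ n) atTop (𝓝 (Real.exp (-J)))) :
    Tendsto (fun n : ℕ => n * (1 - x n)) atTop (𝓝 J) := by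
  have hlog : Tendsto (fun n => -Real.log (x n ^ n)) atTop (𝓝 J) := by
    have := (h.log (Real.exp_pos _).ne').neg
    simpa using this
  have hpos : ∀ᶠ n in atTop, 0 < x n := by
    filter_upwards [h.eventually (lt_mem_nhds (Real.exp_pos (-J))), eventually_ge_atTop 1]
      with n hn hn1
    rcases (h0 n).eq_or_lt with h | h
    · rw [← h, zero_pow (by omega)] at hn
      exact absurd hn (lt_irrefl _)
    · exact h
  have hx1 : Tendsto x atTop (𝓝 1) := by
    have h2 : Tendsto (fun n : ℕ => Real.exp (-(-Real.log (x n ^ n) / n))) atTop (𝓝 1) := by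
      have := (hlog.div_atTop tendsto_natCast_atTop_atTop).neg.rexp
      simpa using this
    refine h2.congr' ?_
    filter_upwards [hpos, eventually_ge_atTop 1] with n hn hn1
    have : (n : ℝ) ≠ 0 := by positivity
    rw [Real.log_pow, neg_div, neg_neg, mul_div_cancel_left₀ _ this, Real.exp_log hn]
  have hlow : Tendsto (fun n => x n * -Real.log (x n ^ n)) atTop (𝓝 J) := by
    simpa using hx1.mul hlog
  refine tendsto_of_tendsto_of_tendsto_of_le_of_le' hlow hlog ?_ ?_
  · filter_upwards [hpos] with n hn
    have := mul_neg_log_le_sum_one_sub (Finset.range n) (fun _ => x n) hn (fun _ _ => le_rfl)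
      (fun _ _ => h1 n)
    simpa only [Finset.sum_const, Finset.prod_const, Finset.card_range, nsmul_eq_mul] using this
  · filter_upwards [hpos] with n hn
    have := sum_one_sub_le_neg_log (Finset.range n) (fun _ => x n) (fun _ _ => hn)
    simpa only [Finset.sum_const, Finset.prod_const, Finset.card_range, nsmul_eq_mul] using this

end Elementary

/-! ### Tightness of one law, second moments, and symmetrization. -/

section Concentration

variable {μ : Measure ℝ} [IsProbabilityMeasure μ]

lemma exists_measureReal_abs_gt_lt (μ : Measure ℝ) [IsProbabilityMeasure μ] {ε : ℝ} (hε : 0 < ε) :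
    ∃ M : ℝ, 0 ≤ M ∧ μ.real {x | M < |x|} < ε := by
  have h : Tendsto (fun k : ℕ => μ {x : ℝ | (k : ℝ) < |x|}) atTop
      (𝓝 (μ (⋂ k : ℕ, {x : ℝ | (k : ℝ) < |x|}))) := by
    refine tendsto_measure_iInter_atTop
      (fun k => (measurableSet_lt (by fun_prop) (by fun_prop)).nullMeasurableSet) ?_
      ⟨0, measure_ne_top _ _⟩
    intro i j hij x hx
    simp only [Set.mem_ofPred_eq] at hx ⊢
    exact lt_of_le_of_lt (by exact_mod_cast hij) hx
  have he : (⋂ k : ℕ, {x : ℝ | (k : ℝ) < |x|}) = ∅ := by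
    ext x
    simp only [Set.mem_iInter, Set.mem_ofPred_eq, Set.mem_empty_iff_false, iff_false, not_forall,
      not_lt]
    exact exists_nat_ge |x|
  rw [he, measure_empty] at h
  obtain ⟨k, hk⟩ := (h.eventually (gt_mem_nhds (ENNReal.ofReal_pos.2 hε))).exists
  exact ⟨k, by positivity, (ENNReal.toReal_lt_of_lt_ofReal hk)⟩

lemma exists_half_le_measureReal (μ : Measure ℝ) [IsProbabilityMeasure μ] :
    ∃ M : ℝ, 0 ≤ M ∧ 1 / 2 ≤ μ.real {x | |x| ≤ M} := by
  obtain ⟨M, hM0, hM⟩ := exists_measureReal_abs_gt_lt μ (ε := 1 / 2) (by norm_num)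
  refine ⟨M, hM0, ?_⟩
  have h : {x : ℝ | |x| ≤ M} = {x | M < |x|}ᶜ := by
    ext x
    simp
  rw [h, probReal_compl_eq_one_sub (measurableSet_lt (by fun_prop) (by fun_prop))]
  linarith

lemma integrable_one_sub_cos (ν : Measure ℝ) [IsFiniteMeasure ν] (t : ℝ) :
    Integrable (fun x => 1 - Real.cos (t * x)) ν :=
  (integrable_const _).sub (integrable_cos_mul ν t)

lemma tendsto_sq_mul_one_sub_re_charFun {c : ℕ → ℝ} (hc : Tendsto c atTop atTop)
    (hμ : Integrable (fun x => x ^ 2) μ) (θ : ℝ) :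
    Tendsto (fun n => c n ^ 2 * (1 - (charFun μ (θ / c n)).re)) atTop
      (𝓝 (θ ^ 2 / 2 * ∫ x, x ^ 2 ∂μ)) := by
  simp_rw [one_sub_re_charFun, ← integral_const_mul]
  refine tendsto_integral_of_dominated_convergence (fun x => θ ^ 2 / 2 * x ^ 2)
    (fun n => by fun_prop) (hμ.const_mul _) ?_ (ae_of_all _ fun x => ?_)
  · intro n
    refine ae_of_all _ fun x => ?_
    have h1 := Real.one_sub_sq_div_two_le_cos (x := θ / c n * x)
    have h2 := Real.cos_le_one (θ / c n * x)
    rw [Real.norm_eq_abs, abs_of_nonneg (mul_nonneg (sq_nonneg _) (by linarith))]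
    -- The domination is needed for every `n`, including those with `c n = 0`, where the left side
    -- vanishes.
    rcases eq_or_ne (c n) 0 with h | h
    · rw [h]
      simp only [ne_eq, OfNat.ofNat_ne_zero, not_false_eq_true, zero_pow, zero_mul]
      positivity
    · calc c n ^ 2 * (1 - Real.cos (θ / c n * x)) ≤ c n ^ 2 * ((θ / c n * x) ^ 2 / 2) := by
            gcongr
            linarith
        _ = θ ^ 2 / 2 * x ^ 2 := by field_simp
  · have hu : Tendsto (fun n => θ * x / c n) atTop (𝓝 0) := hc.const_div_atTop _
    -- `1 - cos u = u ^ 2 * (sinc (u / 2) ^ 2 / 2)`, so the pointwise limit is continuity of `sinc`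
    -- at `0`.
    have hlim : Tendsto (fun u : ℝ => (1 / 2) * Real.sinc (u / 2) ^ 2) (𝓝 0) (𝓝 (1 / 2)) := by
      have : Continuous fun u : ℝ => (1 / 2) * Real.sinc (u / 2) ^ 2 := by fun_prop
      simpa using this.tendsto 0
    have h1 := ((hlim.comp hu).const_mul (θ ^ 2 * x ^ 2))
    rw [show θ ^ 2 * x ^ 2 * (1 / 2) = θ ^ 2 / 2 * x ^ 2 by ring] at h1
    refine h1.congr' ?_
    filter_upwards [hc.eventually_gt_atTop 0] with n hn
    simp only [Function.comp_apply]
    have h2 : 1 - Real.cos (θ / c n * x) = 2 * Real.sin (θ * x / c n / 2) ^ 2 := by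
      rw [show θ / c n * x = 2 * (θ * x / c n / 2) by ring, Real.cos_two_mul, Real.cos_sq']
      ring
    rw [h2]
    rcases eq_or_ne (θ * x) 0 with h | h
    · rw [← mul_pow, h]
      simp
    · obtain ⟨hθ, hx⟩ := mul_ne_zero_iff.1 h
      rw [Real.sinc_of_ne_zero (by positivity)]
      field_simp

/-- For `|v| ≤ 1` one has `1 - cos v ≥ v ^ 2 / 5`. So once `c n > M` the quantity exceeds a fifth of
the second moment over `[-M, M]`, which is unbounded in `M`. -/
lemma tendsto_sq_mul_one_sub_re_charFun_atTop {c : ℕ → ℝ} (hc : Tendsto c atTop atTop)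
    (hμ : ¬ Integrable (fun x => x ^ 2) μ) :
    Tendsto (fun n => c n ^ 2 * (1 - (charFun μ (1 / c n)).re)) atTop atTop := by
  have hloc : ∀ M : ℝ, Integrable (fun x : ℝ => x ^ 2) (μ.restrict (Set.Icc (-M) M)) := fun M =>
    (Continuous.continuousOn (by fun_prop)).integrableOn_compact isCompact_Icc
  have hM : ∀ K : ℝ, ∃ M : ℕ, K ≤ ∫ x in Set.Icc (-(M : ℝ)) M, x ^ 2 ∂μ := by
    intro K
    by_contra! hcon
    refine hμ (AECover.integrable_of_integral_bounded_of_nonneg_ae (l := atTop)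
      (φ := fun k : ℕ => Set.Icc (-(k : ℝ)) k) ?_ K (fun k => hloc k)
      (ae_of_all _ fun x => sq_nonneg x) (Eventually.of_forall fun k => (hcon k).le))
    exact aecover_Icc (tendsto_neg_atTop_atBot.comp tendsto_natCast_atTop_atTop)
      tendsto_natCast_atTop_atTop
  rw [tendsto_atTop]
  intro K
  obtain ⟨M, hM⟩ := hM (5 * K)
  filter_upwards [hc.eventually_ge_atTop ((M : ℝ) + 1)] with n hn
  have hM0 : (0 : ℝ) ≤ M := by positivity
  have hc0 : 0 < c n := by linarith
  rw [one_sub_re_charFun, ← integral_const_mul]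
  have hi := (integrable_one_sub_cos μ (1 / c n)).const_mul (c n ^ 2)
  have h1 : ∫ x in Set.Icc (-(M : ℝ)) M, (1 / 5) * x ^ 2 ∂μ ≤
      ∫ x in Set.Icc (-(M : ℝ)) M, c n ^ 2 * (1 - Real.cos (1 / c n * x)) ∂μ := by
    refine setIntegral_mono_on ((hloc M).const_mul _) hi.integrableOn measurableSet_Icc ?_
    intro x hx
    have hx1 : |1 / c n * x| ≤ 1 := by
      rw [abs_mul, abs_of_pos (by positivity : 0 < 1 / c n), one_div, inv_mul_le_iff₀ hc0]
      have := abs_le.2 hx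
      linarith
    have h2 := Real.cos_le_one_sub_mul_cos_sq (hx1.trans (by linarith [Real.pi_gt_three]))
    have h3 : (1 : ℝ) / 5 ≤ 2 / Real.pi ^ 2 := by
      rw [div_le_div_iff₀ (by norm_num) (by positivity)]
      nlinarith [Real.pi_lt_d2, Real.pi_pos]
    have h4 : 1 / 5 * (1 / c n * x) ^ 2 ≤ 1 - Real.cos (1 / c n * x) := by
      have := mul_le_mul_of_nonneg_right h3 (sq_nonneg (1 / c n * x))
      linarith
    calc 1 / 5 * x ^ 2 = c n ^ 2 * (1 / 5 * (1 / c n * x) ^ 2) := by field_simp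
      _ ≤ _ := by gcongr
  rw [integral_const_mul] at h1
  have h5 : ∫ x in Set.Icc (-(M : ℝ)) M, c n ^ 2 * (1 - Real.cos (1 / c n * x)) ∂μ ≤
      ∫ x, c n ^ 2 * (1 - Real.cos (1 / c n * x)) ∂μ :=
    setIntegral_le_integral hi (ae_of_all _ fun x =>
      mul_nonneg (sq_nonneg _) (by linarith [Real.cos_le_one (1 / c n * x)]))
  linarith

/-- Integrated form of `1 - cos (2 v) ≤ 4 (1 - cos v)`. It propagates `‖φ‖ = 1` from a neighbourhood
of the origin to the whole line. -/
lemma one_sub_norm_charFun_sq_two_mul_le (t : ℝ) :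
    1 - ‖charFun μ (2 * t)‖ ^ 2 ≤ 4 * (1 - ‖charFun μ t‖ ^ 2) := by
  rw [← integral_integral_one_sub_cos, ← integral_integral_one_sub_cos, ← integral_const_mul]
  refine integral_mono (integrable_integral_one_sub_cos _)
    ((integrable_integral_one_sub_cos _).const_mul _) fun y => ?_
  simp only
  have hi : ∀ s, Integrable (fun x => 1 - Real.cos (s * (x - y))) μ := fun s =>
    integrable_of_abs_le 2 (by fun_prop) fun x => by
      rw [abs_le]
      constructor <;> linarith [Real.cos_le_one (s * (x - y)), Real.neg_one_le_cos (s * (x - y))]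
  rw [← integral_const_mul]
  refine integral_mono (hi _) ((hi _).const_mul _) fun x => ?_
  simp only
  rw [mul_assoc, Real.cos_two_mul]
  nlinarith [sq_nonneg (Real.cos (t * (x - y)) - 1)]

/-- The law of the difference of two independent variables with law `μ`. -/
noncomputable def symmetrization (μ : Measure ℝ) : Measure ℝ :=
  Measure.conv μ (μ.map fun x => (-1) * x)

instance (μ : Measure ℝ) [IsProbabilityMeasure μ] : IsProbabilityMeasure (symmetrization μ) := by
  have : IsProbabilityMeasure (μ.map fun x => (-1) * x) :=
    Measure.isProbabilityMeasure_map (by fun_prop)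
  unfold symmetrization
  infer_instance

lemma charFun_symmetrization_re (t : ℝ) :
    (charFun (symmetrization μ) t).re = ‖charFun μ t‖ ^ 2 := by
  have : IsProbabilityMeasure (μ.map fun x => (-1) * x) :=
    Measure.isProbabilityMeasure_map (by fun_prop)
  rw [symmetrization, charFun_conv, charFun_map_mul, show -1 * t = -t by ring, charFun_neg,
    Complex.mul_conj, Complex.ofReal_re, Complex.normSq_eq_norm_sq]

end Concentration

section Scaling

/-! Consequences, for the scaling constants `c n`, of the convergence of the moduli of the
characteristic functions of normalized sums. -/

variable {F : Measure ℝ} [IsProbabilityMeasure F] {c : ℕ → ℝ}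

/-- If `c n < M` infinitely often, then for `|t| ≤ u₀ / M` the product `n * (1 - ‖φ t‖ ^ 2)` stays
below `η` along a subsequence. This forces `‖φ t‖ = 1` there, then everywhere by doubling, against
`J > 0`. -/
lemma tendsto_scaling_atTop (hc : ∀ n, 0 < c n) {J : ℝ} (hJ : 0 < J)
    (h1 : Tendsto (fun n : ℕ => n * (1 - ‖charFun F (1 / c n)‖ ^ 2)) atTop (𝓝 J))
    {u₀ η : ℝ} (hu₀ : 0 < u₀)
    (hu : ∀ᶠ n : ℕ in atTop, ∀ u, |u| ≤ u₀ → n * (1 - ‖charFun F (u / c n)‖ ^ 2) ≤ η) :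
    Tendsto c atTop atTop := by
  by_contra hcon
  rw [tendsto_atTop] at hcon
  push Not at hcon
  obtain ⟨M, hM⟩ := hcon
  have hM' : ∃ᶠ n in atTop, c n < M := by
    simpa only [not_le] using hM
  have hMpos : 0 < M := by
    obtain ⟨n, hn⟩ := hM'.exists
    exact (hc n).trans hn
  have hg0 : ∀ t, 0 ≤ 1 - ‖charFun F t‖ ^ 2 := fun t => sub_nonneg.2 (norm_charFun_sq_le_one t)
  have hsmall : ∀ t, |t| ≤ u₀ / M → 1 - ‖charFun F t‖ ^ 2 = 0 := by
    intro t ht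
    by_contra hne
    have hpos : 0 < 1 - ‖charFun F t‖ ^ 2 := lt_of_le_of_ne (hg0 t) (Ne.symm hne)
    have hev : ∀ᶠ n : ℕ in atTop, η < n * (1 - ‖charFun F t‖ ^ 2) :=
      (tendsto_natCast_atTop_atTop.atTop_mul_const hpos).eventually_gt_atTop η
    obtain ⟨n, hn, hn1, hn2⟩ := (hM'.and_eventually (hu.and hev)).exists
    have h3 := hn1 (t * c n) (by
      rw [abs_mul, abs_of_pos (hc n)]
      have := (hc n).le
      calc |t| * c n ≤ u₀ / M * M := by gcongr
        _ = u₀ := by field_simp)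
    rw [mul_div_cancel_right₀ _ (hc n).ne'] at h3
    linarith
  have hall : ∀ (k : ℕ) (t : ℝ), |t| ≤ 2 ^ k * (u₀ / M) → 1 - ‖charFun F t‖ ^ 2 = 0 := by
    intro k
    induction k with
    | zero => simpa using hsmall
    | succ k ih =>
      intro t ht
      have h4 : |t / 2| ≤ 2 ^ k * (u₀ / M) := by
        rw [abs_div, abs_of_pos (by norm_num : (0 : ℝ) < 2), div_le_iff₀ (by norm_num)]
        rw [pow_succ] at ht
        linarith
      have h5 := one_sub_norm_charFun_sq_two_mul_le (μ := F) (t / 2)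
      rw [ih _ h4, mul_div_cancel₀ _ (by norm_num : (2 : ℝ) ≠ 0)] at h5
      linarith [hg0 t]
  have hzero : ∀ t, 1 - ‖charFun F t‖ ^ 2 = 0 := by
    intro t
    obtain ⟨k, hk⟩ := pow_unbounded_of_one_lt (|t| / (u₀ / M)) (by norm_num : (1 : ℝ) < 2)
    refine hall k t ?_
    rw [div_lt_iff₀ (by positivity)] at hk
    exact hk.le
  simp_rw [hzero, mul_zero] at h1
  exact hJ.ne (tendsto_nhds_unique tendsto_const_nhds h1)

/-- A finite variance of the symmetrized law would make `1 - ‖φ‖ ^ 2` quadratic at the origin and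
give `J₂ = 4 * J₁`. So the variance is infinite, and `c n ^ 2 * (1 - ‖φ (1 / c n)‖ ^ 2)` diverges
while the same expression with `n` for `c n ^ 2` converges. -/
lemma tendsto_div_scaling_sq (hcT : Tendsto c atTop atTop) {J₁ J₂ : ℝ} (hJ₁ : 0 < J₁)
    (hJ₂ : J₂ < 4 * J₁)
    (h1 : Tendsto (fun n : ℕ => n * (1 - ‖charFun F (1 / c n)‖ ^ 2)) atTop (𝓝 J₁))
    (h2 : Tendsto (fun n : ℕ => n * (1 - ‖charFun F (2 / c n)‖ ^ 2)) atTop (𝓝 J₂)) :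
    Tendsto (fun n : ℕ => n / c n ^ 2) atTop (𝓝 0) := by
  have hs : ∀ t, 1 - ‖charFun F t‖ ^ 2 = 1 - (charFun (symmetrization F) t).re := fun t => by
    rw [charFun_symmetrization_re]
  simp_rw [hs] at h1 h2
  by_cases hi : Integrable (fun x => x ^ 2) (symmetrization F)
  · exfalso
    set V := ∫ x, x ^ 2 ∂(symmetrization F) with hV
    have e1 := tendsto_sq_mul_one_sub_re_charFun hcT hi 1
    have e2 := tendsto_sq_mul_one_sub_re_charFun hcT hi 2
    rw [← hV] at e1 e2
    have p1 := h1.mul e2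
    have p2 := h2.mul e1
    have heq := tendsto_nhds_unique p1 (p2.congr fun n => by ring)
    have hV0 : V = 0 := by
      have : V * (4 * J₁ - J₂) = 0 := by linarith
      rcases mul_eq_zero.1 this with h | h
      · exact h
      · linarith
    have hz : ∀ t, 1 - (charFun (symmetrization F) t).re ≤ 0 := by
      intro t
      rw [one_sub_re_charFun]
      calc ∫ x, (1 - Real.cos (t * x)) ∂(symmetrization F)
          ≤ ∫ x, t ^ 2 / 2 * x ^ 2 ∂(symmetrization F) := by
            refine integral_mono (integrable_one_sub_cos _ t) (hi.const_mul _) fun x => ?_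
            have := Real.one_sub_sq_div_two_le_cos (x := t * x)
            simp only
            nlinarith
        _ = 0 := by rw [integral_const_mul, ← hV, hV0, mul_zero]
    have : J₁ ≤ 0 := le_of_tendsto' h1 fun n =>
      mul_nonpos_of_nonneg_of_nonpos (by positivity) (hz _)
    linarith
  · have e1 := tendsto_sq_mul_one_sub_re_charFun_atTop hcT hi
    refine (h1.div_atTop e1).congr' ?_
    filter_upwards [e1.eventually_gt_atTop 0, hcT.eventually_gt_atTop 0] with n hn hn2
    have : 1 - (charFun (symmetrization F) (1 / c n)).re ≠ 0 := by
      intro h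
      rw [h, mul_zero] at hn
      exact lt_irrefl _ hn
    field_simp

lemma eventually_mul_one_sub_re_charFun_le (hn : Tendsto (fun n : ℕ => n / c n ^ 2) atTop (𝓝 0))
    {u₀ η : ℝ} (hη : 0 < η)
    (hu : ∀ᶠ n : ℕ in atTop, ∀ u, |u| ≤ u₀ → n * (1 - ‖charFun F (u / c n)‖ ^ 2) ≤ η) :
    ∀ᶠ n : ℕ in atTop, ∀ u, |u| ≤ u₀ → n * (1 - (charFun F (u / c n)).re) ≤ 5 * η := by
  obtain ⟨M, hM0, hM⟩ := exists_half_le_measureReal F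
  have h1 : Tendsto (fun n : ℕ => 2 * u₀ ^ 2 * M ^ 2 * (n / c n ^ 2)) atTop (𝓝 0) := by
    simpa using hn.const_mul (2 * u₀ ^ 2 * M ^ 2)
  filter_upwards [hu, h1.eventually (gt_mem_nhds hη)] with n h2 h3 u hu
  have h4 := one_sub_re_charFun_le hM (u / c n)
  have h5 : u ^ 2 ≤ u₀ ^ 2 := sq_le_sq' (abs_le.1 hu).1 (abs_le.1 hu).2
  calc n * (1 - (charFun F (u / c n)).re)
      ≤ n * (4 * (1 - ‖charFun F (u / c n)‖ ^ 2) + 2 * (u / c n) ^ 2 * M ^ 2) := by gcongr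
    _ = 4 * (n * (1 - ‖charFun F (u / c n)‖ ^ 2)) + 2 * u ^ 2 * M ^ 2 * (n / c n ^ 2) := by ring
    _ ≤ 4 * η + 2 * u₀ ^ 2 * M ^ 2 * (n / c n ^ 2) := by
        gcongr
        exact h2 u hu
    _ ≤ 5 * η := by linarith

/-- This is the error made on replacing `φ ^ n` by `exp (n (φ - 1))`. The sequence `n * (1 - Re φ)`
is bounded, and `norm_one_sub_charFun_sq_le` multiplies it by an arbitrarily small tail probability.
-/
lemma tendsto_mul_norm_one_sub_charFun_sq
    (hn : Tendsto (fun n : ℕ => n / c n ^ 2) atTop (𝓝 0)) {θ J : ℝ}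
    (h1 : Tendsto (fun n : ℕ => n * (1 - ‖charFun F (θ / c n)‖ ^ 2)) atTop (𝓝 J)) :
    Tendsto (fun n : ℕ => n * ‖1 - charFun F (θ / c n)‖ ^ 2) atTop (𝓝 0) := by
  obtain ⟨M₀, -, hM₀⟩ := exists_half_le_measureReal F
  set K := 4 * (|J| + 1) + 1 with hK
  have hK0 : 0 < K := by positivity
  have hbd : ∀ᶠ n : ℕ in atTop, n * (1 - (charFun F (θ / c n)).re) ≤ K := by
    have h3 : Tendsto (fun n : ℕ => 2 * θ ^ 2 * M₀ ^ 2 * (n / c n ^ 2)) atTop (𝓝 0) := by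
      simpa using hn.const_mul (2 * θ ^ 2 * M₀ ^ 2)
    have hJ : J < |J| + 1 := by linarith [le_abs_self J]
    filter_upwards [h1.eventually (gt_mem_nhds hJ), h3.eventually (gt_mem_nhds one_pos)]
      with n h4 h5
    calc n * (1 - (charFun F (θ / c n)).re)
        ≤ n * (4 * (1 - ‖charFun F (θ / c n)‖ ^ 2) + 2 * (θ / c n) ^ 2 * M₀ ^ 2) := by
          gcongr
          exact one_sub_re_charFun_le hM₀ _
      _ = 4 * (n * (1 - ‖charFun F (θ / c n)‖ ^ 2)) + 2 * θ ^ 2 * M₀ ^ 2 * (n / c n ^ 2) := by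
          ring
      _ ≤ K := by linarith
  rw [tendsto_order]
  refine ⟨fun a ha => Eventually.of_forall fun n => ha.trans_le (by positivity), fun ε hε => ?_⟩
  -- With this choice the tail term is at most `4 * (ε / (8 * K)) * K = ε / 2`.
  obtain ⟨M, hM0, hM⟩ := exists_measureReal_abs_gt_lt F (ε := ε / (8 * K)) (by positivity)
  have h3 : Tendsto (fun n : ℕ => 2 * θ ^ 2 * M ^ 2 * (n / c n ^ 2)) atTop (𝓝 0) := by
    simpa using hn.const_mul (2 * θ ^ 2 * M ^ 2)
  filter_upwards [hbd, h3.eventually (gt_mem_nhds (half_pos hε))] with n h4 h5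
  calc n * ‖1 - charFun F (θ / c n)‖ ^ 2
      ≤ n * (2 * (θ / c n) ^ 2 * M ^ 2 +
          4 * F.real {x | M < |x|} * (1 - (charFun F (θ / c n)).re)) := by
        gcongr
        exact norm_one_sub_charFun_sq_le hM0 _
    _ = 2 * θ ^ 2 * M ^ 2 * (n / c n ^ 2) +
          4 * F.real {x | M < |x|} * (n * (1 - (charFun F (θ / c n)).re)) := by ring
    _ ≤ 2 * θ ^ 2 * M ^ 2 * (n / c n ^ 2) + 4 * (ε / (8 * K)) * K := by
        have : 0 ≤ n * (1 - (charFun F (θ / c n)).re) :=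
          mul_nonneg (by positivity) (sub_nonneg.2 (re_charFun_le_one _))
        gcongr
    _ = 2 * θ ^ 2 * M ^ 2 * (n / c n ^ 2) + ε / 2 := by field_simp; ring
    _ < ε := by linarith

end Scaling

/-! ### Continuity theorem for finite measures. -/

section LevyContinuity

lemma charFun_nnreal_smul_measure (a : NNReal) (μ : Measure ℝ) (t : ℝ) :
    charFun (a • μ) t = a * charFun μ t := by
  rw [charFun_apply_real, charFun_apply_real, integral_smul_nnreal_measure]
  rfl

/-- Lévy's continuity theorem for finite measures with a nonzero limit. -/
lemma FiniteMeasure.tendsto_of_tendsto_charFun {μs : ℕ → FiniteMeasure ℝ} {μ : FiniteMeasure ℝ}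
    (h0 : μ ≠ 0)
    (h : ∀ t, Tendsto (fun n => charFun (μs n : Measure ℝ) t) atTop
      (𝓝 (charFun (μ : Measure ℝ) t))) :
    Tendsto μs atTop (𝓝 μ) := by
  have hmass : ∀ ν : FiniteMeasure ℝ, charFun (ν : Measure ℝ) 0 = ((ν.mass : ℝ) : ℂ) := fun ν => by
    rw [charFun_zero]
    rfl
  have hm : Tendsto (fun n => (μs n).mass) atTop (𝓝 μ.mass) := by
    have := h 0
    simp only [hmass] at this
    have h2 := (Complex.continuous_re.tendsto _).comp this
    rw [← NNReal.tendsto_coe]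
    simpa [Function.comp_def] using h2
  have hmpos : 0 < μ.mass := pos_iff_ne_zero.2 (μ.mass_nonzero_iff.2 h0)
  rw [← FiniteMeasure.tendsto_normalize_iff_tendsto h0]
  refine ⟨ProbabilityMeasure.tendsto_of_tendsto_charFun fun t => ?_, hm⟩
  rw [FiniteMeasure.toMeasure_normalize_eq_of_nonzero _ h0, charFun_nnreal_smul_measure]
  have hinv : Tendsto (fun n => ((((μs n).mass⁻¹ : NNReal) : ℝ) : ℂ)) atTop
      (𝓝 (((μ.mass⁻¹ : NNReal) : ℝ) : ℂ)) :=
    (Complex.continuous_ofReal.tendsto _).comp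
      (NNReal.tendsto_coe.2 (hm.inv₀ hmpos.ne'))
  refine (hinv.mul (h t)).congr' ?_
  filter_upwards [hm.eventually (lt_mem_nhds hmpos)] with n hn
  rw [FiniteMeasure.toMeasure_normalize_eq_of_nonzero _
    ((μs n).mass_nonzero_iff.1 hn.ne'), charFun_nnreal_smul_measure]

end LevyContinuity

/-! ### Lévy exponents and their second differences. -/

section LevyMeasure

variable {ν : Measure ℝ}

/-- The integrand in the Lévy–Khinchine formula. -/
noncomputable def levyIntegrand (θ x : ℝ) : ℂ :=
  Complex.exp (Complex.I * θ * x) - 1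
    - Complex.I * θ * (Set.Ioo (-1 : ℝ) 1).indicator (fun y => y) x

lemma one_sub_cos_le_min (t x : ℝ) : 1 - Real.cos (t * x) ≤ (2 + t ^ 2) * min 1 (x ^ 2) := by
  rcases le_total 1 (x ^ 2) with h | h
  · rw [min_eq_left h]
    nlinarith [Real.neg_one_le_cos (t * x), sq_nonneg t]
  · rw [min_eq_right h]
    have := Real.one_sub_sq_div_two_le_cos (x := t * x)
    nlinarith [mul_nonneg (sq_nonneg t) (sq_nonneg x), sq_nonneg x]

lemma abs_one_sub_cos (u : ℝ) : |1 - Real.cos u| = 1 - Real.cos u :=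
  abs_of_nonneg (by linarith [Real.cos_le_one u])

lemma integrable_one_sub_cos_levy (hν : Integrable (fun x : ℝ => min 1 (x ^ 2)) ν) (t : ℝ) :
    Integrable (fun x => 1 - Real.cos (t * x)) ν := by
  refine (hν.const_mul (2 + t ^ 2)).mono' (by fun_prop) (ae_of_all _ fun x => ?_)
  rw [Real.norm_eq_abs, abs_one_sub_cos]
  exact one_sub_cos_le_min t x

lemma norm_levyIntegrand_le (θ x : ℝ) :
    ‖levyIntegrand θ x‖ ≤ (3 * θ ^ 2 + 2) * min 1 (x ^ 2) := by
  have he : ∀ u : ℝ, ‖Complex.exp (Complex.I * u)‖ = 1 := fun u => by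
    rw [mul_comm, Complex.norm_exp_ofReal_mul_I]
  have hb : ‖Complex.exp (Complex.I * (θ * x : ℝ)) - 1‖ ≤ 2 := by
    refine (norm_sub_le _ _).trans ?_
    rw [he, norm_one]
    norm_num
  have h1 : Complex.I * θ * x = Complex.I * (θ * x : ℝ) := by
    push_cast
    ring
  unfold levyIntegrand
  by_cases hx : x ∈ Set.Ioo (-1 : ℝ) 1
  · have hx2 : x ^ 2 ≤ 1 := by nlinarith [hx.1, hx.2]
    rw [Set.indicator_of_mem hx, h1, min_eq_right hx2]
    have key : ‖Complex.exp (Complex.I * (θ * x : ℝ)) - 1 - Complex.I * (θ * x : ℝ)‖ ≤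
        3 * (θ * x) ^ 2 := by
      have hn : ‖Complex.I * ((θ * x : ℝ) : ℂ)‖ = |θ * x| := by
        rw [norm_mul, Complex.norm_I, one_mul, Complex.norm_real, Real.norm_eq_abs]
      rcases le_total |θ * x| 1 with h | h
      · have := Complex.norm_exp_sub_one_sub_id_le (x := Complex.I * ((θ * x : ℝ) : ℂ))
          (by rwa [hn])
        rw [hn, sq_abs] at this
        nlinarith [sq_nonneg (θ * x)]
      · refine (norm_sub_le _ _).trans ?_
        rw [hn, ← sq_abs (θ * x)]
        nlinarith
    refine key.trans ?_
    nlinarith [sq_nonneg x]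
  · have hx2 : 1 ≤ x ^ 2 := by
      rw [Set.mem_Ioo, not_and_or, not_lt, not_lt] at hx
      rcases hx with h | h <;> nlinarith
    rw [Set.indicator_of_notMem hx, h1, min_eq_left hx2]
    simp only [Complex.ofReal_zero, mul_zero, sub_zero, mul_one]
    nlinarith [sq_nonneg θ]

lemma measurable_levyIntegrand (θ : ℝ) : Measurable (levyIntegrand θ) := by
  unfold levyIntegrand
  have : Measurable ((Set.Ioo (-1 : ℝ) 1).indicator fun y => y) :=
    measurable_id.indicator measurableSet_Ioo
  fun_prop

lemma integrable_levyIntegrand (hν : Integrable (fun x : ℝ => min 1 (x ^ 2)) ν) (θ : ℝ) :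
    Integrable (levyIntegrand θ) ν :=
  (hν.const_mul _).mono' (measurable_levyIntegrand θ).aestronglyMeasurable
    (ae_of_all _ fun x => norm_levyIntegrand_le θ x)

lemma levyIntegrand_re (θ x : ℝ) : (levyIntegrand θ x).re = -(1 - Real.cos (θ * x)) := by
  have h1 : Complex.I * θ * x = ((θ * x : ℝ) : ℂ) * Complex.I := by
    push_cast
    ring
  have h2 : ∀ y : ℝ, Complex.I * θ * y = ((θ * y : ℝ) : ℂ) * Complex.I := fun y => by
    push_cast
    ring
  unfold levyIntegrand
  rw [h1, h2, Complex.sub_re, Complex.sub_re, Complex.exp_ofReal_mul_I_re, Complex.re_ofReal_mul]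
  simp

lemma integral_levyIntegrand_re (hν : Integrable (fun x : ℝ => min 1 (x ^ 2)) ν) (θ : ℝ) :
    (∫ x, levyIntegrand θ x ∂ν).re = -∫ x, (1 - Real.cos (θ * x)) ∂ν := by
  rw [← RCLike.re_eq_complex_re, ← integral_re (integrable_levyIntegrand hν θ), ← integral_neg]
  simp_rw [RCLike.re_eq_complex_re, levyIntegrand_re]

/-- Terms constant or linear in `θ` disappear, so the compensator drops out. The factor `1 - cos (s
x)` that remains makes an infinite Lévy measure finite. -/
lemma levyIntegrand_second_difference (θ s x : ℝ) :
    2 * levyIntegrand θ x - levyIntegrand (θ + s) x - levyIntegrand (θ - s) x =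
      2 * ((1 - Real.cos (s * x) : ℝ) * Complex.exp (θ * x * Complex.I)) := by
  unfold levyIntegrand
  have h1 : Complex.exp (Complex.I * (θ + s : ℝ) * x) =
      Complex.exp (θ * x * Complex.I) * Complex.exp ((s * x : ℝ) * Complex.I) := by
    rw [← Complex.exp_add]
    congr 1
    push_cast
    ring
  have h2 : Complex.exp (Complex.I * (θ - s : ℝ) * x) =
      Complex.exp (θ * x * Complex.I) * Complex.exp ((-(s * x) : ℝ) * Complex.I) := by
    rw [← Complex.exp_add]
    congr 1
    push_cast
    ring
  have h3 : Complex.exp (Complex.I * θ * x) = Complex.exp (θ * x * Complex.I) := by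
    congr 1
    ring
  rw [h1, h2, h3]
  rw [Complex.exp_mul_I ((s * x : ℝ) : ℂ), Complex.exp_mul_I ((-(s * x) : ℝ) : ℂ)]
  push_cast
  rw [Complex.cos_neg, Complex.sin_neg]
  ring

/-- `ν` weighted by `1 - cos (s x)`. -/
noncomputable def cosWeighted (ν : Measure ℝ) (s : ℝ) : Measure ℝ :=
  ν.withDensity fun x => ENNReal.ofReal (1 - Real.cos (s * x))

lemma integral_cosWeighted {E : Type*} [NormedAddCommGroup E] [NormedSpace ℝ E] (s : ℝ)
    (f : ℝ → E) : ∫ x, f x ∂(cosWeighted ν s) = ∫ x, (1 - Real.cos (s * x)) • f x ∂ν := by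
  unfold cosWeighted
  rw [integral_withDensity_eq_integral_toReal_smul (by fun_prop) (ae_of_all _ fun _ => by simp)]
  congr with x
  rw [ENNReal.toReal_ofReal (by linarith [Real.cos_le_one (s * x)])]

lemma isFiniteMeasure_cosWeighted (hν : Integrable (fun x : ℝ => min 1 (x ^ 2)) ν) (s : ℝ) :
    IsFiniteMeasure (cosWeighted ν s) :=
  isFiniteMeasure_withDensity_ofReal (integrable_one_sub_cos_levy hν s).2

lemma charFun_cosWeighted (θ s : ℝ) : charFun (cosWeighted ν s) θ =
    ∫ x : ℝ, ((1 - Real.cos (s * x) : ℝ) * Complex.exp (θ * x * Complex.I)) ∂ν := by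
  rw [charFun_apply_real, integral_cosWeighted]
  simp

lemma cosWeighted_real_univ (hν : Integrable (fun x : ℝ => min 1 (x ^ 2)) ν) (s : ℝ) :
    (cosWeighted ν s).real Set.univ = ∫ x, (1 - Real.cos (s * x)) ∂ν := by
  have := isFiniteMeasure_cosWeighted hν s
  have h := integral_cosWeighted (ν := ν) s (fun _ => (1 : ℝ))
  simpa using h

lemma two_mul_charFun_cosWeighted_levy (hν : Integrable (fun x : ℝ => min 1 (x ^ 2)) ν)
    (θ s : ℝ) : 2 * charFun (cosWeighted ν s) θ =
      2 * ∫ x, levyIntegrand θ x ∂ν - ∫ x, levyIntegrand (θ + s) x ∂ν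
        - ∫ x, levyIntegrand (θ - s) x ∂ν := by
  have h1 := (integrable_levyIntegrand hν θ).const_mul 2
  have h2 := integrable_levyIntegrand hν (θ + s)
  have h3 := integrable_levyIntegrand hν (θ - s)
  have h4 : Integrable (fun x => 2 * levyIntegrand θ x - levyIntegrand (θ + s) x) ν := h1.sub h2
  rw [charFun_cosWeighted, ← integral_const_mul, ← integral_const_mul, ← integral_sub h1 h2,
    ← integral_sub h4 h3]
  congr with x
  rw [levyIntegrand_second_difference]

lemma integrable_min_of_isFiniteMeasure (ρ : Measure ℝ) [IsFiniteMeasure ρ] :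
    Integrable (fun x : ℝ => min 1 (x ^ 2)) ρ :=
  integrable_of_abs_le 1 (by fun_prop) fun x => by
    rw [abs_of_nonneg (le_min zero_le_one (sq_nonneg x))]
    exact min_le_left _ _

lemma two_mul_charFun_cosWeighted (ρ : Measure ℝ) [IsFiniteMeasure ρ] (θ s : ℝ) :
    2 * charFun (cosWeighted ρ s) θ =
      2 * charFun ρ θ - charFun ρ (θ + s) - charFun ρ (θ - s) := by
  have h1 := (integrable_cexp_mul_I ρ θ).const_mul 2
  have h2 := integrable_cexp_mul_I ρ (θ + s)
  have h3 := integrable_cexp_mul_I ρ (θ - s)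
  have h4 : Integrable (fun x : ℝ => 2 * Complex.exp (θ * x * Complex.I) -
      Complex.exp ((θ + s : ℝ) * x * Complex.I)) ρ := h1.sub h2
  rw [charFun_cosWeighted, ← integral_const_mul, charFun_apply_real, charFun_apply_real,
    charFun_apply_real, ← integral_const_mul, ← integral_sub h1 h2, ← integral_sub h4 h3]
  congr with x
  rw [← levyIntegrand_second_difference]
  -- The two integrands differ by a function affine in `t`, which has zero second difference.
  have e : ∀ t : ℝ, Complex.exp (t * x * Complex.I) = levyIntegrand t x + 1 +
      t * (Complex.I * (Set.Ioo (-1 : ℝ) 1).indicator (fun y => y) x) := fun t => by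
    unfold levyIntegrand
    rw [show (t : ℂ) * x * Complex.I = Complex.I * t * x by ring]
    ring
  rw [e, e, e]
  push_cast
  ring

end LevyMeasure

/-! ### Inverting the complex exponential near the origin. -/

section ExpInjective

/-- On the unit disc imaginary parts are below `π / 2`, so the principal logarithm inverts `exp` and
is continuous at `exp w`. -/
lemma tendsto_of_tendsto_cexp {z : ℕ → ℂ} {w : ℂ} (hz : ∀ᶠ n in atTop, ‖z n‖ ≤ 1) (hw : ‖w‖ ≤ 1)
    (h : Tendsto (fun n => Complex.exp (z n)) atTop (𝓝 (Complex.exp w))) :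
    Tendsto z atTop (𝓝 w) := by
  have hlog : ∀ v : ℂ, ‖v‖ ≤ 1 → Complex.log (Complex.exp v) = v := fun v hv => by
    have := (Complex.abs_im_le_norm v).trans hv
    rw [abs_le] at this
    exact Complex.log_exp (by linarith [Real.pi_gt_three]) (by linarith [Real.pi_gt_three])
  have hs : Complex.exp w ∈ Complex.slitPlane := by
    left
    rw [Complex.exp_re]
    have := abs_le.1 ((Complex.abs_im_le_norm w).trans hw)
    exact mul_pos (Real.exp_pos _) (Real.cos_pos_of_mem_Ioo
      ⟨by linarith [Real.pi_gt_three], by linarith [Real.pi_gt_three]⟩)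
  have h1 := h.clog hs
  rw [hlog w hw] at h1
  refine h1.congr' ?_
  filter_upwards [hz] with n hn
  exact hlog _ hn

end ExpInjective

/-! ### Vague convergence of the scaled laws to the Lévy measure. -/

section Vague

variable {F : Measure ℝ} {c : ℕ → ℝ} {ν : Measure ℝ}

/-- `n` times the law of `X / c n`, where `X` has law `F`. -/
noncomputable def scaledLaw (F : Measure ℝ) (c : ℕ → ℝ) (n : ℕ) : Measure ℝ :=
  (n : NNReal) • F.map fun x => (c n)⁻¹ * x

instance [IsProbabilityMeasure F] (n : ℕ) : IsFiniteMeasure (scaledLaw F c n) := by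
  have : IsProbabilityMeasure (F.map fun x => (c n)⁻¹ * x) :=
    Measure.isProbabilityMeasure_map (by fun_prop)
  unfold scaledLaw
  infer_instance

lemma charFun_scaledLaw (n : ℕ) (θ : ℝ) :
    charFun (scaledLaw F c n) θ = n * charFun F (θ / c n) := by
  rw [scaledLaw, charFun_nnreal_smul_measure, charFun_map_mul, div_eq_inv_mul]
  simp

lemma integral_scaledLaw (n : ℕ) {f : ℝ → ℝ} (hf : Measurable f) :
    ∫ x, f x ∂(scaledLaw F c n) = n * ∫ x, f ((c n)⁻¹ * x) ∂F := by
  rw [scaledLaw, integral_smul_nnreal_measure, integral_map (by fun_prop)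
    hf.aestronglyMeasurable]
  simp [NNReal.smul_def]

variable [IsProbabilityMeasure F]

lemma integral_one_sub_cos_scaledLaw (n : ℕ) (s : ℝ) :
    ∫ x, (1 - Real.cos (s * x)) ∂(scaledLaw F c n) = n * (1 - (charFun F (s / c n)).re) := by
  rw [integral_scaledLaw n (by fun_prop), one_sub_re_charFun]
  congr with x
  ring_nf

/-- Passage from the normalized sums to the compound Poisson exponents. -/
lemma tendsto_cexp_of_tendsto_charFun_pow {d : ℕ → ℝ} {w : ℂ} {θ : ℝ}
    (hsq : Tendsto (fun n : ℕ => n * ‖1 - charFun F (θ / c n)‖ ^ 2) atTop (𝓝 0))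
    (h : Tendsto (fun n : ℕ => charFun F (θ / c n) ^ n * Complex.exp (-(Complex.I * θ * d n)))
      atTop (𝓝 w)) :
    Tendsto (fun n : ℕ => Complex.exp (n * (charFun F (θ / c n) - 1) - Complex.I * θ * d n))
      atTop (𝓝 w) := by
  have hsmall : ∀ᶠ n : ℕ in atTop, ‖1 - charFun F (θ / c n)‖ ≤ 1 := by
    filter_upwards [hsq.eventually (gt_mem_nhds one_pos), eventually_ge_atTop 1] with n hn hn1
    have h1 : (1 : ℝ) ≤ n := by exact_mod_cast hn1
    by_contra! hcon
    nlinarith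
  have hn1 : ∀ n, ‖Complex.exp (-(Complex.I * θ * d n))‖ = 1 := fun n => by
    rw [show -(Complex.I * θ * d n) = ((-(θ * d n) : ℝ) : ℂ) * Complex.I by push_cast; ring,
      Complex.norm_exp_ofReal_mul_I]
  -- Powers of points of the unit disc differ by at most `n` times the distance of the points, and
  -- `exp (φ - 1) - φ` has norm at most `‖φ - 1‖ ^ 2`.
  have hdiff : Tendsto (fun n : ℕ =>
      Complex.exp (n * (charFun F (θ / c n) - 1) - Complex.I * θ * d n) -
      charFun F (θ / c n) ^ n * Complex.exp (-(Complex.I * θ * d n))) atTop (𝓝 0) := by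
    refine squeeze_zero_norm' ?_ hsq
    filter_upwards [hsmall] with n hn
    have e : Complex.exp (n * (charFun F (θ / c n) - 1) - Complex.I * θ * d n) =
        Complex.exp (charFun F (θ / c n) - 1) ^ n * Complex.exp (-(Complex.I * θ * d n)) := by
      rw [sub_eq_add_neg _ (Complex.I * θ * d n), Complex.exp_add, Complex.exp_nat_mul]
    rw [e, ← sub_mul, norm_mul, hn1, mul_one]
    have hw : ‖Complex.exp (charFun F (θ / c n) - 1)‖ ≤ 1 := by
      rw [Complex.norm_exp, Real.exp_le_one_iff, Complex.sub_re, Complex.one_re]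
      linarith [re_charFun_le_one (μ := F) (θ / c n)]
    refine (norm_pow_sub_pow_le_mul n hw (norm_charFun_le_one _)).trans ?_
    gcongr
    rw [norm_sub_rev] at hn
    rw [norm_sub_rev 1 (charFun F (θ / c n)), show Complex.exp (charFun F (θ / c n) - 1) -
      charFun F (θ / c n) = Complex.exp (charFun F (θ / c n) - 1) - 1 -
        (charFun F (θ / c n) - 1) by ring]
    exact Complex.norm_exp_sub_one_sub_id_le hn
  simpa using hdiff.add h

/-- With `E` the exponentials in `hE`, the quotient `E(θ)² / (E(θ + s) E(θ - s))` involves neither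
`γ` nor `d n` and is the exponential of twice the wanted characteristic function. The bound `hs`
keeps these exponents in the unit disc, where `exp` can be inverted. -/
lemma tendsto_charFun_cosWeighted {d : ℕ → ℝ} {γ s : ℝ}
    (hν : Integrable (fun x : ℝ => min 1 (x ^ 2)) ν)
    (hE : ∀ θ : ℝ, Tendsto
      (fun n : ℕ => Complex.exp (n * (charFun F (θ / c n) - 1) - Complex.I * θ * d n)) atTop
      (𝓝 (Complex.exp (Complex.I * θ * γ + ∫ x, levyIntegrand θ x ∂ν))))
    (hs : ∀ᶠ n : ℕ in atTop, n * (1 - (charFun F (s / c n)).re) ≤ 1 / 2) (θ : ℝ) :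
    Tendsto (fun n => charFun (cosWeighted (scaledLaw F c n) s) θ) atTop
      (𝓝 (charFun (cosWeighted ν s) θ)) := by
  have hexp : ∀ θ, Tendsto
      (fun n => Complex.exp (2 * charFun (cosWeighted (scaledLaw F c n) s) θ)) atTop
      (𝓝 (Complex.exp (2 * charFun (cosWeighted ν s) θ))) := by
    intro θ
    have h1 := (((hE θ).pow 2).div (hE (θ + s)) (Complex.exp_ne_zero _)).div (hE (θ - s))
      (Complex.exp_ne_zero _)
    have e : Complex.exp (2 * charFun (cosWeighted ν s) θ) =
        Complex.exp (Complex.I * θ * γ + ∫ x, levyIntegrand θ x ∂ν) ^ 2 /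
        Complex.exp (Complex.I * (θ + s : ℝ) * γ + ∫ x, levyIntegrand (θ + s) x ∂ν) /
        Complex.exp (Complex.I * (θ - s : ℝ) * γ + ∫ x, levyIntegrand (θ - s) x ∂ν) := by
      rw [two_mul_charFun_cosWeighted_levy hν, ← Complex.exp_nat_mul, ← Complex.exp_sub,
        ← Complex.exp_sub]
      congr 1
      push_cast
      ring
    rw [e]
    refine h1.congr fun n => ?_
    rw [two_mul_charFun_cosWeighted, charFun_scaledLaw, charFun_scaledLaw, charFun_scaledLaw]
    simp only [Pi.div_apply]
    rw [← Complex.exp_nat_mul, ← Complex.exp_sub, ← Complex.exp_sub]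
    congr 1
    push_cast
    ring
  have hbound : ∀ᶠ n : ℕ in atTop, ∀ θ,
      ‖2 * charFun (cosWeighted (scaledLaw F c n) s) θ‖ ≤ 1 := by
    filter_upwards [hs] with n hn θ
    have hi := integrable_min_of_isFiniteMeasure (scaledLaw F c n)
    have := isFiniteMeasure_cosWeighted hi s
    have h1 := norm_charFun_le (μ := cosWeighted (scaledLaw F c n) s) θ
    rw [cosWeighted_real_univ hi, integral_one_sub_cos_scaledLaw] at h1
    rw [norm_mul, Complex.norm_ofNat]
    linarith
  have := isFiniteMeasure_cosWeighted hν s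
  -- At `θ = 0` the exponent is twice the mass, a real number, so the bound passes to the limit.
  have hmass : (cosWeighted ν s).real Set.univ ≤ 1 / 2 := by
    have h0 := hexp 0
    have hre := h0.norm
    simp only [Complex.norm_exp, charFun_zero] at hre
    have h2 : Real.exp (2 * ((cosWeighted ν s).real Set.univ : ℂ)).re ≤ Real.exp 1 := by
      refine le_of_tendsto hre ?_
      filter_upwards [hbound] with n hn
      have h3 := hn 0
      rw [charFun_zero] at h3
      exact Real.exp_le_exp.2 ((Complex.re_le_norm _).trans h3)
    rw [Real.exp_le_exp] at h2
    have h4 : (2 * ((cosWeighted ν s).real Set.univ : ℂ)).re =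
        2 * (cosWeighted ν s).real Set.univ := by
      simp
    linarith
  have hlim : ‖2 * charFun (cosWeighted ν s) θ‖ ≤ 1 := by
    have h1 := norm_charFun_le (μ := cosWeighted ν s) θ
    rw [norm_mul, Complex.norm_ofNat]
    linarith
  have hfin := tendsto_of_tendsto_cexp (hbound.mono fun n hn => hn θ) hlim (hexp θ)
  have := hfin.const_mul (1 / 2 : ℂ)
  simpa using this

/-- Convergence of the scaled laws against continuous functions that vanish near the origin and
near infinity. -/
lemma tendsto_mul_integral_of_tendsto_charFun_cosWeighted {s q₀ : ℝ}
    (hν : Integrable (fun x : ℝ => min 1 (x ^ 2)) ν)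
    (h0 : 0 < ∫ x, (1 - Real.cos (s * x)) ∂ν)
    (h : ∀ θ, Tendsto (fun n => charFun (cosWeighted (scaledLaw F c n) s) θ) atTop
      (𝓝 (charFun (cosWeighted ν s) θ)))
    {f : ℝ → ℝ} {C : ℝ} (hf : Continuous f) (hfC : ∀ x, |f x| ≤ C) (hq₀ : 0 < q₀)
    (hsupp : ∀ x, f x ≠ 0 → q₀ ≤ 1 - Real.cos (s * x)) :
    Tendsto (fun n : ℕ => n * ∫ x, f ((c n)⁻¹ * x) ∂F) atTop (𝓝 (∫ x, f x ∂ν)) := by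
  have hfin := isFiniteMeasure_cosWeighted hν s
  have hfin' : ∀ n, IsFiniteMeasure (cosWeighted (scaledLaw F c n) s) := fun n =>
    isFiniteMeasure_cosWeighted (integrable_min_of_isFiniteMeasure _) s
  set ms : ℕ → FiniteMeasure ℝ := fun n => ⟨cosWeighted (scaledLaw F c n) s, hfin' n⟩
  set m : FiniteMeasure ℝ := ⟨cosWeighted ν s, hfin⟩ with hm
  have hm0 : m ≠ 0 := by
    intro hz
    have h1 : cosWeighted ν s = 0 := congrArg Subtype.val hz
    rw [← cosWeighted_real_univ hν, h1] at h0
    simp at h0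
  have hw := FiniteMeasure.tendsto_of_tendsto_charFun (μs := ms) hm0 h
  rw [FiniteMeasure.tendsto_iff_forall_integral_tendsto] at hw
  -- Dividing `f` by the weight gives the test function; the maximum with `q₀` keeps it bounded and
  -- continuous and changes nothing where `f ≠ 0`.
  have hkc : Continuous fun x => f x / max q₀ (1 - Real.cos (s * x)) :=
    hf.div (by fun_prop) fun x => (lt_max_of_lt_left hq₀).ne'
  have hC0 : 0 ≤ C := (abs_nonneg _).trans (hfC 0)
  set k : BoundedContinuousFunction ℝ ℝ := BoundedContinuousFunction.ofNormedAddCommGroup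
    (fun x => f x / max q₀ (1 - Real.cos (s * x))) hkc (C / q₀) (by
      intro x
      rw [norm_div, Real.norm_eq_abs, Real.norm_eq_abs, abs_of_pos (lt_max_of_lt_left hq₀)]
      exact div_le_div₀ hC0 (hfC x) hq₀ (le_max_left _ _)) with hk
  have hmul : ∀ x, (1 - Real.cos (s * x)) • k x = f x := by
    intro x
    simp only [hk, BoundedContinuousFunction.coe_ofNormedAddCommGroup, smul_eq_mul]
    by_cases hx : f x = 0
    · simp [hx]
    · have := hsupp x hx
      rw [max_eq_right this, mul_div_cancel₀]
      linarith
  have := hw k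
  simp only [ms, hm, FiniteMeasure.toMeasure_mk, integral_cosWeighted, hmul] at this
  refine this.congr fun n => ?_
  rw [integral_scaledLaw n hf.measurable]

end Vague

/-! ### The stable Lévy measure: integrability and lower bounds. -/

section StableLevyMeasure

variable {α p q : ℝ}

/-- The density of `stableLevyMeasure α p q`. -/
noncomputable def stableLevyDensity (α p q x : ℝ) : ℝ :=
  if 0 < x then p * α * x ^ (-α - 1) else if x < 0 then q * α * |x| ^ (-α - 1) else 0

lemma stableLevyMeasure_eq (α p q : ℝ) : stableLevyMeasure α p q =
    volume.withDensity fun x => ENNReal.ofReal (stableLevyDensity α p q x) := rfl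

lemma measurable_stableLevyDensity (α p q : ℝ) : Measurable (stableLevyDensity α p q) := by
  unfold stableLevyDensity
  refine Measurable.ite measurableSet_Ioi (by fun_prop)
    (Measurable.ite measurableSet_Iio (by fun_prop) measurable_const)

lemma stableLevyDensity_nonneg (hα : 0 < α) (hp : 0 ≤ p) (hq : 0 ≤ q) (x : ℝ) :
    0 ≤ stableLevyDensity α p q x := by
  unfold stableLevyDensity
  split_ifs <;> positivity

lemma integrable_min_mul_abs_rpow (hα : 0 < α) (hα2 : α < 2) :
    Integrable (fun x : ℝ => min 1 (x ^ 2) * |x| ^ (-α - 1)) := by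
  have hpos : IntegrableOn (fun x : ℝ => min 1 (x ^ 2) * |x| ^ (-α - 1)) (Set.Ioi 0) := by
    rw [← Set.Ioc_union_Ioi_eq_Ioi (zero_le_one (α := ℝ))]
    refine IntegrableOn.union ?_ ?_
    · have h1 : IntegrableOn (fun x : ℝ => x ^ (1 - α)) (Set.Ioc 0 1) := by
        have := intervalIntegral.intervalIntegrable_rpow' (a := 0) (b := 1) (r := 1 - α)
          (by linarith)
        rwa [intervalIntegrable_iff_integrableOn_Ioc_of_le zero_le_one] at this
      refine h1.congr_fun (fun x hx => ?_) measurableSet_Ioc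
      have hx2 : x ^ 2 ≤ 1 := by nlinarith [hx.1, hx.2]
      simp only
      rw [min_eq_right hx2, abs_of_pos hx.1, ← Real.rpow_natCast, ← Real.rpow_add hx.1]
      congr 1
      push_cast
      ring
    · refine (integrableOn_Ioi_rpow_of_lt (a := -α - 1) (by linarith) one_pos).congr_fun
        (fun x hx => ?_) measurableSet_Ioi
      have hx1 : 1 < x := hx
      have hx2 : 1 ≤ x ^ 2 := by nlinarith
      simp only
      rw [min_eq_left hx2, abs_of_pos (by linarith), one_mul]
  have hneg : IntegrableOn (fun x : ℝ => min 1 (x ^ 2) * |x| ^ (-α - 1)) (Set.Iic 0) := by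
    have hpos' : IntegrableOn (fun x : ℝ => min 1 (x ^ 2) * |x| ^ (-α - 1)) (Set.Ioi (-0)) := by
      rwa [neg_zero]
    rw [integrableOn_Iic_iff_integrableOn_Iio]
    refine (IntegrableOn.comp_neg_Iio hpos').congr_fun (fun x _ => ?_) measurableSet_Iio
    simp only [neg_sq, abs_neg]
  rw [← integrableOn_univ, ← Set.Iic_union_Ioi (a := (0 : ℝ))]
  exact hneg.union hpos

lemma integrable_min_stableLevyMeasure (hα : 0 < α) (hα2 : α < 2) (hp : 0 ≤ p) (hq : 0 ≤ q) :
    Integrable (fun x : ℝ => min 1 (x ^ 2)) (stableLevyMeasure α p q) := by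
  rw [stableLevyMeasure_eq, integrable_withDensity_iff_integrable_smul'
    (measurable_stableLevyDensity α p q).ennreal_ofReal (ae_of_all _ fun _ => by simp)]
  refine ((integrable_min_mul_abs_rpow hα hα2).const_mul ((p + q) * α)).mono'
    (((measurable_stableLevyDensity α p q).ennreal_ofReal.ennreal_toReal.smul
      (by fun_prop)).aestronglyMeasurable) (ae_of_all _ fun x => ?_)
  have h0 := stableLevyDensity_nonneg hα hp hq x
  have hm : 0 ≤ min 1 (x ^ 2) := le_min zero_le_one (sq_nonneg x)
  rw [ENNReal.toReal_ofReal h0, smul_eq_mul, Real.norm_eq_abs, abs_of_nonneg (mul_nonneg h0 hm)]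
  have hd : stableLevyDensity α p q x ≤ (p + q) * α * |x| ^ (-α - 1) := by
    have hr : 0 ≤ |x| ^ (-α - 1) := by positivity
    unfold stableLevyDensity
    split_ifs with h1 h2
    · rw [abs_of_pos h1] at hr ⊢
      gcongr
      linarith
    · gcongr
      linarith
    · positivity
  calc stableLevyDensity α p q x * min 1 (x ^ 2)
      ≤ (p + q) * α * |x| ^ (-α - 1) * min 1 (x ^ 2) := by gcongr
    _ = _ := by ring

lemma measure_lt_top_of_integrable_min {ν : Measure ℝ}
    (hν : Integrable (fun x : ℝ => min 1 (x ^ 2)) ν) {δ : ℝ} (hδ : 0 < δ) :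
    ν {x | δ ≤ |x|} < ⊤ := by
  have h := hν.measure_ge_lt_top (ε := min 1 (δ ^ 2)) (by positivity)
  refine lt_of_le_of_lt (measure_mono fun x hx => ?_) h
  simp only [Set.mem_ofPred_eq] at hx ⊢
  have : δ ^ 2 ≤ x ^ 2 := by
    rw [← sq_abs x]
    gcongr
  exact min_le_min le_rfl this

/-- Staying at distance `δ` from the origin ensures finite mass; for an infinite mass `Measure.real`
would be `0`. -/
lemma le_stableLevyMeasure_of_le (hν : Integrable (fun x : ℝ => min 1 (x ^ 2))
      (stableLevyMeasure α p q)) {u v m : ℝ} (huv : u ≤ v) {δ : ℝ} (hδ : 0 < δ)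
    (hs : ∀ x ∈ Set.Icc u v, δ ≤ |x|)
    (h : ∀ x ∈ Set.Icc u v, m ≤ stableLevyDensity α p q x) :
    m * (v - u) ≤ (stableLevyMeasure α p q).real (Set.Icc u v) := by
  rcases le_total m 0 with hm | hm
  · exact (mul_nonpos_of_nonpos_of_nonneg hm (by linarith)).trans measureReal_nonneg
  have hfin : stableLevyMeasure α p q (Set.Icc u v) ≠ ⊤ :=
    ((measure_mono hs).trans_lt (measure_lt_top_of_integrable_min hν hδ)).ne
  rw [measureReal_def, ← ENNReal.ofReal_le_iff_le_toReal hfin]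
  rw [stableLevyMeasure_eq, withDensity_apply _ measurableSet_Icc]
  calc ENNReal.ofReal (m * (v - u)) = ∫⁻ _ in Set.Icc u v, ENNReal.ofReal m := by
        rw [setLIntegral_const, Real.volume_Icc, ENNReal.ofReal_mul hm]
    _ ≤ _ := setLIntegral_mono (measurable_stableLevyDensity α p q).ennreal_ofReal
        fun x hx => ENNReal.ofReal_le_ofReal (h x hx)

/-- The density decreases on the half-line, so its value at `3 * x` bounds it below. For `p > 0` the
bound is of order `x ^ (-α)` and blows up at the origin. -/
lemma le_stableLevyMeasure_Icc (hα : 0 < α) (hα2 : α < 2) (hp : 0 ≤ p) (hq : 0 ≤ q) {x : ℝ}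
    (hx : 0 < x) : p * α * (3 * x) ^ (-α - 1) * x ≤
      (stableLevyMeasure α p q).real (Set.Icc (2 * x) (3 * x)) := by
  have h := le_stableLevyMeasure_of_le (integrable_min_stableLevyMeasure hα hα2 hp hq)
    (u := 2 * x) (v := 3 * x) (m := p * α * (3 * x) ^ (-α - 1)) (by linarith) (δ := 2 * x)
    (by linarith) (fun y hy => hy.1.trans (le_abs_self y)) (fun y hy => by
      have hy0 : 0 < y := by linarith [hy.1]
      rw [stableLevyDensity, if_pos hy0]
      have := Real.rpow_le_rpow_of_nonpos hy0 hy.2 (by linarith : -α - 1 ≤ 0)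
      gcongr)
  linarith

lemma le_stableLevyMeasure_Icc_neg (hα : 0 < α) (hα2 : α < 2) (hp : 0 ≤ p) (hq : 0 ≤ q) {x : ℝ}
    (hx : 0 < x) : q * α * (3 * x) ^ (-α - 1) * x ≤
      (stableLevyMeasure α p q).real (Set.Icc (-(3 * x)) (-(2 * x))) := by
  have h := le_stableLevyMeasure_of_le (integrable_min_stableLevyMeasure hα hα2 hp hq)
    (u := -(3 * x)) (v := -(2 * x)) (m := q * α * (3 * x) ^ (-α - 1)) (by linarith) (δ := 2 * x)
    (by linarith) (fun y hy => by linarith [neg_le_abs y, hy.2]) (fun y hy => by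
      have hy0 : y < 0 := by linarith [hy.2]
      rw [stableLevyDensity, if_neg (by linarith), if_pos hy0]
      have : (3 * x) ^ (-α - 1) ≤ |y| ^ (-α - 1) := Real.rpow_le_rpow_of_nonpos (abs_pos.2 hy0.ne)
        (by rw [abs_of_neg hy0]; linarith [hy.1]) (by linarith : -α - 1 ≤ 0)
      gcongr)
  linarith

lemma stableLevyMeasure_Ioi_eq_zero : stableLevyMeasure α 0 q (Set.Ioi 0) = 0 := by
  rw [stableLevyMeasure_eq, withDensity_apply _ measurableSet_Ioi]
  rw [setLIntegral_congr_fun (g := fun _ => 0) measurableSet_Ioi fun x hx => by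
    simp [stableLevyDensity, Set.mem_Ioi.1 hx]]
  simp

/-- A set bounded away from the zeros of `1 - cos` that carries mass. -/
lemma stableLevyMeasure_pos (hα : 0 < α) (hα2 : α < 2) (hp : 0 ≤ p) (hq : 0 ≤ q)
    (hpq : 0 < p + q) : 0 < (stableLevyMeasure α p q).real {x | 2 ≤ |x| ∧ |x| ≤ 3} := by
  have hfin : stableLevyMeasure α p q {x | 2 ≤ |x| ∧ |x| ≤ 3} ≠ ⊤ :=
    ((measure_mono fun x hx => hx.1).trans_lt (measure_lt_top_of_integrable_min
      (integrable_min_stableLevyMeasure hα hα2 hp hq) two_pos)).ne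
  rcases hp.eq_or_lt with h | h
  · have hq0 : 0 < q := by linarith
    have h1 := le_stableLevyMeasure_Icc_neg hα hα2 hp hq one_pos
    refine lt_of_lt_of_le (by positivity) (h1.trans (measureReal_mono ?_ hfin))
    intro x hx
    have hx0 : x < 0 := by linarith [hx.2]
    simp only [Set.mem_ofPred_eq, abs_of_neg hx0]
    constructor <;> linarith [hx.1, hx.2]
  · have h1 := le_stableLevyMeasure_Icc hα hα2 hp hq one_pos
    refine lt_of_lt_of_le (by positivity) (h1.trans (measureReal_mono ?_ hfin))
    intro x hx
    have hx0 : 0 < x := by linarith [hx.1]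
    simp only [Set.mem_ofPred_eq, abs_of_pos hx0]
    constructor <;> linarith [hx.1, hx.2]

lemma integral_pos_of_le_on {ν : Measure ℝ} {A : Set ℝ} (hA : MeasurableSet A) (hνA : 0 < ν.real A)
    {f : ℝ → ℝ} (hf : Integrable f ν) (hf0 : ∀ x, 0 ≤ f x) {δ : ℝ} (hδ : 0 < δ)
    (h : ∀ x ∈ A, δ ≤ f x) : 0 < ∫ x, f x ∂ν := by
  have hfin : ν A ≠ ⊤ := fun ht => by
    rw [measureReal_def, ht] at hνA
    simp at hνA
  calc 0 < δ * ν.real A := by positivity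
    _ ≤ ∫ x in A, f x ∂ν := setIntegral_ge_of_const_le_real hA hfin h hf.integrableOn
    _ ≤ ∫ x, f x ∂ν := setIntegral_le_integral hf (ae_of_all _ hf0)

lemma measurableSet_two_le_abs_le_three : MeasurableSet {x : ℝ | 2 ≤ |x| ∧ |x| ≤ 3} :=
  (measurableSet_le (by fun_prop) (by fun_prop) : MeasurableSet {x : ℝ | 2 ≤ |x|}).inter
    (measurableSet_le (by fun_prop) (by fun_prop) : MeasurableSet {x : ℝ | |x| ≤ 3})

lemma integral_one_sub_cos_pos {ν : Measure ℝ} (hν : Integrable (fun x : ℝ => min 1 (x ^ 2)) ν)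
    (hpos : 0 < ν.real {x | 2 ≤ |x| ∧ |x| ≤ 3}) {s : ℝ} (hs : 0 < s) (hs1 : s ≤ 1) :
    0 < ∫ x, (1 - Real.cos (s * x)) ∂ν := by
  refine integral_pos_of_le_on measurableSet_two_le_abs_le_three hpos
    (integrable_one_sub_cos_levy hν s) (fun x => by linarith [Real.cos_le_one (s * x)])
    (δ := 2 / Real.pi ^ 2 * s ^ 2) (by positivity) fun x hx => ?_
  have h1 : |s * x| ≤ Real.pi := by
    rw [abs_mul, abs_of_pos hs]
    nlinarith [hx.2, Real.pi_gt_three, abs_nonneg x]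
  have h2 := Real.cos_le_one_sub_mul_cos_sq h1
  have h3 : s ^ 2 ≤ (s * x) ^ 2 := by
    rw [mul_pow, ← sq_abs x]
    have h4 : 1 ≤ |x| ^ 2 := by nlinarith [hx.1]
    nlinarith [sq_nonneg s]
  have h4 : 2 / Real.pi ^ 2 * s ^ 2 ≤ 2 / Real.pi ^ 2 * (s * x) ^ 2 := by gcongr
  linarith

/-- The difference of the integrands is `2 (1 - cos x) ^ 2`. Strictness is what distinguishes the
exponent from a Gaussian one, whose ratio is exactly `4`. -/
lemma integral_one_sub_cos_two_lt {ν : Measure ℝ}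
    (hν : Integrable (fun x : ℝ => min 1 (x ^ 2)) ν)
    (hpos : 0 < ν.real {x | 2 ≤ |x| ∧ |x| ≤ 3}) :
    ∫ x, (1 - Real.cos (2 * x)) ∂ν < 4 * ∫ x, (1 - Real.cos (1 * x)) ∂ν := by
  have i1 := (integrable_one_sub_cos_levy hν 1).const_mul 4
  have i2 := integrable_one_sub_cos_levy hν 2
  rw [← sub_pos, ← integral_const_mul, ← integral_sub i1 i2]
  have e : ∀ x : ℝ, 4 * (1 - Real.cos (1 * x)) - (1 - Real.cos (2 * x)) =
      2 * (1 - Real.cos x) ^ 2 := fun x => by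
    rw [Real.cos_two_mul, one_mul]
    ring
  refine integral_pos_of_le_on measurableSet_two_le_abs_le_three hpos (i1.sub i2)
    (fun x => by rw [e]; positivity) (δ := 2) two_pos fun x hx => ?_
  rw [e]
  have h1 : Real.cos x ≤ 0 := by
    rw [← Real.cos_abs]
    exact Real.cos_nonpos_of_pi_div_two_le_of_le (by linarith [hx.1, Real.pi_lt_d2])
      (by linarith [hx.2, Real.pi_gt_three])
  nlinarith

end StableLevyMeasure

/-! ### From normalized sums to the underlying law. -/

section NormalizedSums

/-- For `|u| ≤ u₀`, `‖1 - φ u‖` is at most the integral of the bounded continuous function `min 2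
(u₀ |x|)`. One test function thus serves all such `u`, which gives uniformity. -/
lemma eventually_le_norm_charFun {μs : ℕ → ProbabilityMeasure ℝ} {μ : ProbabilityMeasure ℝ}
    (h : Tendsto μs atTop (𝓝 μ)) {ε : ℝ} (hε : 0 < ε) :
    ∃ u₀ : ℝ, 0 < u₀ ∧ ∀ᶠ n in atTop, ∀ u, |u| ≤ u₀ →
      1 - ε ≤ ‖charFun (μs n : Measure ℝ) u‖ := by
  have hb : ∀ (u : ℝ) (x : ℝ), |min 2 (|u| * |x|)| ≤ 2 := fun u x => by
    rw [abs_of_nonneg (by positivity)]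
    exact min_le_left _ _
  have hlim : Tendsto (fun k : ℕ => ∫ x, min 2 (|(1 : ℝ) / (k + 1)| * |x|) ∂(μ : Measure ℝ)) atTop
      (𝓝 (∫ x, (0 : ℝ) ∂(μ : Measure ℝ))) := by
    refine tendsto_integral_of_dominated_convergence (fun _ => 2) (fun n => by fun_prop)
      (integrable_const _) (fun k => ae_of_all _ fun x => hb _ x) (ae_of_all _ fun x => ?_)
    have h1 : Tendsto (fun k : ℕ => |(1 : ℝ) / (k + 1)| * |x|) atTop (𝓝 0) := by
      simpa using (tendsto_one_div_add_atTop_nhds_zero_nat (𝕜 := ℝ)).abs.mul_const |x|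
    have h2 := (tendsto_const_nhds (x := (2 : ℝ))).min h1
    simpa using h2
  rw [integral_zero] at hlim
  obtain ⟨k, hk⟩ := (hlim.eventually (gt_mem_nhds hε)).exists
  set u₀ : ℝ := 1 / (k + 1) with hu₀
  have hu₀pos : 0 < u₀ := by positivity
  refine ⟨u₀, hu₀pos, ?_⟩
  rw [ProbabilityMeasure.tendsto_iff_forall_integral_tendsto] at h
  have h3 := h (BoundedContinuousFunction.ofNormedAddCommGroup
    (fun x => min 2 (|u₀| * |x|)) (by fun_prop) 2 (fun x => hb u₀ x))
  simp only [BoundedContinuousFunction.coe_ofNormedAddCommGroup] at h3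
  filter_upwards [h3.eventually (gt_mem_nhds hk)] with n hn u hu
  have h4 : ‖1 - charFun (μs n : Measure ℝ) u‖ ≤ ∫ x, min 2 (|u₀| * |x|) ∂(μs n : Measure ℝ) := by
    have : 1 - charFun (μs n : Measure ℝ) u =
        ∫ x : ℝ, (1 - Complex.exp (u * x * Complex.I)) ∂(μs n : Measure ℝ) := by
      rw [integral_sub (integrable_const _) (integrable_cexp_mul_I _ u), charFun_apply_real]
      simp
    rw [this]
    refine norm_integral_le_of_norm_le (integrable_of_abs_le 2 (by fun_prop) fun x => hb u₀ x)
      (ae_of_all _ fun x => le_min ?_ ?_)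
    · refine (norm_sub_le _ _).trans ?_
      rw [← Complex.ofReal_mul, Complex.norm_exp_ofReal_mul_I, norm_one]
      norm_num
    · rw [norm_sub_rev, ← Complex.ofReal_mul, mul_comm]
      refine Real.norm_exp_I_mul_ofReal_sub_one_le.trans ?_
      rw [Real.norm_eq_abs, abs_mul, abs_of_pos hu₀pos]
      gcongr
  have h5 : ‖(1 : ℂ)‖ ≤ ‖1 - charFun (μs n : Measure ℝ) u‖ + ‖charFun (μs n : Measure ℝ) u‖ := by
    simpa using norm_add_le (1 - charFun (μs n : Measure ℝ) u) (charFun (μs n : Measure ℝ) u)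
  rw [norm_one] at h5
  linarith

lemma charFun_map_normalized_sum (F : Measure ℝ) [IsProbabilityMeasure F] (n : ℕ) (c d θ : ℝ) :
    charFun ((Measure.pi fun _ : Fin n => F).map fun x : Fin n → ℝ => (∑ i, x i - d) / c) θ =
      charFun F (θ / c) ^ n * Complex.exp (-(Complex.I * θ * (d / c : ℝ))) := by
  have e : (fun x : Fin n → ℝ => (∑ i, x i - d) / c) =
      (fun y : ℝ => y + -(d / c)) ∘ (fun y : ℝ => c⁻¹ * y) ∘ fun x => ∑ i, x i := by
    ext x
    simp only [Function.comp_apply]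
    ring
  rw [e, ← Measure.map_map (by fun_prop) (by fun_prop), ← Measure.map_map (by fun_prop)
    (by fun_prop), charFun_map_add_const, charFun_map_mul, charFun_map_sum_pi_eq_prod]
  simp only [Finset.prod_const, Finset.card_univ, Fintype.card_fin, Pi.pow_apply]
  congr 2
  · rw [div_eq_inv_mul]
  · simp only [RCLike.inner_apply, conj_trivial]
    push_cast
    ring

/-- What convergence in distribution of the normalized sums to a stable law says about `F`: no
escape of mass to infinity, bounded truncated second moments, and vague convergence to the Lévy
measure. -/
theorem exists_scaling_of_inStableDomain {α : ℝ} (hα : 0 < α) (hα2 : α < 2) {F : Measure ℝ}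
    [IsProbabilityMeasure F] (hF : InStableDomain α F) :
    ∃ (p q : ℝ) (c : ℕ → ℝ), 0 ≤ p ∧ 0 ≤ q ∧ 0 < p + q ∧ (∀ n, 0 < c n) ∧
      Tendsto c atTop atTop ∧ Tendsto (fun n : ℕ => n / c n ^ 2) atTop (𝓝 0) ∧
      (∀ η : ℝ, 0 < η → ∃ r : ℝ, 0 < r ∧
        ∀ᶠ n : ℕ in atTop, n * F.real {x | c n * r < |x|} ≤ η) ∧
      (∃ C : ℝ, ∀ᶠ n : ℕ in atTop, n * ∫ x, min 1 ((x / c n) ^ 2) ∂F ≤ C) ∧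
      ∀ (f : ℝ → ℝ) (C δ R : ℝ), Continuous f → (∀ x, |f x| ≤ C) → 0 < δ →
        (∀ x, f x ≠ 0 → δ ≤ |x| ∧ |x| ≤ R) →
        Tendsto (fun n : ℕ => n * ∫ x, f ((c n)⁻¹ * x) ∂F) atTop
          (𝓝 (∫ x, f x ∂(stableLevyMeasure α p q))) := by
  obtain ⟨G, ⟨p, q, γ, hp, hq, hpq, hG⟩, c, d, hc, hconv⟩ := hF
  set ν := stableLevyMeasure α p q with hνdef
  have hν : Integrable (fun x : ℝ => min 1 (x ^ 2)) ν :=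
    integrable_min_stableLevyMeasure hα hα2 hp hq
  have hνpos : 0 < ν.real {x | 2 ≤ |x| ∧ |x| ≤ 3} := stableLevyMeasure_pos hα hα2 hp hq hpq
  have hmap : (G : Measure ℝ).map (fun y : ℝ => y) = G := Measure.map_id
  have hG' : ∀ θ : ℝ, charFun (G : Measure ℝ) θ =
      Complex.exp (Complex.I * θ * γ + ∫ x, levyIntegrand θ x ∂ν) := hG
  have hweak := hconv.tendsto
  have hcf : ∀ θ : ℝ, Tendsto (fun n : ℕ => charFun F (θ / c n) ^ n *
      Complex.exp (-(Complex.I * θ * (d n / c n : ℝ)))) atTop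
      (𝓝 (Complex.exp (Complex.I * θ * γ + ∫ x, levyIntegrand θ x ∂ν))) := by
    intro θ
    have h1 := (ProbabilityMeasure.tendsto_iff_tendsto_charFun.1 hweak) θ
    simp only [ProbabilityMeasure.coe_mk, charFun_map_normalized_sum, hmap, hG'] at h1
    exact h1
  have hnorm1 : ∀ θ x : ℝ, ‖Complex.exp (-(Complex.I * θ * x))‖ = 1 := fun θ x => by
    rw [show -(Complex.I * θ * x) = ((-(θ * x) : ℝ) : ℂ) * Complex.I by push_cast; ring,
      Complex.norm_exp_ofReal_mul_I]
  set J : ℝ → ℝ := fun θ => ∫ x, (1 - Real.cos (θ * x)) ∂ν with hJ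
  -- Taking moduli removes the unknown centerings `d n`.
  have hg : ∀ θ : ℝ, Tendsto (fun n : ℕ => n * (1 - ‖charFun F (θ / c n)‖ ^ 2)) atTop
      (𝓝 (2 * J θ)) := by
    intro θ
    refine tendsto_mul_one_sub_of_tendsto_pow (fun n => by positivity)
      (fun n => norm_charFun_sq_le_one _) ?_
    have h1 := (hcf θ).norm.pow 2
    have h2 : ‖Complex.exp (Complex.I * θ * γ + ∫ x, levyIntegrand θ x ∂ν)‖ ^ 2 =
        Real.exp (-(2 * J θ)) := by
      rw [Complex.norm_exp, ← Real.exp_nat_mul, Complex.add_re, integral_levyIntegrand_re hν]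
      congr 1
      simp [hJ]
    rw [h2] at h1
    refine h1.congr fun n => ?_
    rw [norm_mul, hnorm1, mul_one, norm_pow, ← pow_mul, ← pow_mul, mul_comm]
  have hunif : ∀ η : ℝ, 0 < η → ∃ u₀ : ℝ, 0 < u₀ ∧ ∀ᶠ n : ℕ in atTop, ∀ u, |u| ≤ u₀ →
      n * (1 - ‖charFun F (u / c n)‖ ^ 2) ≤ η := by
    intro η hη
    -- This gives `‖φ‖ ^ n ≥ exp (-η / 2)`, hence `n (1 - ‖φ‖ ^ 2) ≤ -2 n log ‖φ‖ ≤ η`.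
    obtain ⟨u₀, hu₀, h1⟩ := eventually_le_norm_charFun hweak (ε := 1 - Real.exp (-(η / 2)))
      (by simpa using hη)
    refine ⟨u₀, hu₀, ?_⟩
    filter_upwards [h1, eventually_ge_atTop 1] with n h2 hn u hu
    have h3 := h2 u hu
    simp only [ProbabilityMeasure.coe_mk, charFun_map_normalized_sum] at h3
    rw [norm_mul, hnorm1, mul_one, norm_pow, sub_sub_cancel] at h3
    have hpos : 0 < ‖charFun F (u / c n)‖ := by
      by_contra hcon
      have h0 : ‖charFun F (u / c n)‖ = 0 := le_antisymm (not_lt.1 hcon) (norm_nonneg _)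
      rw [h0, zero_pow (by omega)] at h3
      exact absurd h3 (not_le.2 (Real.exp_pos _))
    have h4 := sum_one_sub_le_neg_log (Finset.range n) (fun _ => ‖charFun F (u / c n)‖ ^ 2)
      (fun _ _ => by positivity)
    simp only [Finset.sum_const, Finset.prod_const, Finset.card_range, nsmul_eq_mul] at h4
    refine h4.trans ?_
    rw [← pow_mul, mul_comm, pow_mul, Real.log_pow]
    have h5 := Real.log_le_log (Real.exp_pos _) h3
    rw [Real.log_exp] at h5
    push_cast
    linarith
  have hJ1 : 0 < J 1 := integral_one_sub_cos_pos hν hνpos one_pos le_rfl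
  have hJ2 : J 2 < 4 * J 1 := integral_one_sub_cos_two_lt hν hνpos
  have hcT : Tendsto c atTop atTop := by
    obtain ⟨u₀, hu₀, h1⟩ := hunif 1 one_pos
    exact tendsto_scaling_atTop hc (by positivity : 0 < 2 * J 1) (hg 1) hu₀ h1
  have hnc : Tendsto (fun n : ℕ => n / c n ^ 2) atTop (𝓝 0) :=
    tendsto_div_scaling_sq hcT (by positivity : 0 < 2 * J 1) (by linarith) (hg 1) (hg 2)
  have hunif' : ∀ η : ℝ, 0 < η → ∃ u₀ : ℝ, 0 < u₀ ∧ ∀ᶠ n : ℕ in atTop, ∀ u, |u| ≤ u₀ →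
      n * (1 - (charFun F (u / c n)).re) ≤ η := by
    intro η hη
    obtain ⟨u₀, hu₀, h1⟩ := hunif (η / 5) (by positivity)
    refine ⟨u₀, hu₀, ?_⟩
    filter_upwards [eventually_mul_one_sub_re_charFun_le hnc (by positivity : 0 < η / 5) h1]
      with n hn u hu
    linarith [hn u hu]
  have hE : ∀ θ : ℝ, Tendsto (fun n : ℕ =>
      Complex.exp (n * (charFun F (θ / c n) - 1) - Complex.I * θ * (d n / c n : ℝ))) atTop
      (𝓝 (Complex.exp (Complex.I * θ * γ + ∫ x, levyIntegrand θ x ∂ν))) := fun θ =>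
    tendsto_cexp_of_tendsto_charFun_pow (d := fun n => d n / c n)
      (tendsto_mul_norm_one_sub_charFun_sq hnc (hg θ)) (hcf θ)
  have hbound : ∀ n : ℕ, ∀ r η u₀ : ℝ, 1 ≤ n → 0 < u₀ → r = 2 / u₀ →
      (∀ u, |u| ≤ u₀ → n * (1 - (charFun F (u / c n)).re) ≤ η) →
      n * F.real {x | c n * r < |x|} ≤ 2 * η := by
    intro n r η u₀ hn hu₀ hr h
    have hn0 : (0 : ℝ) < n := by exact_mod_cast hn
    have h1 := measureReal_abs_gt_le (μ := F) (r := c n * r) (η := η / n)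
      (by rw [hr]; exact mul_pos (hc n) (by positivity)) (by
        intro u hu
        have h2 := h (u * c n) (by
          rw [abs_mul, abs_of_pos (hc n)]
          have := hc n
          calc |u| * c n ≤ 2 / (c n * r) * c n := by gcongr
            _ = u₀ := by rw [hr]; field_simp)
        rw [mul_div_cancel_right₀ _ (hc n).ne'] at h2
        rw [le_div_iff₀ hn0]
        linarith)
    calc n * F.real {x | c n * r < |x|} ≤ n * (2 * (η / n)) := by gcongr
      _ = 2 * η := by field_simp
  refine ⟨p, q, c, hp, hq, hpq, hc, hcT, hnc, ?_, ?_, ?_⟩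
  · intro η hη
    obtain ⟨u₀, hu₀, h1⟩ := hunif' (η / 2) (by positivity)
    refine ⟨2 / u₀, by positivity, ?_⟩
    filter_upwards [h1, eventually_ge_atTop 1] with n hn hn1
    have := hbound n _ _ u₀ hn1 hu₀ rfl hn
    linarith
  · obtain ⟨u₀, hu₀, h1⟩ := hunif' 1 one_pos
    set r := 2 / u₀ with hr
    set K := Real.pi ^ 2 / (2 * u₀ ^ 2) with hK
    have hK0 : 0 < K := by positivity
    refine ⟨2 * 1 + K * 1, ?_⟩
    filter_upwards [h1, eventually_ge_atTop 1] with n hn hn1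
    have hcn := hc n
    set B : Set ℝ := {x | c n * r < |x|} with hB
    have hBm : MeasurableSet B := measurableSet_lt (by fun_prop) (by fun_prop)
    have hb1 := hbound n r 1 u₀ hn1 hu₀ hr hn
    have hb2 := hn u₀ (by rw [abs_of_pos hu₀])
    rw [one_sub_re_charFun] at hb2
    have i1 : Integrable (B.indicator fun _ => (1 : ℝ)) F := (integrable_const _).indicator hBm
    have i2 := (integrable_one_sub_cos F (u₀ / c n)).const_mul K
    -- Outside `B` the argument of the cosine is at most `2 < π` in modulus, so the quadratic lower
    -- bound for `1 - cos` controls `(x / c n) ^ 2`; on `B` the bound `1` suffices.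
    have hle : ∫ x, min 1 ((x / c n) ^ 2) ∂F ≤
        ∫ x, (B.indicator (fun _ => (1 : ℝ)) x + K * (1 - Real.cos (u₀ / c n * x))) ∂F := by
      refine integral_mono (integrable_of_abs_le 1 (by fun_prop) fun x => by
        rw [abs_of_nonneg (by positivity)]
        exact min_le_left _ _) (i1.add i2) fun x => ?_
      have hcos : 0 ≤ K * (1 - Real.cos (u₀ / c n * x)) :=
        mul_nonneg hK0.le (by linarith [Real.cos_le_one (u₀ / c n * x)])
      simp only
      by_cases hx : x ∈ B
      · rw [Set.indicator_of_mem hx]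
        linarith [min_le_left 1 ((x / c n) ^ 2)]
      · rw [Set.indicator_of_notMem hx, zero_add]
        refine (min_le_right _ _).trans ?_
        have hx' : |x| ≤ c n * r := by simpa [hB] using hx
        have habs : |u₀ / c n * x| ≤ Real.pi := by
          rw [abs_mul, abs_of_pos (by positivity)]
          calc u₀ / c n * |x| ≤ u₀ / c n * (c n * r) := by gcongr
            _ = 2 := by rw [hr]; field_simp
            _ ≤ Real.pi := by linarith [Real.pi_gt_three]
        have h2 := Real.cos_le_one_sub_mul_cos_sq habs
        calc (x / c n) ^ 2 = K * (2 / Real.pi ^ 2 * (u₀ / c n * x) ^ 2) := by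
              rw [hK]
              field_simp
          _ ≤ K * (1 - Real.cos (u₀ / c n * x)) := by
              gcongr
              linarith
    rw [integral_add i1 i2, integral_const_mul, integral_indicator hBm, setIntegral_const,
      smul_eq_mul, mul_one] at hle
    calc n * ∫ x, min 1 ((x / c n) ^ 2) ∂F
        ≤ n * (F.real B + K * ∫ x, (1 - Real.cos (u₀ / c n * x)) ∂F) := by gcongr
      _ = n * F.real B + K * (n * ∫ x, (1 - Real.cos (u₀ / c n * x)) ∂F) := by ring
      _ ≤ 2 * 1 + K * 1 := by gcongr
  · intro f C δ R hf hfC hδ hsupp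
    obtain ⟨u₀, hu₀, h1⟩ := hunif' (1 / 2) (by norm_num)
    set R' := max R δ with hR'
    have hR'0 : 0 < R' := lt_max_of_lt_right hδ
    -- The three constraints give, in turn, the bound `1 / 2` at frequency `s`, positive mass of the
    -- weighted Lévy measure, and `|s * x| ≤ 3 < π` on the support of `f`, where the weight is then
    -- bounded below.
    set s := min (min u₀ 1) (3 / R') with hs
    have hs0 : 0 < s := by positivity
    have hsu : s ≤ u₀ := (min_le_left _ _).trans (min_le_left _ _)
    have hs1 : s ≤ 1 := (min_le_left _ _).trans (min_le_right _ _)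
    have hsR : s ≤ 3 / R' := min_le_right _ _
    have h2 := tendsto_charFun_cosWeighted (d := fun n => d n / c n) (s := s) hν hE
      (h1.mono fun n hn => hn s (by rwa [abs_of_pos hs0]))
    refine tendsto_mul_integral_of_tendsto_charFun_cosWeighted hν
      (integral_one_sub_cos_pos hν hνpos hs0 hs1) h2 hf hfC
      (q₀ := 2 / Real.pi ^ 2 * (s * δ) ^ 2) (by positivity) fun x hx => ?_
    obtain ⟨h3, h4⟩ := hsupp x hx
    have habs : |s * x| ≤ Real.pi := by
      rw [abs_mul, abs_of_pos hs0]
      calc s * |x| ≤ 3 / R' * R' := by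
            gcongr
            exact h4.trans (le_max_left _ _)
        _ = 3 := by field_simp
        _ ≤ Real.pi := Real.pi_gt_three.le
    have h5 := Real.cos_le_one_sub_mul_cos_sq habs
    have h6 : (s * δ) ^ 2 ≤ (s * x) ^ 2 := by
      rw [← sq_abs (s * x), abs_mul, abs_of_pos hs0]
      gcongr
    have h7 : 2 / Real.pi ^ 2 * (s * δ) ^ 2 ≤ 2 / Real.pi ^ 2 * (s * x) ^ 2 := by gcongr
    linarith

end NormalizedSums

/-! ### Regularity of the right tail. -/

section Tails

variable {F : Measure ℝ} [IsProbabilityMeasure F]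

lemma tail_eq (x : ℝ) : tail F x = F.real (Set.Ioi x) := by
  rw [tail, cdf_eq_real, ← Set.compl_Iic, probReal_compl_eq_one_sub measurableSet_Iic]

lemma absTail_eq (x : ℝ) : absTail F x = F.real {y | x < |y|} := by
  have : IsProbabilityMeasure (F.map fun y : ℝ => |y|) :=
    Measure.isProbabilityMeasure_map (by fun_prop)
  rw [absTail, tail_eq, map_measureReal_apply (by fun_prop) measurableSet_Ioi]
  rfl

lemma tail_nonneg (x : ℝ) : 0 ≤ tail F x := by
  rw [tail_eq]
  exact measureReal_nonneg

lemma tail_antitone : Antitone (tail F) := fun x y h => by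
  rw [tail_eq, tail_eq]
  exact measureReal_mono (Set.Ioi_subset_Ioi h)

lemma absTail_antitone : Antitone (absTail F) := fun x y h => by
  rw [absTail_eq, absTail_eq]
  exact measureReal_mono fun z hz => lt_of_le_of_lt h hz

lemma tail_le_absTail (x : ℝ) : tail F x ≤ absTail F x := by
  rw [tail_eq, absTail_eq]
  exact measureReal_mono fun z hz => lt_of_lt_of_le hz (le_abs_self z)

lemma tendsto_tail (F : Measure ℝ) : Tendsto (tail F) atTop (𝓝 0) := by
  have := (tendsto_cdf_atTop F).const_sub 1
  rw [sub_self] at this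
  exact this

lemma measurableSet_preimage_mul (s : ℝ) {A : Set ℝ} (hA : MeasurableSet A) :
    MeasurableSet {y : ℝ | s * y ∈ A} :=
  (measurable_const_mul s) hA

/-- A trapezoidal function, equal to `1` on `[b, c]` and to `0` outside `(a, d)`. -/
noncomputable def trapezoid (a b c d y : ℝ) : ℝ :=
  max 0 (min 1 (min ((y - a) / (b - a)) ((d - y) / (d - c))))

lemma continuous_trapezoid (a b c d : ℝ) : Continuous (trapezoid a b c d) := by
  unfold trapezoid
  fun_prop

lemma trapezoid_nonneg (a b c d y : ℝ) : 0 ≤ trapezoid a b c d y := le_max_left _ _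

lemma trapezoid_le_one (a b c d y : ℝ) : trapezoid a b c d y ≤ 1 :=
  max_le zero_le_one (min_le_left _ _)

lemma trapezoid_eq_one {a b c d y : ℝ} (hab : a < b) (hcd : c < d) (hy : y ∈ Set.Icc b c) :
    trapezoid a b c d y = 1 := by
  unfold trapezoid
  have h1 : 1 ≤ (y - a) / (b - a) := by
    rw [le_div_iff₀ (by linarith)]
    linarith [hy.1]
  have h2 : 1 ≤ (d - y) / (d - c) := by
    rw [le_div_iff₀ (by linarith)]
    linarith [hy.2]
  rw [min_eq_left (le_min h1 h2), max_eq_right zero_le_one]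

lemma mem_Ioo_of_trapezoid_ne_zero {a b c d y : ℝ} (hab : a < b) (hcd : c < d)
    (hy : trapezoid a b c d y ≠ 0) : y ∈ Set.Ioo a d := by
  by_contra hcon
  apply hy
  unfold trapezoid
  refine max_eq_left ((min_le_right _ _).trans ?_)
  rw [Set.mem_Ioo, not_and_or, not_lt, not_lt] at hcon
  rcases hcon with h | h
  · exact (min_le_left _ _).trans (div_nonpos_of_nonpos_of_nonneg (by linarith) (by linarith))
  · exact (min_le_right _ _).trans (div_nonpos_of_nonpos_of_nonneg (by linarith) (by linarith))

lemma trapezoid_le_indicator {a b c d : ℝ} (hab : a < b) (hcd : c < d) (y : ℝ) :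
    trapezoid a b c d y ≤ (Set.Ioo a d).indicator (fun _ => (1 : ℝ)) y := by
  by_cases hy : y ∈ Set.Ioo a d
  · rw [Set.indicator_of_mem hy]
    exact trapezoid_le_one _ _ _ _ _
  · rw [Set.indicator_of_notMem hy]
    by_contra hcon
    exact hy (mem_Ioo_of_trapezoid_ne_zero hab hcd (not_le.1 hcon).ne')

lemma indicator_le_trapezoid {a b c d : ℝ} (hab : a < b) (hcd : c < d) (y : ℝ) :
    (Set.Icc b c).indicator (fun _ => (1 : ℝ)) y ≤ trapezoid a b c d y := by
  by_cases hy : y ∈ Set.Icc b c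
  · rw [Set.indicator_of_mem hy, trapezoid_eq_one hab hcd hy]
  · rw [Set.indicator_of_notMem hy]
    exact trapezoid_nonneg _ _ _ _ _

variable {ν : Measure ℝ} {s : ℕ → ℝ}

lemma integral_trapezoid_bounds (hν : Integrable (fun x : ℝ => min 1 (x ^ 2)) ν) {δ a b c d : ℝ}
    (hδ : 0 < δ) (hab : a < b) (hcd : c < d) (h0 : ∀ y ∈ Set.Ioo a d, δ ≤ |y|) :
    (0 < b → ν.real (Set.Icc b c) ≤ ∫ y, trapezoid a b c d y ∂ν) ∧
      (c < 0 → ν.real (Set.Icc b c) ≤ ∫ y, trapezoid a b c d y ∂ν) ∧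
      ∫ y, trapezoid a b c d y ∂ν ≤ ν.real (Set.Ioo a d) := by
  have hfin : ν (Set.Ioo a d) ≠ ⊤ :=
    ((measure_mono h0).trans_lt (measure_lt_top_of_integrable_min hν hδ)).ne
  have i2 : Integrable ((Set.Ioo a d).indicator fun _ => (1 : ℝ)) ν :=
    (integrable_indicator_iff measurableSet_Ioo).2 (integrableOn_const hfin)
  have it : Integrable (trapezoid a b c d) ν :=
    i2.mono' (continuous_trapezoid _ _ _ _).aestronglyMeasurable (ae_of_all _ fun y => by
      rw [Real.norm_eq_abs, abs_of_nonneg (trapezoid_nonneg _ _ _ _ _)]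
      exact trapezoid_le_indicator hab hcd y)
  have hlow : ν (Set.Icc b c) ≠ ⊤ → ν.real (Set.Icc b c) ≤ ∫ y, trapezoid a b c d y ∂ν := by
    intro hf
    have i1 : Integrable ((Set.Icc b c).indicator fun _ => (1 : ℝ)) ν :=
      (integrable_indicator_iff measurableSet_Icc).2 (integrableOn_const hf)
    have := integral_mono i1 it (indicator_le_trapezoid hab hcd)
    rwa [integral_indicator measurableSet_Icc, setIntegral_const, smul_eq_mul, mul_one] at this
  refine ⟨fun hb => hlow ?_, fun hc => hlow ?_, ?_⟩
  · exact ((measure_mono fun y hy => hy.1.trans (le_abs_self y)).trans_lt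
      (measure_lt_top_of_integrable_min hν hb)).ne
  · refine ((measure_mono fun y hy => ?_).trans_lt
      (measure_lt_top_of_integrable_min hν (neg_pos.2 hc))).ne
    exact (neg_le_neg hy.2).trans (neg_le_abs y)
  · have := integral_mono it i2 (trapezoid_le_indicator hab hcd)
    rwa [integral_indicator measurableSet_Ioo, setIntegral_const, smul_eq_mul, mul_one] at this

lemma integral_indicator_comp_mul (F : Measure ℝ) (t : ℝ) {A : Set ℝ} (hA : MeasurableSet A) :
    ∫ y, A.indicator (fun _ => (1 : ℝ)) (t * y) ∂F = F.real {y | t * y ∈ A} := by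
  have : (fun y => A.indicator (fun _ => (1 : ℝ)) (t * y)) =
      {y | t * y ∈ A}.indicator fun _ => (1 : ℝ) := by
    ext y
    by_cases hy : t * y ∈ A
    · rw [Set.indicator_of_mem hy, Set.indicator_of_mem (by exact hy)]
    · rw [Set.indicator_of_notMem hy, Set.indicator_of_notMem (by exact hy)]
  rw [this, integral_indicator (measurableSet_preimage_mul t hA), setIntegral_const, smul_eq_mul,
    mul_one]

lemma integral_trapezoid_comp_bounds {a b c d : ℝ} (hab : a < b) (hcd : c < d) (t : ℝ) :
    F.real {y | t * y ∈ Set.Icc b c} ≤ ∫ y, trapezoid a b c d (t * y) ∂F ∧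
      ∫ y, trapezoid a b c d (t * y) ∂F ≤ F.real {y | t * y ∈ Set.Ioo a d} := by
  have it : Integrable (fun y => trapezoid a b c d (t * y)) F :=
    integrable_of_abs_le 1 ((continuous_trapezoid _ _ _ _).comp
      (by fun_prop : Continuous fun y => t * y)).aestronglyMeasurable fun y => by
      rw [abs_of_nonneg (trapezoid_nonneg _ _ _ _ _)]
      exact trapezoid_le_one _ _ _ _ _
  have hi : ∀ A : Set ℝ, MeasurableSet A →
      Integrable (fun y => A.indicator (fun _ => (1 : ℝ)) (t * y)) F := fun A hA =>
    integrable_of_abs_le 1 (((measurable_const.indicator hA).comp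
      (measurable_const_mul t)).aestronglyMeasurable) fun y => by
      by_cases hy : t * y ∈ A <;> simp [hy]
  rw [← integral_indicator_comp_mul F t measurableSet_Icc,
    ← integral_indicator_comp_mul F t measurableSet_Ioo]
  exact ⟨integral_mono (hi _ measurableSet_Icc) it fun y => indicator_le_trapezoid hab hcd _,
    integral_mono it (hi _ measurableSet_Ioo) fun y => trapezoid_le_indicator hab hcd _⟩

/-- The first index at which `c` exceeds `x` is `n + 1`; monotonicity of `c` is not available. This
transfers estimates along `c n` to all large `x`. -/
lemma exists_index_between {c : ℕ → ℝ} (N : ℕ) (hcT : Tendsto c atTop atTop) :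
    ∀ᶠ x in atTop, ∃ n, N ≤ n ∧ c n ≤ x ∧ x < c (n + 1) := by
  classical
  have h1 : ∀ᶠ x : ℝ in atTop, ∀ m ∈ Finset.range (N + 1), c m ≤ x :=
    (Finset.eventually_all _).2 fun m _ => eventually_ge_atTop (c m)
  filter_upwards [h1] with x hx
  have hex : ∃ m, x < c m := (hcT.eventually_gt_atTop x).exists
  have hm := Nat.find_spec hex
  have hN : N < Nat.find hex := by
    by_contra hcon
    exact absurd hm (not_lt.2 (hx _ (Finset.mem_range.2 (by omega))))
  refine ⟨Nat.find hex - 1, by omega, ?_, ?_⟩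
  · exact not_lt.1 (Nat.find_min hex (by omega))
  · rwa [Nat.sub_add_cancel (by omega)]

/-- Regularity of the tail of a law in the domain of attraction of a stable law, when the right
tail is not negligible. -/
theorem tail_regularity {α : ℝ} (hα : 0 < α) (hα2 : α < 2) (hF : InStableDomain α F)
    (hright : ¬ (tail F =o[atTop] absTail F)) :
    (∃ C : ℝ, ∀ᶠ x in atTop, ∫ y, min 1 ((y / x) ^ 2) ∂F ≤ C * tail F x) ∧
      (∃ κ : ℝ, 0 < κ ∧ κ < 1 ∧ ∀ᶠ x in atTop, 2 * tail F x ≤ tail F (κ * x)) ∧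
      Tendsto (fun x => x ^ 2 * tail F x) atTop atTop := by
  obtain ⟨p, q, c, hp, hq, hpq, hc, hcT, hnc, hout, ⟨C, hC⟩, hvague⟩ :=
    exists_scaling_of_inStableDomain hα hα2 hF
  set ν := stableLevyMeasure α p q with hνdef
  have hν : Integrable (fun x : ℝ => min 1 (x ^ 2)) ν :=
    integrable_min_stableLevyMeasure hα hα2 hp hq
  have htrap : ∀ {a b u d : ℝ} (δ R : ℝ), 0 < δ → a < b → u < d →
      (∀ y ∈ Set.Ioo a d, δ ≤ |y| ∧ |y| ≤ R) →
      Tendsto (fun n : ℕ => n * ∫ y, trapezoid a b u d ((c n)⁻¹ * y) ∂F) atTop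
        (𝓝 (∫ y, trapezoid a b u d y ∂ν)) := by
    intro a b u d δ R hδ hab hud h
    exact hvague _ 1 δ R (continuous_trapezoid _ _ _ _)
      (fun y => by
        rw [abs_of_nonneg (trapezoid_nonneg _ _ _ _ _)]
        exact trapezoid_le_one _ _ _ _ _) hδ
      fun y hy => h y (mem_Ioo_of_trapezoid_ne_zero hab hud hy)
  have hlower : ∀ x ε : ℝ, 0 < x → 0 < ε →
      ∀ᶠ n : ℕ in atTop, ν.real (Set.Icc (2 * x) (3 * x)) - ε ≤ n * tail F (x * c n) := by
    intro x ε hx hε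
    have hmem : ∀ y ∈ Set.Ioo x (4 * x), x ≤ |y| ∧ |y| ≤ 4 * x := fun y hy => by
      rw [abs_of_pos (hx.trans hy.1)]
      exact ⟨hy.1.le, hy.2.le⟩
    have h1 := htrap (a := x) (b := 2 * x) (u := 3 * x) (d := 4 * x) x (4 * x) hx (by linarith)
      (by linarith) hmem
    have h2 := (integral_trapezoid_bounds hν hx (a := x) (b := 2 * x) (c := 3 * x) (d := 4 * x)
      (by linarith) (by linarith) fun y hy => (hmem y hy).1).1 (by linarith)
    filter_upwards [h1.eventually (lt_mem_nhds (sub_lt_self _ hε))] with n hn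
    have h3 := (integral_trapezoid_comp_bounds (F := F) (a := x) (b := 2 * x) (c := 3 * x)
      (d := 4 * x) (by linarith) (by linarith) (c n)⁻¹).2
    have h4 : F.real {y | (c n)⁻¹ * y ∈ Set.Ioo x (4 * x)} ≤ tail F (x * c n) := by
      rw [tail_eq]
      refine measureReal_mono fun y hy => ?_
      have := hy.1
      rw [← div_eq_inv_mul, lt_div_iff₀ (hc n)] at this
      exact this
    have h5 := mul_le_mul_of_nonneg_left (h3.trans h4) (Nat.cast_nonneg (α := ℝ) n)
    linarith
  have hlower_neg : ∀ x ε : ℝ, 0 < x → 0 < ε → ∀ᶠ n : ℕ in atTop,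
      ν.real (Set.Icc (-(3 * x)) (-(2 * x))) - ε ≤ n * absTail F (x * c n) := by
    intro x ε hx hε
    have hmem : ∀ y ∈ Set.Ioo (-(4 * x)) (-x), x ≤ |y| ∧ |y| ≤ 4 * x := fun y hy => by
      rw [abs_of_neg (by linarith [hy.2])]
      constructor <;> linarith [hy.1, hy.2]
    have h1 := htrap (a := -(4 * x)) (b := -(3 * x)) (u := -(2 * x)) (d := -x) x (4 * x) hx
      (by linarith) (by linarith) hmem
    have h2 := (integral_trapezoid_bounds hν hx (a := -(4 * x)) (b := -(3 * x)) (c := -(2 * x))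
      (d := -x) (by linarith) (by linarith) fun y hy => (hmem y hy).1).2.1 (by linarith)
    filter_upwards [h1.eventually (lt_mem_nhds (sub_lt_self _ hε))] with n hn
    have h3 := (integral_trapezoid_comp_bounds (F := F) (a := -(4 * x)) (b := -(3 * x))
      (c := -(2 * x)) (d := -x) (by linarith) (by linarith) (c n)⁻¹).2
    have h4 : F.real {y | (c n)⁻¹ * y ∈ Set.Ioo (-(4 * x)) (-x)} ≤ absTail F (x * c n) := by
      rw [absTail_eq]
      refine measureReal_mono fun y hy => ?_
      have := hy.2
      rw [← div_eq_inv_mul, div_lt_iff₀ (hc n)] at this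
      exact lt_of_lt_of_le (by linarith) (neg_le_abs y)
    have h5 := mul_le_mul_of_nonneg_left (h3.trans h4) (Nat.cast_nonneg (α := ℝ) n)
    linarith
  have hupper : ∀ ε : ℝ, 0 < ε →
      ∀ᶠ n : ℕ in atTop, n * tail F (c n) ≤ ν.real (Set.Ici (1 / 2)) + ε := by
    intro ε hε
    obtain ⟨r, hr, hr'⟩ := hout (ε / 2) (by positivity)
    set R := max r 1 with hR
    have hR1 : 1 ≤ R := le_max_right _ _
    have hmem : ∀ y ∈ Set.Ioo (1 / 2) (2 * R), 1 / 2 ≤ |y| ∧ |y| ≤ 2 * R := fun y hy => by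
      rw [abs_of_pos (by linarith [hy.1])]
      exact ⟨hy.1.le, hy.2.le⟩
    have h1 := htrap (a := 1 / 2) (b := 1) (u := R) (d := 2 * R) (1 / 2) (2 * R) (by norm_num)
      (by norm_num) (by linarith) hmem
    have h2 := (integral_trapezoid_bounds hν (δ := 1 / 2) (a := 1 / 2) (b := 1) (c := R)
      (d := 2 * R) (by norm_num) (by norm_num) (by linarith) fun y hy => (hmem y hy).1).2.2
    have hfin : ν (Set.Ici (1 / 2)) ≠ ⊤ :=
      ((measure_mono fun y hy => le_trans hy (le_abs_self y)).trans_lt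
        (measure_lt_top_of_integrable_min hν (by norm_num : (0 : ℝ) < 1 / 2))).ne
    have h2' : ν.real (Set.Ioo (1 / 2) (2 * R)) ≤ ν.real (Set.Ici (1 / 2)) :=
      measureReal_mono (fun y hy => hy.1.le) hfin
    filter_upwards [h1.eventually (gt_mem_nhds (lt_add_of_pos_right _ (half_pos hε))), hr']
      with n hn hn'
    have h3 := (integral_trapezoid_comp_bounds (F := F) (a := 1 / 2) (b := 1) (c := R)
      (d := 2 * R) (by norm_num) (by linarith) (c n)⁻¹).1
    -- Vague convergence only sees the compact window `[1, R]`; the absence of escaping mass handles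
    -- the part beyond `c n * r`.
    have h4 : tail F (c n) ≤ F.real {y | (c n)⁻¹ * y ∈ Set.Icc 1 R} +
        F.real {y | c n * r < |y|} := by
      rw [tail_eq]
      refine (measureReal_mono fun y hy => ?_).trans (measureReal_union_le _ _)
      have hy' : c n < y := hy
      have hcn := hc n
      by_cases h : c n * r < |y|
      · exact Or.inr h
      · left
        rw [abs_of_pos (hcn.trans hy'), not_lt] at h
        refine ⟨?_, ?_⟩
        · rw [← div_eq_inv_mul, le_div_iff₀ hcn]
          linarith
        · rw [← div_eq_inv_mul, div_le_iff₀ hcn, mul_comm]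
          refine h.trans ?_
          gcongr
          exact le_max_left _ _
    have h5 : n * tail F (c n) ≤ n * ∫ y, trapezoid (1 / 2) 1 R (2 * R) ((c n)⁻¹ * y) ∂F +
        n * F.real {y | c n * r < |y|} := by
      rw [← mul_add]
      gcongr
      linarith
    linarith
  -- If `p = 0`, then `n * tail F (c n)` tends to `0` while `n * absTail F (c n)` stays away from
  -- `0` because `q > 0`. The right tail would be negligible.
  have hp0 : 0 < p := by
    refine lt_of_le_of_ne hp fun h0 => hright ?_
    have hq0 : 0 < q := by linarith
    have hz : ν.real (Set.Ici (1 / 2)) = 0 := by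
      have hsub : Set.Ici (1 / 2 : ℝ) ⊆ Set.Ioi 0 := fun y hy =>
        lt_of_lt_of_le (by norm_num : (0 : ℝ) < 1 / 2) hy
      have h1 : ν (Set.Ioi 0) = 0 := by
        rw [hνdef, ← h0]
        exact stableLevyMeasure_Ioi_eq_zero
      rw [measureReal_def, measure_mono_null hsub h1, ENNReal.toReal_zero]
    set L := ν.real (Set.Icc (-(3 * 1)) (-(2 * 1))) with hL
    have hL0 : 0 < L :=
      lt_of_lt_of_le (by positivity) (le_stableLevyMeasure_Icc_neg hα hα2 hp hq one_pos)
    rw [isLittleO_iff]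
    intro ε hε
    obtain ⟨N, hN⟩ := eventually_atTop.1 ((hupper (ε * L / 4) (by positivity)).and
      (hlower_neg 1 (L / 2) one_pos (by positivity)))
    filter_upwards [exists_index_between (max N 1) hcT] with x ⟨n, hn, hcx, hxc⟩
    have hnN : N ≤ n := (le_max_left _ _).trans hn
    have hn1 : (1 : ℝ) ≤ n := by exact_mod_cast (le_max_right _ _).trans hn
    have h1 := (hN n hnN).1
    have h2 := (hN (n + 1) (by omega)).2
    rw [hz, zero_add] at h1
    rw [one_mul, ← hL] at h2
    push_cast at h2
    have h3 : tail F x ≤ tail F (c n) := tail_antitone hcx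
    have h4 : absTail F (c (n + 1)) ≤ absTail F x := absTail_antitone hxc.le
    have h5 : 0 ≤ absTail F x := (tail_nonneg x).trans (tail_le_absTail x)
    rw [Real.norm_eq_abs, Real.norm_eq_abs, abs_of_nonneg (tail_nonneg x), abs_of_nonneg h5]
    have h6 : n * tail F x ≤ ε * L / 4 := by
      refine le_trans ?_ h1
      gcongr
    have h7 : L / 2 ≤ 2 * n * absTail F x := by
      have : (n + 1 : ℝ) * absTail F (c (n + 1)) ≤ 2 * n * absTail F x := by
        gcongr
        · exact (tail_nonneg _).trans (tail_le_absTail _)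
        · linarith
      linarith
    have h8 : n * tail F x ≤ n * (ε * absTail F x) := by nlinarith
    exact le_of_mul_le_mul_left h8 (by linarith)
  set L := ν.real (Set.Icc (2 * 1) (3 * 1)) with hL
  have hL0 : 0 < L :=
    lt_of_lt_of_le (by positivity) (le_stableLevyMeasure_Icc hα hα2 hp hq one_pos)
  obtain ⟨N₁, hN₁⟩ := eventually_atTop.1 (hlower 1 (L / 2) one_pos (by positivity))
  -- The bound at index `n + 1` is carried back to `n` through `n + 1 ≤ 2 * n`, so the ratio `c (n +
  -- 1) / c n` never has to be studied.
  have hTlow : ∀ n : ℕ, N₁ ≤ n → 1 ≤ n → ∀ x, x < c (n + 1) → L / 4 ≤ n * tail F x := by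
    intro n hnN hn1 x hx
    have hn1' : (1 : ℝ) ≤ n := by exact_mod_cast hn1
    have h1 := hN₁ (n + 1) (by omega)
    rw [one_mul, ← hL] at h1
    push_cast at h1
    have h2 : (n + 1 : ℝ) * tail F (c (n + 1)) ≤ 2 * n * tail F x := by
      gcongr
      · exact tail_nonneg _
      · linarith
      · exact tail_antitone hx.le
    linarith
  refine ⟨?_, ?_, ?_⟩
  · obtain ⟨N₂, hN₂⟩ := eventually_atTop.1 hC
    refine ⟨4 * |C| / L, ?_⟩
    filter_upwards [exists_index_between (max (max N₁ N₂) 1) hcT] with x ⟨n, hn, hcx, hxc⟩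
    have hnN₁ : N₁ ≤ n := (le_max_left _ _).trans ((le_max_left _ _).trans hn)
    have hnN₂ : N₂ ≤ n := (le_max_right _ _).trans ((le_max_left _ _).trans hn)
    have hn1 : 1 ≤ n := (le_max_right _ _).trans hn
    have hn1' : (1 : ℝ) ≤ n := by exact_mod_cast hn1
    have h1 := hTlow n hnN₁ hn1 x hxc
    have h2 := hN₂ n hnN₂
    have hcn := hc n
    have hi : ∀ z : ℝ, Integrable (fun y : ℝ => min 1 ((y / z) ^ 2)) F := fun z =>
      integrable_of_abs_le 1 (by fun_prop) fun y => by
        rw [abs_of_nonneg (by positivity)]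
        exact min_le_left _ _
    have h3 : ∫ y, min 1 ((y / x) ^ 2) ∂F ≤ ∫ y, min 1 ((y / c n) ^ 2) ∂F := by
      refine integral_mono (hi x) (hi (c n)) fun y => ?_
      simp only [div_pow]
      gcongr
    have h4 : n * ∫ y, min 1 ((y / x) ^ 2) ∂F ≤ n * (4 * |C| / L * tail F x) := by
      calc n * ∫ y, min 1 ((y / x) ^ 2) ∂F ≤ n * ∫ y, min 1 ((y / c n) ^ 2) ∂F := by gcongr
        _ ≤ |C| := h2.trans (le_abs_self C)
        _ = 4 * |C| / L * (L / 4) := by field_simp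
        _ ≤ 4 * |C| / L * (n * tail F x) := by gcongr
        _ = _ := by ring
    exact le_of_mul_le_mul_left h4 (by linarith)
  · set U := ν.real (Set.Ici (1 / 2)) + 1 with hU
    have hU0 : 0 < U := by positivity
    -- `κ` is defined by `(3 * κ) ^ (-α) = K`, so that `ν [2κ, 3κ] ≥ p * α * K / 3 ≥ 16 * U`. This
    -- absorbs the losses from halving the mass and from passing from `n + 1` to `2 * n`.
    set K := max (48 * U / (p * α)) 2 with hK
    have hK2 : 2 ≤ K := le_max_right _ _
    have hK0 : 0 < K := by linarith
    set κ := K ^ (-1 / α) / 3 with hκ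
    have hκ0 : 0 < κ := by positivity
    have hκ1 : κ < 1 := by
      have : K ^ (-1 / α) ≤ 1 := Real.rpow_le_one_of_one_le_of_nonpos (by linarith)
        (div_nonpos_of_nonpos_of_nonneg (by norm_num) hα.le)
      rw [hκ]
      linarith
    refine ⟨κ, hκ0, hκ1, ?_⟩
    set Lκ := ν.real (Set.Icc (2 * κ) (3 * κ)) with hLκ
    have hLκU : 16 * U ≤ Lκ := by
      refine le_trans ?_ (le_stableLevyMeasure_Icc hα hα2 hp hq hκ0)
      have e1 : (3 * κ) ^ (-α - 1) * κ = K / 3 := by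
        have h3 : 3 * κ = K ^ (-1 / α) := by rw [hκ]; ring
        have h4 : (3 * κ) ^ (-α) = K := by
          rw [h3, ← Real.rpow_mul hK0.le]
          rw [show -1 / α * -α = 1 by field_simp, Real.rpow_one]
        rw [Real.rpow_sub_one (by positivity), h4]
        field_simp
      have e2 : 48 * U ≤ p * α * K := by
        have := le_max_left (48 * U / (p * α)) 2
        rw [← hK, div_le_iff₀ (by positivity)] at this
        linarith
      rw [mul_assoc (p * α), e1]
      linarith
    obtain ⟨N₂, hN₂⟩ := eventually_atTop.1 ((hupper 1 one_pos).and
      (hlower κ (Lκ / 2) hκ0 (by linarith)))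
    filter_upwards [exists_index_between (max N₂ 1) hcT] with x ⟨n, hn, hcx, hxc⟩
    have hnN₂ : N₂ ≤ n := (le_max_left _ _).trans hn
    have hn1' : (1 : ℝ) ≤ n := by exact_mod_cast (le_max_right _ _).trans hn
    have h1 := (hN₂ n hnN₂).1
    have h2 := (hN₂ (n + 1) (by omega)).2
    push_cast at h2
    have h3 : n * tail F x ≤ U := by
      refine le_trans ?_ h1
      gcongr
      exact tail_antitone hcx
    have h4 : (n + 1 : ℝ) * tail F (κ * c (n + 1)) ≤ 2 * n * tail F (κ * x) := by
      gcongr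
      · exact tail_nonneg _
      · linarith
      · exact tail_antitone (by gcongr)
    have h5 : n * (2 * tail F x) ≤ n * tail F (κ * x) := by linarith
    exact le_of_mul_le_mul_left h5 (by linarith)
  · rw [tendsto_atTop]
    intro K
    -- `n * tail F x ≥ L / 4` and `x ^ 2 ≥ c n ^ 2`, so `n / c n ^ 2` below this threshold yields `x
    -- ^ 2 * tail F x ≥ |K| + 1`.
    have hK : 0 < L / (4 * (|K| + 1)) := by positivity
    obtain ⟨N₂, hN₂⟩ := eventually_atTop.1 (hnc.eventually (gt_mem_nhds hK))
    filter_upwards [exists_index_between (max (max N₁ N₂) 1) hcT] with x ⟨n, hn, hcx, hxc⟩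
    have hnN₁ : N₁ ≤ n := (le_max_left _ _).trans ((le_max_left _ _).trans hn)
    have hnN₂ : N₂ ≤ n := (le_max_right _ _).trans ((le_max_left _ _).trans hn)
    have hn1 : 1 ≤ n := (le_max_right _ _).trans hn
    have hn1' : (1 : ℝ) ≤ n := by exact_mod_cast hn1
    have h1 := hTlow n hnN₁ hn1 x hxc
    have h2 := hN₂ n hnN₂
    have hcn := hc n
    have hx2 : c n ^ 2 ≤ x ^ 2 := by gcongr
    rw [div_lt_div_iff₀ (by positivity) (by positivity)] at h2
    have h3 : n * (|K| + 1) ≤ n * (x ^ 2 * tail F x) := by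
      have h4 : L / 4 * c n ^ 2 ≤ n * tail F x * x ^ 2 := by
        have := tail_nonneg (F := F) x
        gcongr
      linarith
    have h5 := le_of_mul_le_mul_left h3 (by linarith)
    linarith [le_abs_self K]

end Tails

/-! ### Moments of the truncated variable. -/

section Truncation

variable {F : Measure ℝ}

lemma measurable_trunc (a b : ℝ) : Measurable (trunc a b) :=
  measurable_id.indicator measurableSet_Icc

lemma trunc_of_mem {a b x : ℝ} (hx : x ∈ Set.Icc a b) : trunc a b x = x :=
  Set.indicator_of_mem hx _

lemma trunc_of_notMem {a b x : ℝ} (hx : x ∉ Set.Icc a b) : trunc a b x = 0 :=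
  Set.indicator_of_notMem hx _

lemma abs_trunc_le_abs (a b x : ℝ) : |trunc a b x| ≤ |x| := by
  by_cases hx : x ∈ Set.Icc a b
  · rw [trunc_of_mem hx]
  · rw [trunc_of_notMem hx, abs_zero]
    exact abs_nonneg x

lemma abs_trunc_le {a b C : ℝ} (hC : 0 ≤ C) (ha : -a ≤ C) (hb : b ≤ C) (x : ℝ) :
    |trunc a b x| ≤ C := by
  by_cases hx : x ∈ Set.Icc a b
  · rw [trunc_of_mem hx, abs_le]
    exact ⟨by linarith [hx.1], hx.2.trans hb⟩
  · rwa [trunc_of_notMem hx, abs_zero]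

lemma abs_trunc_le_max (a b x : ℝ) : |trunc a b x| ≤ |a| + |b| :=
  abs_trunc_le (by positivity) (by linarith [neg_le_abs a, abs_nonneg b])
    (by linarith [le_abs_self b, abs_nonneg a]) x

lemma truncSD_nonneg (a b : ℝ) : 0 ≤ truncSD F a b := Real.sqrt_nonneg _

lemma measurable_standardize (a b : ℝ) : Measurable (standardize F a b) :=
  ((measurable_trunc a b).sub_const _).div_const _

lemma abs_standardize_le (a b x : ℝ) :
    |standardize F a b x| ≤ (|a| + |b| + |truncMean F a b|) / truncSD F a b := by
  rw [standardize, abs_div, abs_of_nonneg (truncSD_nonneg a b)]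
  gcongr
  · exact truncSD_nonneg a b
  · exact (abs_sub _ _).trans (by linarith [abs_trunc_le_max a b x])

lemma integral_standardize_sq {a b : ℝ} (h : 0 < truncSD F a b) :
    ∫ x, standardize F a b x ^ 2 ∂F = 1 := by
  unfold standardize
  simp_rw [div_pow]
  rw [integral_div, div_eq_one_iff_eq (by positivity), truncSD,
    Real.sq_sqrt (integral_nonneg fun _ => sq_nonneg _)]

variable [IsProbabilityMeasure F]

lemma integrable_trunc (a b : ℝ) : Integrable (trunc a b) F :=
  integrable_of_abs_le _ (measurable_trunc a b).aestronglyMeasurable (abs_trunc_le_max a b)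

lemma integrable_trunc_sq (a b : ℝ) : Integrable (fun x => trunc a b x ^ 2) F :=
  integrable_of_abs_le ((|a| + |b|) ^ 2) ((measurable_trunc a b).pow_const 2).aestronglyMeasurable
    fun x => by
      rw [abs_pow]
      exact pow_le_pow_left₀ (abs_nonneg _) (abs_trunc_le_max a b x) 2

/-- The second moment of the truncated variable. -/
noncomputable def truncSq (F : Measure ℝ) (a b : ℝ) : ℝ := ∫ x, trunc a b x ^ 2 ∂F

lemma truncSD_sq (F : Measure ℝ) [IsProbabilityMeasure F] (a b : ℝ) :
    truncSD F a b ^ 2 = truncSq F a b - truncMean F a b ^ 2 := by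
  rw [truncSD, Real.sq_sqrt (integral_nonneg fun _ => sq_nonneg _)]
  have e : ∀ x, (trunc a b x - truncMean F a b) ^ 2 =
      trunc a b x ^ 2 - 2 * truncMean F a b * trunc a b x + truncMean F a b ^ 2 := fun x => by ring
  have i1 := integrable_trunc_sq (F := F) a b
  have i2 := (integrable_trunc (F := F) a b).const_mul (2 * truncMean F a b)
  have i3 : Integrable (fun x => trunc a b x ^ 2 - 2 * truncMean F a b * trunc a b x) F := i1.sub i2
  simp_rw [e]
  rw [integral_add i3 (integrable_const _), integral_sub i1 i2, integral_const_mul,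
    ← truncMean, ← truncSq]
  simp only [integral_const, probReal_univ, one_smul]
  ring

lemma abs_truncMean_le {a b C : ℝ} (h : ∀ x, |trunc a b x| ≤ C) : |truncMean F a b| ≤ C := by
  have := norm_integral_le_of_norm_le_const (μ := F) (f := trunc a b) (C := C) (ae_of_all _ h)
  simpa [truncMean] using this

/-- The doubling property leaves mass at least `tail F b` just below the truncation level, where the
variable still exceeds `κ * b`. -/
lemma le_truncSq {a b κ : ℝ} (hκ : 0 < κ) (ha : a ≤ 0) (hb : 0 < b)
    (h : 2 * tail F b ≤ tail F (κ * b)) :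
    tail F b ≤ F.real (Set.Ioc (κ * b) b) ∧ κ ^ 2 * (b ^ 2 * tail F b) ≤ truncSq F a b := by
  have hmass : tail F b ≤ F.real (Set.Ioc (κ * b) b) := by
    have h1 : tail F (κ * b) ≤ F.real (Set.Ioc (κ * b) b) + tail F b := by
      rw [tail_eq, tail_eq]
      refine (measureReal_mono fun x hx => ?_).trans (measureReal_union_le _ _)
      rcases le_or_gt x b with h | h
      · exact Or.inl ⟨hx, h⟩
      · exact Or.inr h
    linarith
  refine ⟨hmass, ?_⟩
  calc κ ^ 2 * (b ^ 2 * tail F b) = (κ * b) ^ 2 * tail F b := by ring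
    _ ≤ (κ * b) ^ 2 * F.real (Set.Ioc (κ * b) b) := by gcongr
    _ ≤ ∫ x in Set.Ioc (κ * b) b, trunc a b x ^ 2 ∂F := by
        refine setIntegral_ge_of_const_le_real measurableSet_Ioc (measure_ne_top _ _)
          (fun x hx => ?_) (integrable_trunc_sq a b).integrableOn
        have hκb : 0 < κ * b := by positivity
        rw [trunc_of_mem ⟨by linarith [hx.1], hx.2⟩]
        exact pow_le_pow_left₀ hκb.le hx.1.le 2
    _ ≤ truncSq F a b :=
        setIntegral_le_integral (integrable_trunc_sq a b) (ae_of_all _ fun _ => sq_nonneg _)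

lemma truncSq_le {a b C : ℝ} (hC : 1 ≤ C) (hb : 0 < b) (ha : -a ≤ C * b) :
    truncSq F a b ≤ C ^ 2 * (b ^ 2 * ∫ y, min 1 ((y / b) ^ 2) ∂F) := by
  rw [← mul_assoc, ← integral_const_mul]
  refine integral_mono (integrable_trunc_sq a b) ((integrable_of_abs_le 1 (by fun_prop)
    fun y => by
      rw [abs_of_nonneg (by positivity)]
      exact min_le_left _ _).const_mul _) fun x => ?_
  have hCb : b ≤ C * b := by nlinarith
  have h1 : trunc a b x ^ 2 ≤ C ^ 2 * b ^ 2 := by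
    rw [← sq_abs, ← mul_pow]
    exact pow_le_pow_left₀ (abs_nonneg _) (abs_trunc_le (by positivity) ha hCb x) 2
  have h2 : trunc a b x ^ 2 ≤ C ^ 2 * x ^ 2 := by
    have h3 := abs_trunc_le_abs a b x
    have h4 : trunc a b x ^ 2 ≤ x ^ 2 := sq_le_sq.2 h3
    have h5 : 1 ≤ C ^ 2 := one_le_pow₀ hC
    nlinarith [sq_nonneg x]
  simp only
  rcases min_choice 1 ((x / b) ^ 2) with h | h
  · rw [h, mul_one]
    exact h1
  · rw [h]
    calc trunc a b x ^ 2 ≤ C ^ 2 * x ^ 2 := h2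
      _ = _ := by field_simp

/-- Cauchy–Schwarz beyond `M`. Once `truncSq` tends to infinity, choosing `M` large shows that the
squared mean is negligible against it, so centering does not affect the order of the variance. -/
lemma truncMean_sq_le {a b M : ℝ} (hM : 0 ≤ M) :
    truncMean F a b ^ 2 ≤ 2 * M ^ 2 + 2 * F.real {x | M < |x|} * truncSq F a b := by
  set B : Set ℝ := {x | M < |x|} with hB
  have hBm : MeasurableSet B := measurableSet_lt (by fun_prop) (by fun_prop)
  have h1 := integral_add_compl hBm (integrable_trunc (F := F) a b)
  have h2 : |∫ x in Bᶜ, trunc a b x ∂F| ≤ M := by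
    have h3 := norm_setIntegral_le_of_norm_le_const (μ := F) (s := Bᶜ) (f := trunc a b) (C := M)
      (measure_lt_top _ _) fun x hx => (abs_trunc_le_abs a b x).trans (by simpa [hB] using hx)
    have h4 : F.real Bᶜ ≤ 1 := measureReal_le_one
    rw [Real.norm_eq_abs] at h3
    nlinarith
  have h5 := sq_setIntegral_le (integrable_trunc (F := F) a b) (integrable_trunc_sq a b) B
  have h6 : ∫ x in B, trunc a b x ^ 2 ∂F ≤ truncSq F a b :=
    setIntegral_le_integral (integrable_trunc_sq a b) (ae_of_all _ fun _ => sq_nonneg _)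
  have h7 : F.real B * ∫ x in B, trunc a b x ^ 2 ∂F ≤ F.real B * truncSq F a b := by gcongr
  rw [truncMean, ← h1]
  set u := ∫ x in B, trunc a b x ∂F
  set v := ∫ x in Bᶜ, trunc a b x ∂F
  have h8 : v ^ 2 ≤ M ^ 2 := sq_le_sq.2 (h2.trans (le_abs_self M))
  nlinarith [sq_nonneg (u - v)]

lemma integrable_standardize (a b : ℝ) : Integrable (standardize F a b) F :=
  integrable_of_abs_le _ (measurable_standardize a b).aestronglyMeasurable (abs_standardize_le a b)

lemma integrable_standardize_sq (a b : ℝ) : Integrable (fun x => standardize F a b x ^ 2) F :=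
  integrable_of_abs_le (((|a| + |b| + |truncMean F a b|) / truncSD F a b) ^ 2)
    ((measurable_standardize a b).pow_const 2).aestronglyMeasurable fun x => by
      rw [abs_pow]
      exact pow_le_pow_left₀ (abs_nonneg _) (abs_standardize_le a b x) 2

lemma integral_standardize (a b : ℝ) : ∫ x, standardize F a b x ∂F = 0 := by
  unfold standardize
  rw [integral_div, integral_sub (integrable_trunc a b) (integrable_const _), ← truncMean]
  simp

/-- Asymptotic properties of the truncated standardized variables. -/
theorem standardize_estimates {C₀ κ : ℝ} (hκ0 : 0 < κ)
    (hsq : ∀ᶠ x in atTop, ∫ y, min 1 ((y / x) ^ 2) ∂F ≤ C₀ * tail F x)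
    (hdouble : ∀ᶠ x in atTop, 2 * tail F x ≤ tail F (κ * x))
    (hinf : Tendsto (fun x => x ^ 2 * tail F x) atTop atTop)
    {a b : ℕ → ℝ} (ha : Tendsto a atTop atBot) (hb : Tendsto b atTop atTop)
    {C : ℝ} (hab : ∀ᶠ n in atTop, -a n ≤ C * b n) :
    (∀ᶠ n in atTop, 0 < truncSD F (a n) (b n) ∧ 0 < tail F (b n)) ∧
      (∃ K : ℝ, 0 < K ∧ ∀ᶠ n in atTop, ∀ x,
        standardize F (a n) (b n) x ^ 2 * tail F (b n) ≤ K) ∧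
      (∃ M k : ℝ, 0 < k ∧ 1 / 2 ≤ F.real {x | |x| ≤ M} ∧
        ∀ᶠ n in atTop, tail F (b n) ≤ F.real (Set.Ioc (κ * b n) (b n)) ∧
          ∀ x ∈ Set.Ioc (κ * b n) (b n), ∀ y, |y| ≤ M →
            k ≤ (standardize F (a n) (b n) x - standardize F (a n) (b n) y) ^ 2 * tail F (b n)) ∧
      ∀ t : ℝ, Tendsto (fun n => ∫ x, min 2 (t ^ 2 * standardize F (a n) (b n) x ^ 2) ∂F) atTop
        (𝓝 0) := by
  wlog hC : 1 ≤ C generalizing C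
  · refine this (C := 1) ?_ le_rfl
    filter_upwards [hab, hb.eventually_gt_atTop 0] with n h1 h2
    nlinarith
  set S : ℕ → ℝ := fun n => truncSq F (a n) (b n) with hS
  set σ : ℕ → ℝ := fun n => truncSD F (a n) (b n) with hσ
  set T : ℕ → ℝ := fun n => tail F (b n) with hT
  have hσ0 : ∀ n, 0 ≤ σ n := fun n => truncSD_nonneg _ _
  have hTinf : Tendsto (fun n => b n ^ 2 * T n) atTop atTop := hinf.comp hb
  have hbase : ∀ᶠ n in atTop, a n ≤ 0 ∧ 0 < b n := (ha.eventually_le_atBot 0).and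
    (hb.eventually_gt_atTop 0)
  have hlow : ∀ᶠ n in atTop, T n ≤ F.real (Set.Ioc (κ * b n) (b n)) ∧
      κ ^ 2 * (b n ^ 2 * T n) ≤ S n := by
    filter_upwards [hbase, hb.eventually hdouble] with n h1 h2
    exact le_truncSq hκ0 h1.1 h1.2 h2
  have hSinf : Tendsto S atTop atTop :=
    tendsto_atTop_mono' _ (hlow.mono fun n h => h.2) (hTinf.const_mul_atTop (by positivity))
  set C₁ := |C₀| + 1 with hC₁
  have hup : ∀ᶠ n in atTop, S n ≤ C ^ 2 * C₁ * (b n ^ 2 * T n) := by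
    filter_upwards [hbase, hab, hb.eventually hsq] with n h1 h2 h3
    refine (truncSq_le hC h1.2 h2).trans ?_
    have hTn : 0 ≤ T n := tail_nonneg _
    calc C ^ 2 * (b n ^ 2 * ∫ y, min 1 ((y / b n) ^ 2) ∂F) ≤ C ^ 2 * (b n ^ 2 * (C₁ * T n)) := by
          gcongr
          refine h3.trans ?_
          gcongr
          linarith [le_abs_self C₀]
      _ = _ := by ring
  have hmean : ∀ ε : ℝ, 0 < ε → ∀ᶠ n in atTop, truncMean F (a n) (b n) ^ 2 ≤ ε * S n := by
    intro ε hε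
    obtain ⟨M, hM0, hM⟩ := exists_measureReal_abs_gt_lt F (ε := ε / 4) (by positivity)
    filter_upwards [hSinf.eventually_ge_atTop (4 * M ^ 2 / ε), hSinf.eventually_ge_atTop 0]
      with n h1 h2
    rw [div_le_iff₀ hε] at h1
    have h3 := truncMean_sq_le (F := F) (a := a n) (b := b n) hM0
    have h4 : F.real {x | M < |x|} * S n ≤ ε / 4 * S n := by gcongr
    simp only [hS] at h1 h4 ⊢
    nlinarith
  have hσ2 : ∀ n, σ n ^ 2 = S n - truncMean F (a n) (b n) ^ 2 := fun n => truncSD_sq F _ _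
  have hσlow : ∀ᶠ n in atTop, S n / 2 ≤ σ n ^ 2 := by
    filter_upwards [hmean (1 / 2) (by norm_num)] with n h1
    rw [hσ2]
    linarith
  have hσinf : Tendsto σ atTop atTop := by
    have h1 : Tendsto (fun n => σ n ^ 2) atTop atTop :=
      tendsto_atTop_mono' _ hσlow (hSinf.atTop_div_const two_pos)
    refine (Real.tendsto_sqrt_atTop.comp h1).congr fun n => ?_
    simp only [Function.comp_apply]
    rw [Real.sqrt_sq (hσ0 n)]
  have hTpos : ∀ᶠ n in atTop, 0 < T n := by
    filter_upwards [hTinf.eventually_gt_atTop 0, hbase] with n h1 h2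
    exact pos_of_mul_pos_right h1 (sq_nonneg _)
  refine ⟨(hσinf.eventually_gt_atTop 0).and hTpos, ?_, ?_, ?_⟩
  -- The numerator of `Z` is at most `2 * C * b n` in modulus, and its variance is at least `κ ^ 2 *
  -- b n ^ 2 * T n / 2`.
  · refine ⟨8 * C ^ 2 / κ ^ 2, by positivity, ?_⟩
    filter_upwards [hbase, hab, hlow, hσlow, hσinf.eventually_gt_atTop 0, hTpos]
      with n h1 h2 h3 h4 h5 h6 x
    have hCb : b n ≤ C * b n := by nlinarith [h1.2]
    have hb0 := h1.2
    have htr : ∀ x, |trunc (a n) (b n) x| ≤ C * b n := abs_trunc_le (by positivity) h2 hCb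
    have hmn : |truncMean F (a n) (b n)| ≤ C * b n := abs_truncMean_le htr
    have hnum : (trunc (a n) (b n) x - truncMean F (a n) (b n)) ^ 2 ≤ (2 * (C * b n)) ^ 2 := by
      rw [← sq_abs]
      refine pow_le_pow_left₀ (abs_nonneg _) ((abs_sub _ _).trans ?_) 2
      linarith [htr x]
    have h7 : κ ^ 2 * (b n ^ 2 * T n) / 2 ≤ σ n ^ 2 := by linarith [h3.2]
    change ((trunc (a n) (b n) x - truncMean F (a n) (b n)) / σ n) ^ 2 * T n ≤ _
    rw [div_pow, div_mul_eq_mul_div, div_le_div_iff₀ (by positivity) (by positivity)]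
    calc (trunc (a n) (b n) x - truncMean F (a n) (b n)) ^ 2 * T n * κ ^ 2
        ≤ (2 * (C * b n)) ^ 2 * T n * κ ^ 2 := by gcongr
      _ = 8 * C ^ 2 * (κ ^ 2 * (b n ^ 2 * T n) / 2) := by ring
      _ ≤ 8 * C ^ 2 * σ n ^ 2 := by gcongr
  · obtain ⟨M, hM0, hM⟩ := exists_half_le_measureReal F
    refine ⟨M, κ ^ 2 / (4 * (C ^ 2 * C₁)), by positivity, hM, ?_⟩
    filter_upwards [hbase, hlow, hup, hσinf.eventually_gt_atTop 0, hTpos,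
      ha.eventually_le_atBot (-M), hb.eventually_ge_atTop M, hb.eventually_ge_atTop (2 * M / κ)]
      with n h1 h3 h4 h5 h6 h7 h8 h9
    refine ⟨h3.1, fun x hx y hy => ?_⟩
    rw [div_le_iff₀ hκ0] at h9
    have hb0 := h1.2
    have hκb : 0 < κ * b n := by positivity
    have hyx : y ∈ Set.Icc (a n) (b n) := by
      rw [abs_le] at hy
      exact ⟨by linarith [hy.1], by linarith [hy.2]⟩
    have hxx : x ∈ Set.Icc (a n) (b n) := ⟨by linarith [hx.1, h1.1], hx.2⟩
    have e : standardize F (a n) (b n) x - standardize F (a n) (b n) y = (x - y) / σ n := by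
      rw [standardize, standardize, trunc_of_mem hyx, trunc_of_mem hxx, ← sub_div]
      congr 1
      ring
    -- `h9` gives `|y| ≤ M ≤ κ * b n / 2`. The centering cancels in the difference of the two
    -- standardized values.
    have hxy : κ * b n / 2 ≤ x - y := by linarith [hx.1, le_abs_self y]
    have hxy2 : (κ * b n / 2) ^ 2 ≤ (x - y) ^ 2 := pow_le_pow_left₀ (by positivity) hxy 2
    have hσS : σ n ^ 2 ≤ C ^ 2 * C₁ * (b n ^ 2 * T n) := by
      rw [hσ2]
      linarith [sq_nonneg (truncMean F (a n) (b n))]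
    rw [e, div_pow, div_mul_eq_mul_div, div_le_div_iff₀ (by positivity) (by positivity)]
    calc κ ^ 2 * σ n ^ 2 ≤ κ ^ 2 * (C ^ 2 * C₁ * (b n ^ 2 * T n)) := by gcongr
      _ = (κ * b n / 2) ^ 2 * T n * (4 * (C ^ 2 * C₁)) := by ring
      _ ≤ (x - y) ^ 2 * T n * (4 * (C ^ 2 * C₁)) := by gcongr
  · intro t
    have hmσ : Tendsto (fun n => truncMean F (a n) (b n) / σ n) atTop (𝓝 0) := by
      have h1 : Tendsto (fun n => (truncMean F (a n) (b n) / σ n) ^ 2) atTop (𝓝 0) := by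
        rw [tendsto_order]
        refine ⟨fun u hu => Eventually.of_forall fun n => hu.trans_le (sq_nonneg _),
          fun ε hε => ?_⟩
        filter_upwards [hmean (ε / 4) (by positivity), hσlow, hσinf.eventually_gt_atTop 0]
          with n h2 h3 h4
        rw [div_pow, div_lt_iff₀ (by positivity)]
        have : 0 < σ n ^ 2 := by positivity
        nlinarith
      have h2 := h1.sqrt
      rw [Real.sqrt_zero] at h2
      simp_rw [Real.sqrt_sq_eq_abs] at h2
      exact (tendsto_zero_iff_abs_tendsto_zero _).2 h2
    -- The truncated value at a fixed `x` stays bounded by `|x|` while the standard deviation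
    -- diverges.
    have hptw : ∀ x, Tendsto (fun n => standardize F (a n) (b n) x) atTop (𝓝 0) := by
      intro x
      have h1 : Tendsto (fun n => trunc (a n) (b n) x / σ n) atTop (𝓝 0) := by
        refine squeeze_zero_norm' ?_ (hσinf.const_div_atTop |x|)
        filter_upwards [hσinf.eventually_gt_atTop 0] with n hn
        rw [Real.norm_eq_abs, abs_div, abs_of_pos hn]
        exact div_le_div_of_nonneg_right (abs_trunc_le_abs _ _ _) hn.le
      have h2 := h1.sub hmσ
      rw [sub_zero] at h2
      refine h2.congr fun n => ?_
      rw [standardize, sub_div]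
    have h0 : ∫ _, (0 : ℝ) ∂F = 0 := integral_zero _ _
    rw [← h0]
    refine tendsto_integral_of_dominated_convergence (fun _ => 2)
      (fun n => (measurable_const.min
        (((measurable_standardize _ _).pow_const 2).const_mul _)).aestronglyMeasurable)
      (integrable_const _) (fun n => ae_of_all _ fun x => ?_) (ae_of_all _ fun x => ?_)
    · rw [Real.norm_eq_abs, abs_of_nonneg (by positivity)]
      exact min_le_left _ _
    · have h1 := (tendsto_const_nhds (x := (2 : ℝ))).min (((hptw x).pow 2).const_mul (t ^ 2))
      simpa using h1

/-- The condition on `b n / (-a n)` enters only here: the left truncation level is at most a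
multiple of the right one, so `b n` controls the size of the truncated variable. -/
lemma eventually_neg_le_mul {a b : ℕ → ℝ} (ha : Tendsto a atTop atBot)
    (hab : (∃ l : ℝ, 0 < l ∧ Tendsto (fun n => b n / (-a n)) atTop (𝓝 l)) ∨
      Tendsto (fun n => b n / (-a n)) atTop atTop) :
    ∃ C : ℝ, ∀ᶠ n in atTop, -a n ≤ C * b n := by
  obtain ⟨m, hm, h⟩ : ∃ m : ℝ, 0 < m ∧ ∀ᶠ n in atTop, m < b n / (-a n) := by
    rcases hab with ⟨l, hl, h⟩ | h
    · exact ⟨l / 2, by positivity, h.eventually (lt_mem_nhds (by linarith))⟩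
    · exact ⟨1, one_pos, h.eventually_gt_atTop 1⟩
  refine ⟨1 / m, ?_⟩
  filter_upwards [h, ha.eventually_lt_atBot 0] with n h1 h2
  rw [lt_div_iff₀ (by linarith)] at h1
  rw [one_div, le_inv_mul_iff₀ hm]
  exact h1.le

end Truncation

/-! ### Expansion of the characteristic function of a standardized variable. -/

section CharFunExpansion

variable {F : Measure ℝ} {Z : ℝ → ℝ}

lemma norm_cexp_taylor_le (y : ℝ) :
    ‖Complex.exp (y * Complex.I) - 1 - y * Complex.I + y ^ 2 / 2‖ ≤ 4 * y ^ 2 ∧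
      (|y| ≤ 1 → ‖Complex.exp (y * Complex.I) - 1 - y * Complex.I + y ^ 2 / 2‖ ≤ |y| * y ^ 2) := by
  have hn : ‖(y : ℂ) * Complex.I‖ = |y| := by
    rw [norm_mul, Complex.norm_I, mul_one, Complex.norm_real, Real.norm_eq_abs]
  have hsmall : |y| ≤ 1 →
      ‖Complex.exp (y * Complex.I) - 1 - y * Complex.I + y ^ 2 / 2‖ ≤ |y| * y ^ 2 := by
    intro hy
    have h1 := Complex.exp_bound (x := y * Complex.I) (by rwa [hn]) (n := 3) (by norm_num)
    have e : Complex.exp (y * Complex.I) - ∑ m ∈ Finset.range 3, (y * Complex.I) ^ m / m.factorial =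
        Complex.exp (y * Complex.I) - 1 - y * Complex.I + y ^ 2 / 2 := by
      simp only [Finset.sum_range_succ, Finset.range_zero, Finset.sum_empty, Nat.factorial]
      push_cast
      rw [mul_pow _ _ 2, Complex.I_sq]
      ring
    rw [e, hn] at h1
    refine h1.trans ?_
    have h3 : |y| ^ 3 = |y| * y ^ 2 := by
      rw [← sq_abs y]
      ring
    rw [h3]
    norm_num [Nat.factorial]
    nlinarith [mul_nonneg (abs_nonneg y) (sq_nonneg y)]
  refine ⟨?_, hsmall⟩
  rcases le_total |y| 1 with hy | hy
  · refine (hsmall hy).trans ?_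
    nlinarith [sq_nonneg y]
  · have h1 : ‖Complex.exp (y * Complex.I) - 1 - y * Complex.I + y ^ 2 / 2‖ ≤
        1 + 1 + |y| + y ^ 2 / 2 := by
      refine (norm_add_le _ _).trans (add_le_add ((norm_sub_le _ _).trans (add_le_add
        ((norm_sub_le _ _).trans (add_le_add ?_ ?_)) hn.le)) ?_)
      · rw [Complex.norm_exp_ofReal_mul_I]
      · rw [norm_one]
      · rw [norm_div, norm_pow, Complex.norm_real, Real.norm_eq_abs, sq_abs, Complex.norm_ofNat]
    rw [← sq_abs y] at h1 ⊢
    nlinarith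

lemma charFun_map_eq (hZm : Measurable Z) (u : ℝ) :
    charFun (F.map Z) u = ∫ x, Complex.exp ((u * Z x : ℝ) * Complex.I) ∂F := by
  rw [charFun_apply_real, integral_map hZm.aemeasurable (by fun_prop)]
  congr with x
  push_cast
  rfl

variable [IsProbabilityMeasure F]

/-- The crude bound serves for the large weights, whose total square is small; the bound with `ε`
serves for the weights that make the summand uniformly small. -/
lemma norm_charFun_map_sub_le (hZm : Measurable Z) (hZ : Integrable Z F)
    (hZ2 : Integrable (fun x => Z x ^ 2) F) (h0 : ∫ x, Z x ∂F = 0) (h1 : ∫ x, Z x ^ 2 ∂F = 1)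
    (u : ℝ) :
    ‖charFun (F.map Z) u - (1 - u ^ 2 / 2)‖ ≤ 4 * u ^ 2 ∧
      ∀ ε ≤ 1, (∀ x, |u * Z x| ≤ ε) → ‖charFun (F.map Z) u - (1 - u ^ 2 / 2)‖ ≤ ε * u ^ 2 := by
  have ie : Integrable (fun x => Complex.exp ((u * Z x : ℝ) * Complex.I)) F :=
    Integrable.of_bound (by fun_prop) 1 (ae_of_all _ fun x => by
      rw [Complex.norm_exp_ofReal_mul_I])
  have i1 : Integrable (fun x => ((u * Z x : ℝ) : ℂ) * Complex.I) F :=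
    ((hZ.const_mul u).ofReal).mul_const _
  have i2 : Integrable (fun x => ((u * Z x : ℝ) : ℂ) ^ 2 / 2) F := by
    have : Integrable (fun x => ((u ^ 2 / 2 * Z x ^ 2 : ℝ) : ℂ)) F := (hZ2.const_mul _).ofReal
    refine this.congr (ae_of_all _ fun x => ?_)
    push_cast
    ring
  have j1 : Integrable (fun x => Complex.exp ((u * Z x : ℝ) * Complex.I) - 1) F :=
    ie.sub (integrable_const _)
  have j2 : Integrable (fun x => Complex.exp ((u * Z x : ℝ) * Complex.I) - 1 -
      ((u * Z x : ℝ) : ℂ) * Complex.I) F := j1.sub i1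
  have e1 : ∫ x, ((u * Z x : ℝ) : ℂ) * Complex.I ∂F = 0 := by
    rw [integral_mul_const, integral_complex_ofReal, integral_const_mul, h0]
    simp
  have e2 : ∫ x, (((u * Z x : ℝ) : ℂ) ^ 2 / 2) ∂F = (u : ℂ) ^ 2 / 2 := by
    have : ∀ x, ((u * Z x : ℝ) : ℂ) ^ 2 / 2 = ((u ^ 2 / 2 * Z x ^ 2 : ℝ) : ℂ) := fun x => by
      push_cast
      ring
    simp_rw [this]
    rw [integral_complex_ofReal, integral_const_mul, h1]
    push_cast
    ring
  have e : charFun (F.map Z) u - (1 - u ^ 2 / 2) = ∫ x, (Complex.exp ((u * Z x : ℝ) * Complex.I) -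
      1 - ((u * Z x : ℝ) : ℂ) * Complex.I + ((u * Z x : ℝ) : ℂ) ^ 2 / 2) ∂F := by
    rw [integral_add j2 i2, integral_sub j1 i1, integral_sub ie (integrable_const _), e1, e2,
      ← charFun_map_eq hZm]
    simp
    ring
  have key : ∀ c : ℝ, (∀ x, ‖Complex.exp ((u * Z x : ℝ) * Complex.I) - 1 -
      ((u * Z x : ℝ) : ℂ) * Complex.I + ((u * Z x : ℝ) : ℂ) ^ 2 / 2‖ ≤ c * (u * Z x) ^ 2) →
      ‖charFun (F.map Z) u - (1 - u ^ 2 / 2)‖ ≤ c * u ^ 2 := by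
    intro c hc
    have h2 : ∀ x, c * (u * Z x) ^ 2 = c * u ^ 2 * Z x ^ 2 := fun x => by ring
    simp_rw [h2] at hc
    rw [e]
    refine (norm_integral_le_of_norm_le (hZ2.const_mul _) (ae_of_all _ hc)).trans ?_
    rw [integral_const_mul, h1, mul_one]
  refine ⟨key 4 fun x => (norm_cexp_taylor_le _).1, fun ε hε hx => key ε fun x => ?_⟩
  refine ((norm_cexp_taylor_le _).2 ((hx x).trans hε)).trans ?_
  gcongr
  exact hx x

lemma abs_exp_neg_sub_le {v : ℝ} (hv : 0 ≤ v) :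
    |Real.exp (-v) - (1 - v)| ≤ v ∧ (v ≤ 1 → |Real.exp (-v) - (1 - v)| ≤ v ^ 2) := by
  constructor
  · rw [abs_le]
    have h1 := Real.add_one_le_exp (-v)
    have h2 := Real.exp_le_one_iff.2 (neg_nonpos.2 hv)
    constructor <;> linarith
  · intro hv1
    have := Real.norm_exp_sub_one_sub_id_le (x := -v) (by
      rw [Real.norm_eq_abs, abs_neg, abs_of_nonneg hv]
      exact hv1)
    rw [Real.norm_eq_abs, Real.norm_eq_abs, abs_neg, sq_abs] at this
    convert this using 2
    ring

/-- The right side does not depend on `u`, so `Z n → 0` in probability makes all factors of the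
product close to `1` together, with no smallness of the weights. -/
lemma one_sub_norm_charFun_map_sq_le (hZm : Measurable Z) {u t : ℝ} (hut : |u| ≤ |t|) :
    1 - ‖charFun (F.map Z) u‖ ^ 2 ≤ 2 * ∫ x, min 2 (t ^ 2 * Z x ^ 2) ∂F := by
  have : IsProbabilityMeasure (F.map Z) := Measure.isProbabilityMeasure_map hZm.aemeasurable
  refine (one_sub_norm_charFun_sq_le u).trans ?_
  rw [one_sub_re_charFun, integral_map hZm.aemeasurable (by fun_prop)]
  refine mul_le_mul_of_nonneg_left ?_ zero_le_two
  have m1 : Measurable fun x => 1 - Real.cos (u * Z x) := by fun_prop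
  have m2 : Measurable fun x => min 2 (t ^ 2 * Z x ^ 2) :=
    measurable_const.min ((hZm.pow_const 2).const_mul _)
  refine integral_mono (integrable_of_abs_le 2 m1.aestronglyMeasurable fun x => ?_)
    (integrable_of_abs_le 2 m2.aestronglyMeasurable fun x => ?_) fun x => le_min ?_ ?_
  · rw [abs_one_sub_cos]
    linarith [Real.neg_one_le_cos (u * Z x)]
  · rw [abs_of_nonneg (by positivity)]
    exact min_le_left _ _
  · linarith [Real.neg_one_le_cos (u * Z x)]
  · have h1 := Real.one_sub_sq_div_two_le_cos (x := u * Z x)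
    have h2 : u ^ 2 ≤ t ^ 2 := sq_le_sq.2 hut
    nlinarith [mul_le_mul_of_nonneg_right h2 (sq_nonneg (Z x)), mul_nonneg (sq_nonneg t)
      (sq_nonneg (Z x))]

/-- A lower bound for the gap between `u ^ 2` and `1 - ‖φ u‖ ^ 2`, where `φ` is the characteristic
function of a centered variable with unit variance. -/
lemma mul_le_sq_sub_one_sub_norm_charFun_map_sq (hZm : Measurable Z) (hZ : Integrable Z F)
    (hZ2 : Integrable (fun x => Z x ^ 2) F) (h0 : ∫ x, Z x ∂F = 0) (h1 : ∫ x, Z x ^ 2 ∂F = 1)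
    (u : ℝ) {m : ℝ} {I B : Set ℝ} (hI : MeasurableSet I) (hB : MeasurableSet B)
    (h : ∀ x ∈ I, ∀ y ∈ B,
      m ≤ (u * (Z x - Z y)) ^ 2 / 2 - (1 - Real.cos (u * (Z x - Z y)))) :
    m * F.real I * F.real B ≤ u ^ 2 - (1 - ‖charFun (F.map Z) u‖ ^ 2) := by
  have : IsProbabilityMeasure (F.map Z) := Measure.isProbabilityMeasure_map hZm.aemeasurable
  -- The double integral of `g` is exactly the gap, by unit variance and symmetrization. As `g ≥ 0`,
  -- it may be restricted to `I` and `B`.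
  set g : ℝ → ℝ → ℝ := fun y x => (u * (Z x - Z y)) ^ 2 / 2 - (1 - Real.cos (u * (Z x - Z y)))
    with hg
  have hg0 : ∀ y x, 0 ≤ g y x := fun y x => by
    have := Real.one_sub_sq_div_two_le_cos (x := u * (Z x - Z y))
    simp only [hg]
    linarith
  have ic : ∀ y, Integrable (fun x => 1 - Real.cos (u * (Z x - Z y))) F := fun y =>
    integrable_of_abs_le 2 (by fun_prop) fun x => by
      rw [abs_one_sub_cos]
      linarith [Real.neg_one_le_cos (u * (Z x - Z y))]
  have iq : ∀ y, Integrable (fun x => (u * (Z x - Z y)) ^ 2 / 2) F := fun y => by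
    have h2 : Integrable (fun x => u ^ 2 / 2 * Z x ^ 2 - u ^ 2 * Z y * Z x +
        u ^ 2 / 2 * Z y ^ 2) F :=
      ((hZ2.const_mul _).sub (hZ.const_mul _)).add (integrable_const _)
    refine h2.congr (ae_of_all _ fun x => ?_)
    simp only
    ring
  have ig : ∀ y, Integrable (g y) F := fun y => (iq y).sub (ic y)
  have eq : ∀ y, ∫ x, (u * (Z x - Z y)) ^ 2 / 2 ∂F = u ^ 2 / 2 + u ^ 2 / 2 * Z y ^ 2 := by
    intro y
    have e : ∀ x, (u * (Z x - Z y)) ^ 2 / 2 =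
        u ^ 2 / 2 * Z x ^ 2 - u ^ 2 * Z y * Z x + u ^ 2 / 2 * Z y ^ 2 := fun x => by ring
    have k1 : Integrable (fun x => u ^ 2 / 2 * Z x ^ 2 - u ^ 2 * Z y * Z x) F :=
      (hZ2.const_mul _).sub (hZ.const_mul _)
    simp_rw [e]
    rw [integral_add k1 (integrable_const _), integral_sub (hZ2.const_mul _) (hZ.const_mul _),
      integral_const_mul, integral_const_mul, h0, h1]
    simp
  set k : ℝ → ℝ := fun y => ∫ x, (1 - Real.cos (u * (Z x - Z y))) ∂F with hk
  have hkc : k = (fun z => ∫ w, (1 - Real.cos (u * (w - z))) ∂(F.map Z)) ∘ Z := by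
    ext y
    simp only [hk, Function.comp_apply]
    rw [integral_map hZm.aemeasurable (by fun_prop)]
  have hint := integrable_integral_one_sub_cos (μ := F.map Z) u
  have ik : Integrable k F := by
    rw [hkc]
    exact hint.comp_measurable hZm
  have ek : ∫ y, k y ∂F = 1 - ‖charFun (F.map Z) u‖ ^ 2 := by
    rw [← integral_integral_one_sub_cos, integral_map hZm.aemeasurable hint.1, hkc]
    rfl
  have eg : ∀ y, ∫ x, g y x ∂F = u ^ 2 / 2 + u ^ 2 / 2 * Z y ^ 2 - k y := fun y => by
    rw [← eq, hk, ← integral_sub (iq y) (ic y)]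
  have iz : Integrable (fun y => u ^ 2 / 2 + u ^ 2 / 2 * Z y ^ 2) F :=
    (integrable_const _).add (hZ2.const_mul _)
  have iG : Integrable (fun y => ∫ x, g y x ∂F) F := by
    simp_rw [eg]
    exact iz.sub ik
  have eG : ∫ y, ∫ x, g y x ∂F ∂F = u ^ 2 - (1 - ‖charFun (F.map Z) u‖ ^ 2) := by
    simp_rw [eg]
    rw [integral_sub iz ik, ek, integral_add (integrable_const _) (hZ2.const_mul _),
      integral_const_mul, h1]
    simp
  have hin : ∀ y ∈ B, m * F.real I ≤ ∫ x, g y x ∂F := fun y hy =>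
    (setIntegral_ge_of_const_le_real hI (measure_ne_top _ _) (fun x hx => h x hx y hy)
      (ig y).integrableOn).trans (setIntegral_le_integral (ig y) (ae_of_all _ (hg0 y)))
  rw [← eG]
  exact (setIntegral_ge_of_const_le_real hB (measure_ne_top _ _) hin iG.integrableOn).trans
    (setIntegral_le_integral iG (ae_of_all _ fun y => integral_nonneg (hg0 y)))

end CharFunExpansion

/-! ### The two implications, for characteristic functions of weighted sums. -/

section TriangularArray

variable {F : Measure ℝ} [IsProbabilityMeasure F] {Z : ℕ → ℝ → ℝ} {T : ℕ → ℝ} {A : ℕ → ℕ → ℝ}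

lemma sum_indicator_eq (n : ℕ) (A : ℕ → ℕ → ℝ) (l : ℝ) :
    ∑ i ∈ Finset.range n, {t : ℝ | l < |t|}.indicator (fun t => t ^ 2) (A i n) =
      ∑ i ∈ Finset.range n with l < |A i n|, A i n ^ 2 := by
  rw [Finset.sum_filter]
  refine Finset.sum_congr rfl fun i _ => ?_
  simp only [Set.indicator_apply, Set.mem_ofPred_eq]

/-- Normal convergence of the characteristic functions of the weighted sums when the large weights
are negligible. -/
theorem tendsto_prod_charFun_of_tendsto_sum (hZm : ∀ n, Measurable (Z n))
    (hZ : ∀ n, Integrable (Z n) F) (hZ2 : ∀ n, Integrable (fun x => Z n x ^ 2) F)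
    (h0 : ∀ n, ∫ x, Z n x ∂F = 0) (h1 : ∀ᶠ n in atTop, ∫ x, Z n x ^ 2 ∂F = 1)
    (hT : ∀ᶠ n in atTop, 0 < T n) (hT0 : Tendsto T atTop (𝓝 0)) {K : ℝ} (hK : 0 < K)
    (hbd : ∀ᶠ n in atTop, ∀ x, Z n x ^ 2 * T n ≤ K)
    (hA : ∀ n, 1 ≤ n → ∑ i ∈ Finset.range n, A i n ^ 2 = 1)
    (hlarge : ∀ l : ℝ, 0 < l → Tendsto (fun n => ∑ i ∈ Finset.range n with
      l * Real.sqrt (T n) < |A i n|, A i n ^ 2) atTop (𝓝 0)) (t : ℝ) :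
    Tendsto (fun n => ∏ i ∈ Finset.range n, charFun (F.map (Z n)) (A i n * t)) atTop
      (𝓝 (Real.exp (-t ^ 2 / 2) : ℝ)) := by
  rw [tendsto_iff_norm_sub_tendsto_zero, tendsto_order]
  refine ⟨fun r hr => Eventually.of_forall fun n => hr.trans_le (norm_nonneg _), fun η hη => ?_⟩
  set ε := min 1 (η / (4 * (t ^ 2 + 1))) with hε
  have hε0 : 0 < ε := by positivity
  have hε1 : ε ≤ 1 := min_le_left _ _
  have hεη : ε * (4 * (t ^ 2 + 1)) ≤ η := by
    have := min_le_right 1 (η / (4 * (t ^ 2 + 1)))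
    rwa [← hε, le_div_iff₀ (by positivity)] at this
  -- Chosen so that `|A i n| ≤ l √(T n)` and `Z n ^ 2 * T n ≤ K` give `|A i n * t * Z n| ≤ ε`.
  set l := ε / ((|t| + 1) * Real.sqrt K) with hl
  have hl0 : 0 < l := by positivity
  have hTsmall : Tendsto (fun n => t ^ 2 * l ^ 2 * T n) atTop (𝓝 0) := by
    simpa using hT0.const_mul (t ^ 2 * l ^ 2)
  have hbad : Tendsto (fun n => 5 * t ^ 2 * ∑ i ∈ Finset.range n with
      l * Real.sqrt (T n) < |A i n|, A i n ^ 2) atTop (𝓝 0) := by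
    simpa using (hlarge l hl0).const_mul (5 * t ^ 2)
  filter_upwards [h1, hT, hbd, hTsmall.eventually (gt_mem_nhds hε0),
    hbad.eventually (gt_mem_nhds (half_pos hη)), eventually_ge_atTop 1]
    with n h1 hT hbd hTs hbad hn
  have hprob : IsProbabilityMeasure (F.map (Z n)) :=
    Measure.isProbabilityMeasure_map (hZm n).aemeasurable
  set w : ℕ → ℂ := fun i => ((Real.exp (-((A i n * t) ^ 2 / 2)) : ℝ) : ℂ) with hw
  have hprod : ((Real.exp (-t ^ 2 / 2) : ℝ) : ℂ) = ∏ i ∈ Finset.range n, w i := by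
    rw [hw, ← Complex.ofReal_prod, ← Real.exp_sum, Finset.sum_neg_distrib, ← Finset.sum_div]
    simp_rw [mul_pow]
    rw [← Finset.sum_mul, hA n hn]
    congr 2
    ring
  have hterm : ∀ i ∈ Finset.range n, ‖charFun (F.map (Z n)) (A i n * t) - w i‖ ≤
      2 * ε * t ^ 2 * A i n ^ 2 +
        if l * Real.sqrt (T n) < |A i n| then 5 * t ^ 2 * A i n ^ 2 else 0 := by
    intro i _
    set u := A i n * t with hu
    obtain ⟨c1, c2⟩ := norm_charFun_map_sub_le (hZm n) (hZ n) (hZ2 n) (h0 n) h1 u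
    have hv : 0 ≤ u ^ 2 / 2 := by positivity
    obtain ⟨d1, d2⟩ := abs_exp_neg_sub_le hv
    have hsplit : ‖charFun (F.map (Z n)) u - w i‖ ≤
        ‖charFun (F.map (Z n)) u - (1 - u ^ 2 / 2)‖ +
          |Real.exp (-(u ^ 2 / 2)) - (1 - u ^ 2 / 2)| := by
      have e : ‖(1 - (u : ℂ) ^ 2 / 2) - w i‖ = |Real.exp (-(u ^ 2 / 2)) - (1 - u ^ 2 / 2)| := by
        rw [norm_sub_rev, ← Real.norm_eq_abs, ← Complex.norm_real]
        congr 1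
        simp only [hw, ← hu]
        push_cast
        rfl
      rw [← e]
      exact norm_sub_le_norm_sub_add_norm_sub _ _ _
    have hu2 : u ^ 2 = t ^ 2 * A i n ^ 2 := by
      rw [hu]
      ring
    split_ifs with hbig
    -- The crude bounds add up to `4 * u ^ 2 + u ^ 2 / 2 ≤ 5 * u ^ 2`.
    · have : 0 ≤ 2 * ε * t ^ 2 * A i n ^ 2 := by positivity
      nlinarith
    · rw [not_lt] at hbig
      have hAsq : A i n ^ 2 ≤ l ^ 2 * T n := by
        rw [← sq_abs]
        calc |A i n| ^ 2 ≤ (l * Real.sqrt (T n)) ^ 2 := pow_le_pow_left₀ (abs_nonneg _) hbig 2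
          _ = l ^ 2 * T n := by rw [mul_pow, Real.sq_sqrt hT.le]
      have hvε : u ^ 2 / 2 ≤ ε := by
        rw [hu2]
        nlinarith [mul_le_mul_of_nonneg_left hAsq (sq_nonneg t)]
      have hux : ∀ x, |u * Z n x| ≤ ε := by
        intro x
        refine abs_le_of_sq_le_sq ?_ hε0.le
        have hlt : l ^ 2 * (t ^ 2 * K) ≤ ε ^ 2 := by
          rw [hl, div_pow, mul_pow, Real.sq_sqrt hK.le, div_mul_eq_mul_div,
            div_le_iff₀ (by positivity)]
          have : t ^ 2 ≤ (|t| + 1) ^ 2 := by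
            rw [← sq_abs t]
            exact pow_le_pow_left₀ (abs_nonneg _) (by linarith) 2
          gcongr
        calc (u * Z n x) ^ 2 = A i n ^ 2 * (t ^ 2 * Z n x ^ 2) := by rw [hu]; ring
          _ ≤ l ^ 2 * T n * (t ^ 2 * Z n x ^ 2) := by gcongr
          _ = l ^ 2 * (t ^ 2 * (Z n x ^ 2 * T n)) := by ring
          _ ≤ l ^ 2 * (t ^ 2 * K) := by
              gcongr
              exact hbd x
          _ ≤ ε ^ 2 := hlt
      have c3 := c2 ε hε1 hux
      have d3 := d2 (hvε.trans hε1)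
      have d4 : (u ^ 2 / 2) ^ 2 ≤ ε * u ^ 2 := by nlinarith
      rw [add_zero, show 2 * ε * t ^ 2 * A i n ^ 2 = ε * u ^ 2 + ε * u ^ 2 by rw [hu2]; ring]
      linarith
  rw [hprod]
  calc ‖∏ i ∈ Finset.range n, charFun (F.map (Z n)) (A i n * t) - ∏ i ∈ Finset.range n, w i‖
      ≤ ∑ i ∈ Finset.range n, ‖charFun (F.map (Z n)) (A i n * t) - w i‖ := by
        refine norm_prod_sub_prod_le _ _ _ (fun i _ => norm_charFun_le_one _) fun i _ => ?_
        simp only [hw]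
        rw [Complex.norm_real, Real.norm_eq_abs, abs_of_pos (Real.exp_pos _), Real.exp_le_one_iff]
        linarith [sq_nonneg (A i n * t)]
    _ ≤ ∑ i ∈ Finset.range n, (2 * ε * t ^ 2 * A i n ^ 2 +
        if l * Real.sqrt (T n) < |A i n| then 5 * t ^ 2 * A i n ^ 2 else 0) :=
        Finset.sum_le_sum hterm
    _ = 2 * ε * t ^ 2 + 5 * t ^ 2 * ∑ i ∈ Finset.range n with
        l * Real.sqrt (T n) < |A i n|, A i n ^ 2 := by
        rw [Finset.sum_add_distrib, ← Finset.mul_sum, hA n hn, mul_one, ← Finset.sum_filter,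
          ← Finset.mul_sum]
    _ < η := by nlinarith

/-- Negligibility of the large weights when the characteristic functions of the weighted sums
converge to that of a standard normal variable. -/
theorem tendsto_sum_of_tendsto_prod_charFun (hZm : ∀ n, Measurable (Z n))
    (hZ : ∀ n, Integrable (Z n) F) (hZ2 : ∀ n, Integrable (fun x => Z n x ^ 2) F)
    (h0 : ∀ n, ∫ x, Z n x ∂F = 0) (h1 : ∀ᶠ n in atTop, ∫ x, Z n x ^ 2 ∂F = 1)
    (hT : ∀ᶠ n in atTop, 0 < T n)
    (hnull : ∀ t : ℝ, Tendsto (fun n => ∫ x, min 2 (t ^ 2 * Z n x ^ 2) ∂F) atTop (𝓝 0))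
    {k : ℝ} (hk : 0 < k) {I : ℕ → Set ℝ} {B : Set ℝ} (hI : ∀ n, MeasurableSet (I n))
    (hB : MeasurableSet B) (hFB : 1 / 2 ≤ F.real B)
    (hspread : ∀ᶠ n in atTop, T n ≤ F.real (I n) ∧
      ∀ x ∈ I n, ∀ y ∈ B, k ≤ (Z n x - Z n y) ^ 2 * T n)
    (hA : ∀ n, 1 ≤ n → ∑ i ∈ Finset.range n, A i n ^ 2 = 1)
    (hconv : ∀ t : ℝ, Tendsto
      (fun n => ∏ i ∈ Finset.range n, charFun (F.map (Z n)) (A i n * t)) atTop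
      (𝓝 (Real.exp (-t ^ 2 / 2) : ℝ))) {l : ℝ} (hl : 0 < l) :
    Tendsto (fun n => ∑ i ∈ Finset.range n with l * Real.sqrt (T n) < |A i n|, A i n ^ 2) atTop
      (𝓝 0) := by
  -- For a weight above `l √(T n)` this makes `(A i n * t * (Z x - Z y)) ^ 2 ≥ 9`, a range in which
  -- the quadratic clearly dominates `1 - cos`.
  set t := 3 / (l * Real.sqrt k) with ht
  have ht0 : 0 < t := by positivity
  have htk : l ^ 2 * t ^ 2 * k = 9 := by
    rw [ht, div_pow, mul_pow, Real.sq_sqrt hk.le]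
    field_simp
    norm_num
  have hlog : Tendsto (fun n => -Real.log (∏ i ∈ Finset.range n,
      ‖charFun (F.map (Z n)) (A i n * t)‖ ^ 2)) atTop (𝓝 (t ^ 2)) := by
    have h2 := ((hconv t).norm.pow 2).log (by
      rw [Complex.norm_real, Real.norm_eq_abs, abs_of_pos (Real.exp_pos _)]
      positivity)
    have h3 := h2.neg
    have e : -Real.log (‖((Real.exp (-t ^ 2 / 2) : ℝ) : ℂ)‖ ^ 2) = t ^ 2 := by
      rw [Complex.norm_real, Real.norm_eq_abs, abs_of_pos (Real.exp_pos _), Real.log_pow,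
        Real.log_exp]
      push_cast
      ring
    rw [e] at h3
    refine h3.congr fun n => ?_
    rw [norm_prod, Finset.prod_pow]
  rw [tendsto_order]
  refine ⟨fun r hr => Eventually.of_forall fun n =>
    hr.trans_le (Finset.sum_nonneg fun _ _ => sq_nonneg _), fun η hη => ?_⟩
  -- The total gap will be at most `2 * δ * t ^ 2`, whence a sum over large weights of at most `16 *
  -- δ / k ≤ η / 2`.
  set δ := min (1 / 2) (η * k / 32) with hδ
  have hδ0 : 0 < δ := by positivity
  have hδ2 : δ ≤ 1 / 2 := min_le_left _ _
  have hδη : δ ≤ η * k / 32 := min_le_right _ _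
  have hnull' : Tendsto (fun n => 2 * ∫ x, min 2 (t ^ 2 * Z n x ^ 2) ∂F) atTop (𝓝 0) := by
    simpa using (hnull t).const_mul 2
  have hlt : (1 - δ) * t ^ 2 < t ^ 2 := by nlinarith [mul_pos hδ0 (sq_pos_of_pos ht0)]
  filter_upwards [h1, hT, hspread, hnull'.eventually (gt_mem_nhds hδ0),
    hlog.eventually (lt_mem_nhds hlt), eventually_ge_atTop 1] with n h1 hT hspread hn1 hn2 hn
  have hprob : IsProbabilityMeasure (F.map (Z n)) :=
    Measure.isProbabilityMeasure_map (hZm n).aemeasurable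
  have hAle : ∀ i ∈ Finset.range n, |A i n * t| ≤ |t| := by
    intro i hi
    have h2 : A i n ^ 2 ≤ 1 := by
      rw [← hA n hn]
      exact Finset.single_le_sum (f := fun i => A i n ^ 2) (fun _ _ => sq_nonneg _) hi
    rw [abs_mul]
    have : |A i n| ≤ 1 := abs_le_one_iff_mul_self_le_one.2 (by nlinarith)
    nlinarith [abs_nonneg t]
  -- One factor `1 - δ` comes from comparing `1 - x` with `-log x` for `x ≥ 1 - δ`, the other from
  -- the convergence of the logarithm to `t ^ 2`.
  have hsum : (1 - δ) * ((1 - δ) * t ^ 2) ≤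
      ∑ i ∈ Finset.range n, (1 - ‖charFun (F.map (Z n)) (A i n * t)‖ ^ 2) := by
    refine le_trans ?_ (mul_neg_log_le_sum_one_sub (Finset.range n)
      (fun i => ‖charFun (F.map (Z n)) (A i n * t)‖ ^ 2) (δ := 1 - δ) (by linarith)
      (fun i hi => ?_) fun i _ => norm_charFun_sq_le_one _)
    · gcongr
      linarith
    · have := one_sub_norm_charFun_map_sq_le (F := F) (hZm n) (hAle i hi)
      linarith
  have hgap : ∀ i ∈ Finset.range n,
      (if l * Real.sqrt (T n) < |A i n| then t ^ 2 * k / 8 * A i n ^ 2 else 0) ≤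
        (A i n * t) ^ 2 - (1 - ‖charFun (F.map (Z n)) (A i n * t)‖ ^ 2) := by
    intro i _
    split_ifs with hbig
    · have hAsq : l ^ 2 * T n ≤ A i n ^ 2 := by
        rw [← sq_abs (A i n)]
        calc l ^ 2 * T n = (l * Real.sqrt (T n)) ^ 2 := by rw [mul_pow, Real.sq_sqrt hT.le]
          _ ≤ |A i n| ^ 2 := pow_le_pow_left₀ (by positivity) hbig.le 2
      have h2 := mul_le_sq_sub_one_sub_norm_charFun_map_sq (hZm n) (hZ n) (hZ2 n) (h0 n) h1
        (A i n * t) (m := (A i n * t) ^ 2 * (k / T n) / 4) (hI n) hB fun x hx y hy => by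
          have h3 := hspread.2 x hx y hy
          rw [← div_le_iff₀ hT] at h3
          set d := Z n x - Z n y
          have h4 : (A i n * t) ^ 2 * (k / T n) ≤ (A i n * t * d) ^ 2 := by
            rw [mul_pow _ d]
            gcongr
          have h5 : 9 ≤ (A i n * t) ^ 2 * (k / T n) := by
            rw [← mul_div_assoc, le_div_iff₀ hT]
            calc 9 * T n = l ^ 2 * T n * (t ^ 2 * k) := by rw [← htk]; ring
              _ ≤ A i n ^ 2 * (t ^ 2 * k) := by gcongr
              _ = (A i n * t) ^ 2 * k := by ring
          -- With `v = A i n * t * d`: `1 - cos v ≤ 2` and `v ^ 2 ≥ 9 > 8` give `v ^ 2 / 2 - (1 -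
          -- cos v) ≥ v ^ 2 / 4`.
          linarith [Real.neg_one_le_cos (A i n * t * d)]
      refine le_trans ?_ h2
      have hTI : T n * (1 / 2) ≤ F.real (I n) * F.real B := by
        gcongr
        exact hspread.1
      calc t ^ 2 * k / 8 * A i n ^ 2 = (A i n * t) ^ 2 * (k / T n) / 4 * (T n * (1 / 2)) := by
            field_simp
            ring
        _ ≤ (A i n * t) ^ 2 * (k / T n) / 4 * (F.real (I n) * F.real B) := by gcongr
        _ = _ := by ring
    · have := mul_le_sq_sub_one_sub_norm_charFun_map_sq (hZm n) (hZ n) (hZ2 n) (h0 n) h1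
        (A i n * t) (m := 0) (hI n) hB fun x _ y _ => by
          linarith [Real.one_sub_sq_div_two_le_cos (x := A i n * t * (Z n x - Z n y))]
      linarith
  have htot := Finset.sum_le_sum hgap
  rw [Finset.sum_sub_distrib, ← Finset.sum_filter, ← Finset.mul_sum] at htot
  simp_rw [mul_pow] at htot
  rw [← Finset.sum_mul, hA n hn, one_mul] at htot
  have hfin : t ^ 2 * (k / 8 * ∑ i ∈ Finset.range n with l * Real.sqrt (T n) < |A i n|, A i n ^ 2) ≤
      t ^ 2 * (2 * δ) := by
    have : t ^ 2 - (1 - δ) * ((1 - δ) * t ^ 2) ≤ t ^ 2 * (2 * δ) := by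
      nlinarith [mul_nonneg (sq_nonneg t) (sq_nonneg δ)]
    linarith
  have hfin2 := le_of_mul_le_mul_left hfin (by positivity)
  set Sb := ∑ i ∈ Finset.range n with l * Real.sqrt (T n) < |A i n|, A i n ^ 2
  have h6 : k * Sb ≤ k * (η / 2) := by linarith
  linarith [le_of_mul_le_mul_left h6 hk]

end TriangularArray

/-! ### Weighted sums of independent variables and the continuity theorem. -/

section WeightedSums

variable {Ω : Type*} [MeasurableSpace Ω] {P : Measure Ω} {F : Measure ℝ} {X : ℕ → Ω → ℝ}

lemma charFun_map_weighted_sum (hX_indep : iIndepFun X P) (hX_law : ∀ i, HasLaw (X i) F P)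
    {Z : ℝ → ℝ} (hZ : Measurable Z) (w : ℕ → ℝ) (n : ℕ) (t : ℝ) :
    charFun (P.map fun ω => ∑ i ∈ Finset.range n, w i * Z (X i ω)) t =
      ∏ i ∈ Finset.range n, charFun (F.map Z) (w i * t) := by
  have hXm : ∀ i, AEMeasurable (X i) P := fun i => (hX_law i).aemeasurable
  have hind : iIndepFun (fun i ω => w i * Z (X i ω)) P :=
    hX_indep.comp (fun i x => w i * Z x) fun i => hZ.const_mul _
  have hZX : ∀ i, AEMeasurable (fun ω => Z (X i ω)) P := fun i => hZ.comp_aemeasurable (hXm i)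
  rw [(hind.restrict (Finset.range n)).charFun_map_fun_finsetSum_eq_prod
    (fun i _ => (hZX i).const_mul _), Finset.prod_apply]
  refine Finset.prod_congr rfl fun i _ => ?_
  rw [charFun_map_mul_comp (hZX i)]
  congr 1
  rw [← (hX_law i).map_eq, AEMeasurable.map_map_of_aemeasurable hZ.aemeasurable (hXm i)]
  rfl

variable [IsProbabilityMeasure P]

lemma tendstoInDistribution_weighted_sum_iff (hX_indep : iIndepFun X P)
    (hX_law : ∀ i, HasLaw (X i) F P) {Z : ℕ → ℝ → ℝ} (hZ : ∀ n, Measurable (Z n))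
    (A : ℕ → ℕ → ℝ) :
    TendstoInDistribution (fun (n : ℕ) (ω : Ω) => ∑ i ∈ Finset.range n, A i n * Z n (X i ω))
        atTop (fun y : ℝ => y) (fun _ => P) (gaussianReal 0 1) ↔
      ∀ t : ℝ, Tendsto (fun n => ∏ i ∈ Finset.range n, charFun (F.map (Z n)) (A i n * t)) atTop
        (𝓝 (Real.exp (-t ^ 2 / 2) : ℝ)) := by
  have hm : ∀ n : ℕ, AEMeasurable
      (fun ω => ∑ i ∈ Finset.range n, A i n * Z n (X i ω)) P := fun n =>
    Finset.aemeasurable_fun_sum _ fun i _ =>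
      ((hZ n).comp_aemeasurable (hX_law i).aemeasurable).const_mul _
  have hg : ∀ t : ℝ, charFun ((gaussianReal 0 1).map fun y : ℝ => y) t =
      (Real.exp (-t ^ 2 / 2) : ℝ) := fun t => by
    rw [show (gaussianReal 0 1).map (fun y : ℝ => y) = gaussianReal 0 1 from Measure.map_id,
      charFun_gaussianReal]
    push_cast
    congr 1
    simp
    ring
  constructor
  · intro h t
    have h1 := (ProbabilityMeasure.tendsto_iff_tendsto_charFun.1 h.tendsto) t
    simp only [ProbabilityMeasure.coe_mk, hg] at h1
    refine h1.congr fun n => ?_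
    exact charFun_map_weighted_sum hX_indep hX_law (hZ n) (fun i => A i n) n t
  · intro h
    refine ⟨hm, by fun_prop, ProbabilityMeasure.tendsto_iff_tendsto_charFun.2 fun t => ?_⟩
    simp only [ProbabilityMeasure.coe_mk, hg]
    refine (h t).congr fun n => ?_
    exact (charFun_map_weighted_sum hX_indep hX_law (hZ n) (fun i => A i n) n t).symm

end WeightedSums

end TruncatedStable

open TruncatedStable in
/-- `X i` and `A i n`, `i = 0, …, n - 1`, are the `n` variables and constants of the `n`-th row. -/
theorem lemma2p1p2
    {Ω : Type*} [MeasurableSpace Ω] (P : Measure Ω) [IsProbabilityMeasure P]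
    (F : Measure ℝ) [IsProbabilityMeasure F]
    (α : ℝ) (hα_pos : 0 < α) (hα_lt : α < 2) (hF : InStableDomain α F)
    (hp : ¬ (tail F =o[atTop] absTail F))
    (X : ℕ → Ω → ℝ) (hX_indep : iIndepFun X P) (hX_law : ∀ i, HasLaw (X i) F P)
    (a b : ℕ → ℝ) (ha : Tendsto a atTop atBot) (hb : Tendsto b atTop atTop)
    (hab : (∃ l : ℝ, 0 < l ∧ Tendsto (fun n => b n / (-a n)) atTop (𝓝 l)) ∨
      Tendsto (fun n => b n / (-a n)) atTop atTop)
    (A : ℕ → ℕ → ℝ) (hA : ∀ n, 1 ≤ n → ∑ i ∈ Finset.range n, A i n ^ 2 = 1) :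
    TendstoInDistribution
        (fun (n : ℕ) (ω : Ω) =>
          ∑ i ∈ Finset.range n, A i n * standardize F (a n) (b n) (X i ω))
        atTop (fun y : ℝ => y) (fun _ => P) (gaussianReal 0 1) ↔
      ∀ l : ℝ, 0 < l →
        Tendsto (fun n : ℕ => ∑ i ∈ Finset.range n,
            {t : ℝ | l * Real.sqrt (tail F (b n)) < |t|}.indicator (fun t => t ^ 2) (A i n))
          atTop (𝓝 0) := by
  obtain ⟨⟨C₀, hsq⟩, ⟨κ, hκ0, -, hdouble⟩, hinf⟩ := tail_regularity hα_pos hα_lt hF hp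
  obtain ⟨C, hC⟩ := eventually_neg_le_mul ha hab
  obtain ⟨hpos, ⟨K, hK, hbd⟩, ⟨M, k, hk, hM, hspread⟩, hnull⟩ :=
    standardize_estimates hκ0 hsq hdouble hinf ha hb hC
  have hZm : ∀ n, Measurable (standardize F (a n) (b n)) := fun n => measurable_standardize _ _
  have hZ : ∀ n, Integrable (standardize F (a n) (b n)) F := fun n => integrable_standardize _ _
  have hZ2 : ∀ n, Integrable (fun x => standardize F (a n) (b n) x ^ 2) F := fun n =>
    integrable_standardize_sq _ _
  have h0 : ∀ n, ∫ x, standardize F (a n) (b n) x ∂F = 0 := fun n => integral_standardize _ _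
  have h1 : ∀ᶠ n in atTop, ∫ x, standardize F (a n) (b n) x ^ 2 ∂F = 1 :=
    hpos.mono fun n hn => integral_standardize_sq hn.1
  have hT : ∀ᶠ n in atTop, 0 < tail F (b n) := hpos.mono fun n hn => hn.2
  rw [tendstoInDistribution_weighted_sum_iff hX_indep hX_law
    (Z := fun n => standardize F (a n) (b n)) hZm A]
  simp only [sum_indicator_eq]
  constructor
  · intro h l hl
    exact tendsto_sum_of_tendsto_prod_charFun (T := fun n => tail F (b n))
      (I := fun n => Set.Ioc (κ * b n) (b n)) (B := {x | |x| ≤ M}) hZm hZ hZ2 h0 h1 hT hnull hk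
      (fun n => measurableSet_Ioc) (measurableSet_le (by fun_prop) (by fun_prop)) hM hspread hA h hl
  · intro h t
    exact tendsto_prod_charFun_of_tendsto_sum (T := fun n => tail F (b n)) hZm hZ hZ2 h0 h1 hT
      ((tendsto_tail F).comp hb) hK hbd hA h t
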